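/- **Setting.** Let $\mathcal A$ be a unital $*$-algebra over $\mathbb C$ on which space-time translations $T_\tau T_{\bf x}$ $(\tau\in\mathbb R,\ {\bf x}\in\mathbb R^d)$ act as $*$-automorphisms; write $A(\tau,{\bf x})=T_\tau T_{\bf x}A$. Let $\omega$ be a translation-invariant stationary state with $\omega(1)=1$, let $\mathcal H=\mathcal A\Phi$ be the pre-Hilbert space of its GNS representation, and suppose that the translations act strongly continuously on $\mathcal H$. Let $\mathfrak h=\mathcal S(\mathbb R^d,\mathbb C^m)$ be the elementary space in momentum representation, with the $L^2$ metric and with $T_\tau T_{\bf x}$ acting as multiplication by $e^{i{\bf k x}}e^{-i\tau E({\bf k})}$, where $E({\bf k})$ is a non-degenerate Hermitian $m\times m$ matrix, smooth in ${\bf k}$ with all derivatives of at most polynomial growth. Let $\Phi:\mathfrak h\to\mathcal H$ be an elementary excitation, i.e. a linear isometric map commuting with translations. Let $A_1,\dots,A_m\in\mathcal A$ act by bounded operators on $\mathcal H$ and commute asymptotically: for all $i,j,n$ there is a polynomial $C_n$ with $\|[A_i(\tau,{\bf x}),A_j]\|\le C_n(\tau)/(1+\|{\bf x}\|^n)$.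 Let $\alpha_i^j\in\mathcal S(\mathbb R^{d+1})$ and $A'_i=\int \alpha_i^j(\tau,{\bf x})A_j(\tau,{\bf x})\,d\tau d{\bf x}\in\mathcal A$ (an equality of operators on $\mathcal H$; repeated indices are summed). Suppose that the orthogonal projections of $A_i\Phi$ and $A_i'\Phi$ on the one-particle space $\Phi(\mathfrak h)$ are $\Phi(T_i)$ and $\Phi(T'_i)$ with $T_i,T'_i\in\mathfrak h$, and that the matrix $T({\bf k})=(T_i^\beta({\bf k}))$ (row index $i$) is invertible for all ${\bf k}$; $T'({\bf k})$ is defined in the same way. Let $H({\bf k})$ be the matrix of $E({\bf k})$ in the basis $T_1({\bf k}),\dots,T_m({\bf k})$, i.e. $E({\bf k})T_j({\bf k})=\sum_l H_{jl}({\bf k})T_l({\bf k})$. For an $m\times m$ matrix $M$ put $$\alpha(M,{\bf k})_{ij}=\sum_l\int \alpha_i^l(\tau,{\bf x})\,e^{i{\bf kx}}\,(e^{-i\tau M})_{lj}\,d\tau d{\bf x}.$$ The matrix $\alpha(E({\bf k}),{\bf k})$ acting on operator indices is $\alpha(H({\bf k}),{\bf k})$ (if $E({\bf k})$ is a scalar,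 then $H=E$). **Green functions and polar parts.** Fix $r,a\ge 0$. Legs $i\le a$ are incoming, legs $a<i\le r$ are outgoing. The Green function is $$G_r(\tau_1,{\bf x}_1,j_1,\dots,\tau_r,{\bf x}_r,j_r)=\omega\big(T(A_{j_1}(\tau_1,{\bf x}_1)\cdots A_{j_a}(\tau_a,{\bf x}_a)A^*_{j_{a+1}}(\tau_{a+1},{\bf x}_{a+1})\cdots A^*_{j_r}(\tau_r,{\bf x}_r))\big),$$ where $T$ is the chronological product; for self-adjoint $A_j$ the star may be omitted. Energies and momenta of outgoing legs are taken with the opposite sign. For a matrix $M$ attached to leg $i$ write $M^{(i)}=M$ if the leg is incoming, and $M^{(i)}=\overline M$ (entrywise complex conjugate) if it is outgoing. A *wave packet* of leg $i$ is a function $f_i^j({\bf k})\,(e^{i\tau E({\bf k})})^{(i)}_{\mu\nu}$ with $f_i\in C_c^\infty(\mathbb R^d,\mathbb C^m)$. A set $K$ of velocities gives an essential support $\tau K$ of $f_i$ if, for every $n$, all its packets in ${\bf x}$-space (the Fourier factor being $(2\pi)^{-d}e^{-i{\bf kx}}$ for incoming and $(2\pi)^{-d}e^{i{\bf kx}}$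 for outgoing legs) are bounded by $c_n(1+{\bf x}^2+\tau^2)^{-n}$ for ${\bf x}/\tau\notin K$, $\tau\ne0$. A family $(f_1,\dots,f_r)$ is *non-overlapping* if there are such sets $K_i$ with positive distances $d(K_i,K_j)$ for $i\neq j$ both incoming and for $i\ne j$ both outgoing. A generalized function $C({\bf k}_1,\dots,{\bf k}_r)$ with values in $(\mathbb C^m)^{\otimes r}$ (a continuous multilinear functional of $f_1,\dots,f_r$) is a *polar coefficient* of $G_r$ if in $(\tau,{\bf k})$-representation $$G_r(\tau_1,{\bf k}_1,\dots,\tau_r,{\bf k}_r)-\bigotimes_{i}\big(e^{-i\tau_iH({\bf k}_i)}\big)^{(i)}\,C({\bf k}_1,\dots,{\bf k}_r)\longrightarrow 0$$ as the times of incoming legs tend to $-\infty$ and those of outgoing legs to $+\infty$ with bounded ratios, when tested with any non-overlapping family of wave packets. The *polar part* in $(\varepsilon,{\bf k})$-representation is then $$P_r(\varepsilon_1,{\bf k}_1,\dots,\varepsilon_r,{\bf k}_r)=\bigotimes_i i\,\big(H^{(i)}({\bf k}_i)-\varepsilon_i\big)^{-1}C({\bf k}_1,\dots,{\bf k}_r),\qquad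 \operatorname{Im}\varepsilon_i<0,$$ whose boundary value at real energies is given by $(H-\varepsilon+i0)^{-1}$. The *normalized polar part* is $\tilde P_r=\bigotimes_i (T({\bf k}_i)^{-1})^{(i)}P_r$. For $A'$ the polar coefficient, $P'_r$ and $\tilde P'_r$ are defined in the same way with $T$ replaced by $T'$, when $T'({\bf k})$ is invertible for all ${\bf k}$. **Claim.** 1. $T'_i({\bf k})=\sum_j\Big(\int \alpha_i^j(\tau,{\bf x})\,e^{i{\bf kx}-iE({\bf k})\tau}\,d\tau d{\bf x}\Big)T_j({\bf k})$ for all $i$ and ${\bf k}$; equivalently $T'({\bf k})=\alpha(E({\bf k}),{\bf k})\,T({\bf k})$, where $\alpha(E({\bf k}),{\bf k})=\alpha(H({\bf k}),{\bf k})$ acts on operator indices. 2. Suppose that $T'({\bf k})$ is invertible for all ${\bf k}$. If the Green function $G_r$ of $A_1,\dots,A_m$ has a polar coefficient $C$, then $\bigotimes_i\alpha(E({\bf k}_i),{\bf k}_i)^{(i)}\,C$ is a polar coefficient of the Green function $G_r'$ of $A_1',\dots,A'_m$, and for every polar coefficient of $G'_r$ the polar parts satisfy, on non-overlapping families of test functions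 of the momenta and for all $\operatorname{Im}\varepsilon_i<0$, $$P'_r(\varepsilon_1,{\bf k}_1,\dots,\varepsilon_r,{\bf k}_r)=\alpha(E({\bf k}_1),{\bf k}_1)^{(1)}\otimes\dots\otimes\alpha(E({\bf k}_r),{\bf k}_r)^{(r)}\,P_r(\varepsilon_1,{\bf k}_1,\dots,\varepsilon_r,{\bf k}_r).$$ 3. Hence, in the same situation and sense, the normalized polar parts of the Green functions of $A_1,\dots,A_m$ and $A'_1,\dots,A'_m$ coincide: $$\tilde P'_r(\varepsilon_1,{\bf k}_1,\dots,\varepsilon_r,{\bf k}_r)=\tilde P_r(\varepsilon_1,{\bf k}_1,\dots,\varepsilon_r,{\bf k}_r).$$ -/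

import Mathlib

open MeasureTheory Filter Topology
open scoped SchwartzMap

namespace AQFT

/-- Momentum space, also used for the spatial variable. -/
abbrev Space (d : ℕ) := EuclideanSpace ℝ (Fin d)

/-- A unital `*`-algebra over `ℂ` with space-time translations `(τ, x) ↦ T_τ T_x` acting by
`*`-automorphisms, and a stationary translation-invariant normalized state `ω`.  The last field
says that the translations act strongly continuously in the GNS representation. -/
structure TranslationInvariantState (d : ℕ) (𝒜 : Type*) [Ring 𝒜] [StarRing 𝒜] [Algebra ℂ 𝒜]
    [StarModule ℂ 𝒜] where
  trans : ℝ × Space d → 𝒜 ≃⋆ₐ[ℂ] 𝒜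
  trans_add : ∀ p q a, trans (p + q) a = trans p (trans q a)
  ω : 𝒜 →ₗ[ℂ] ℂ
  ω_nonneg : ∀ a, 0 ≤ (ω (star a * a)).re ∧ (ω (star a * a)).im = 0
  ω_one : ω 1 = 1
  ω_trans : ∀ p a, ω (trans p a) = ω a
  trans_continuous : ∀ a,
    Tendsto (fun p => (ω (star (trans p a - a) * (trans p a - a))).re) (𝓝 0) (𝓝 0)

section GNS

variable {d : ℕ} {𝒜 : Type*} [Ring 𝒜] [StarRing 𝒜] [Algebra ℂ 𝒜] [StarModule ℂ 𝒜]

theorem TranslationInvariantState.ω_star (S : TranslationInvariantState d 𝒜) (a : 𝒜) :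
    S.ω (star a) = (starRingEnd ℂ) (S.ω a) := by
  have h0 := (S.ω_nonneg a).2
  have h1 := (S.ω_nonneg (1 + a)).2
  have h2 := (S.ω_nonneg (1 + Complex.I • a)).2
  have hone : (S.ω 1).im = 0 := by rw [S.ω_one]; simp
  simp only [star_add, star_one, star_smul, mul_add, add_mul, one_mul, mul_one, map_add,
    Complex.add_im, smul_mul_assoc, mul_smul_comm, map_smul, smul_eq_mul, Complex.star_def,
    Complex.conj_I, Complex.mul_im, Complex.neg_re, Complex.neg_im, Complex.I_re,
    Complex.I_im, Complex.mul_re, hone, h0] at h1 h2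
  apply Complex.ext
  · rw [Complex.conj_re]; linarith
  · rw [Complex.conj_im]; linarith

set_option linter.unusedVariables false in
/-- The algebra itself, with the semi-inner product `⟨a, b⟩ = ω (a^* b)`. -/
def PreGNS (S : TranslationInvariantState d 𝒜) := 𝒜

variable (S : TranslationInvariantState d 𝒜)

instance : AddCommGroup (PreGNS S) := inferInstanceAs (AddCommGroup 𝒜)
instance : Module ℂ (PreGNS S) := inferInstanceAs (Module ℂ 𝒜)

/-- The identity map from the algebra to `PreGNS S`. -/
def toPreGNS : 𝒜 ≃ₗ[ℂ] PreGNS S := LinearEquiv.refl ℂ _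

noncomputable abbrev preGNSCore : PreInnerProductSpace.Core ℂ (PreGNS S) where
  inner a b := S.ω (star ((toPreGNS S).symm a) * (toPreGNS S).symm b)
  conj_inner_symm a b := by rw [← S.ω_star]; simp
  re_inner_nonneg a := (S.ω_nonneg _).1
  add_left a b c := by rw [map_add, star_add, add_mul, map_add]
  smul_left a b r := by simp

noncomputable instance : SeminormedAddCommGroup (PreGNS S) :=
  InnerProductSpace.Core.toSeminormedAddCommGroup (c := preGNSCore S)

noncomputable instance : InnerProductSpace ℂ (PreGNS S) :=
  InnerProductSpace.ofCore (preGNSCore S)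

/-- The pre-Hilbert space `ℋ = 𝒜 Φ` of the GNS representation: the quotient of the algebra by the
null vectors of `ω (a^* b)`. -/
abbrev GNS := SeparationQuotient (PreGNS S)

/-- The vector `A Φ` of the GNS space, `Φ` being the cyclic vector. -/
noncomputable def vec (a : 𝒜) : GNS S := SeparationQuotient.mk (toPreGNS S a)

theorem inner_vec (a b : 𝒜) : inner ℂ (vec S a) (vec S b) = S.ω (star a * b) := rfl

/-- `‖X‖ ≤ B` for the operator by which `X` acts on the GNS space. -/
def OpNormLE (X : 𝒜) (B : ℝ) : Prop := ∀ Y : 𝒜, ‖vec S (X * Y)‖ ≤ B * ‖vec S Y‖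

/-- Asymptotic commutativity of the family `A`. -/
def AsymptoticallyCommute {m : ℕ} (A : Fin m → 𝒜) : Prop :=
  ∀ (i j : Fin m) (n : ℕ), ∃ c : Polynomial ℝ, ∀ (τ : ℝ) (x : Space d),
    OpNormLE S (S.trans (τ, x) (A i) * A j - A j * S.trans (τ, x) (A i))
      (c.eval τ / (1 + ‖x‖ ^ n))

/-- `A'_i = ∫ α_i^j(τ, x) A_j(τ, x) dτ dx` as operators on the GNS space: the equality holds for
all matrix elements `⟨· Y Φ, X^* Φ⟩`. -/
def IsSmearing {m : ℕ} (α : Fin m → Fin m → 𝓢(ℝ × Space d, ℂ)) (A A' : Fin m → 𝒜) : Prop :=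
  ∀ (i : Fin m) (X Y : 𝒜),
    S.ω (X * A' i * Y) = ∑ j, ∫ p : ℝ × Space d, α i j p * S.ω (X * S.trans p (A j) * Y)

end GNS

/-! ### The elementary space -/

/-- The elementary space in momentum representation. -/
abbrev ElemSpace (d m : ℕ) := 𝓢(Space d, EuclideanSpace ℂ (Fin m))

/-- The matrix `E(k)` governing the time translations of the elementary space: a non-degenerate
Hermitian matrix depending smoothly on `k`, of at most polynomial growth. -/
structure Dispersion (d m : ℕ) where
  E : Space d → Matrix (Fin m) (Fin m) ℂ
  hermitian : ∀ k, (E k).IsHermitian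
  nondegenerate : ∀ k, (E k).det ≠ 0
  growth : ∀ i j, Function.HasTemperateGrowth (fun k => E k i j)

/-- `exp (i t M)`. -/
noncomputable def expI {m : ℕ} (t : ℝ) (M : Matrix (Fin m) (Fin m) ℂ) :
    Matrix (Fin m) (Fin m) ℂ :=
  NormedSpace.exp ((Complex.I * (t : ℂ)) • M)

/-- `exp (i k x)`. -/
noncomputable def planeWave {d : ℕ} (k x : Space d) : ℂ :=
  Complex.exp (Complex.I * ((inner ℝ k x : ℝ) : ℂ))

section Excitation

variable {d m : ℕ} {𝒜 : Type*} [Ring 𝒜] [StarRing 𝒜] [Algebra ℂ 𝒜] [StarModule ℂ 𝒜]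

/-- An elementary excitation: an isometric map of the elementary space to the GNS space that
commutes with space-time translations, where `T_τ T_x` acts on the elementary space as
multiplication by `exp (i k x) exp (- i τ E(k))`. -/
structure ElementaryExcitation (S : TranslationInvariantState d 𝒜) (D : Dispersion d m) where
  toFun : ElemSpace d m →ₗ[ℂ] GNS S
  isometric : ∀ f g, inner ℂ (toFun f) (toFun g) = ∫ k, inner ℂ (f k) (g k)
  equivariant : ∀ (τ : ℝ) (x : Space d) (f : ElemSpace d m), ∃ g : ElemSpace d m,
    (∀ k β, g k β = planeWave k x * (expI (-τ) (D.E k)).mulVec (f k).ofLp β) ∧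
      ∀ a : 𝒜, vec S a = toFun f → vec S (S.trans (τ, x) a) = toFun g

/-- `t` is the projection of the vector `A Φ` on the one-particle space, considered as an element
of the elementary space. -/
def IsOneParticleProjection {S : TranslationInvariantState d 𝒜} {D : Dispersion d m}
    (Φ : ElementaryExcitation S D) (a : 𝒜) (t : ElemSpace d m) : Prop :=
  ∀ f : ElemSpace d m, inner ℂ (Φ.toFun f) (vec S a - Φ.toFun t) = 0

/-- The matrix `T(k) = (T_i^α(k))`, with row index `i`. -/
noncomputable def ampMatrix (t : Fin m → ElemSpace d m) (k : Space d) : Matrix (Fin m) (Fin m) ℂ :=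
  Matrix.of fun i α => t i k α

/-- The operator `E(k)` written in the basis `T_1(k), …, T_m(k)`, i.e. the matrix `H` with
`E(k) T_j(k) = ∑ l, H j l • T_l(k)`.  It equals `E(k)ᵀ` when `T(k)` commutes with `E(k)ᵀ`. -/
noncomputable def opEnergy (D : Dispersion d m) (t : Fin m → ElemSpace d m) (k : Space d) :
    Matrix (Fin m) (Fin m) ℂ :=
  ampMatrix t k * (D.E k).transpose * (ampMatrix t k)⁻¹

theorem mulVec_eq_opEnergy (D : Dispersion d m) (t : Fin m → ElemSpace d m) (k : Space d)
    (ht : (ampMatrix t k).det ≠ 0) (j β : Fin m) :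
    (D.E k).mulVec (t j k).ofLp β = ∑ l, opEnergy D t k j l * t l k β := by
  have h : opEnergy D t k * ampMatrix t k = ampMatrix t k * (D.E k).transpose := by
    rw [opEnergy, Matrix.mul_assoc, Matrix.nonsing_inv_mul _ (isUnit_iff_ne_zero.mpr ht),
      Matrix.mul_one]
  have h2 := congrFun (congrFun h j) β
  simp only [Matrix.mul_apply, ampMatrix, Matrix.of_apply, Matrix.transpose_apply] at h2
  rw [h2]
  simp [Matrix.mulVec, dotProduct, mul_comm]

/-- `α(H, k) = ∫ α(τ, x) exp (i k x) exp (- i τ H) dτ dx` for an `m × m` matrix `H` acting on the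
same indices as the matrix-valued function `α`. -/
noncomputable def symbolAt (α : Fin m → Fin m → 𝓢(ℝ × Space d, ℂ))
    (H : Matrix (Fin m) (Fin m) ℂ) (k : Space d) : Matrix (Fin m) (Fin m) ℂ :=
  Matrix.of fun i j => ∑ l, ∫ p : ℝ × Space d, α i l p * planeWave k p.2 * expI (-p.1) H l j

end Excitation

/-! ### Green functions and their polar parts

The arguments of the Green function are split in two groups: leg `i : Fin r` is incoming if
`i < a` (its time tends to `-∞`) and outgoing if `a ≤ i` (its time tends to `+∞`). -/

section Polar

variable {d m r : ℕ} {𝒜 : Type*} [Ring 𝒜] [StarRing 𝒜] [Algebra ℂ 𝒜] [StarModule ℂ 𝒜]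

/-- `z` for an incoming leg, the complex conjugate of `z` for an outgoing leg. -/
noncomputable def legConj (a : ℕ) (i : Fin r) (z : ℂ) : ℂ :=
  if i.val < a then z else (starRingEnd ℂ) z

/-- `M` for an incoming leg, the entrywise complex conjugate of `M` for an outgoing leg. -/
noncomputable def legMat (a : ℕ) (i : Fin r) (M : Matrix (Fin m) (Fin m) ℂ) :
    Matrix (Fin m) (Fin m) ℂ :=
  M.map (legConj a i)

/-- The operator of a leg: `A` for an incoming leg, `A^*` for an outgoing leg (so `A` for all legs
when `A` is self-adjoint). -/
def legOp (a : ℕ) (i : Fin r) (X : 𝒜) : 𝒜 := if i.val < a then X else star X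

/-- Chronological product: later times stand to the left; operators at equal times are left in the
given order. -/
noncomputable def chronological (τ : Fin r → ℝ) (X : Fin r → 𝒜) : 𝒜 :=
  (List.ofFn fun i => X (Tuple.sort (fun j => -τ j) i)).prod

/-- The Green function in `(τ, x)`-representation. -/
noncomputable def green (S : TranslationInvariantState d 𝒜) (A : Fin m → 𝒜) (a : ℕ)
    (τ : Fin r → ℝ) (x : Fin r → Space d) (j : Fin r → Fin m) : ℂ :=
  S.ω (chronological τ fun i => S.trans (τ i, x i) (legOp a i (A (j i))))

/-- Test functions of momentum, with one component for every operator index. -/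
def IsTest (f : Space d → Fin m → ℂ) : Prop := ContDiff ℝ ((⊤ : ℕ∞) : WithTop ℕ∞) f ∧ HasCompactSupport f

/-- The wave packet of leg `i` in coordinate space at time `τ`: the inverse Fourier transform
`(2π)^{-d} ∫ f^j(k) (exp (i τ E(k)))_{μν} exp (- i k x) dk`, where the phases are complex conjugated
for an outgoing leg (the sign of its energy and momentum is changed). -/
noncomputable def packet (D : Dispersion d m) (a : ℕ) (i : Fin r) (f : Space d → Fin m → ℂ)
    (μ ν : Fin m) (τ : ℝ) (x : Space d) (j : Fin m) : ℂ :=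
  (((2 * Real.pi) ^ d : ℝ) : ℂ)⁻¹ *
    ∫ k, f k j * legConj a i (expI τ (D.E k) μ ν * planeWave k (-x))

/-- `τ K` is an essential support of the wave packets of `f`. -/
def IsEssentialSupport (D : Dispersion d m) (a : ℕ) (i : Fin r) (f : Space d → Fin m → ℂ)
    (K : Set (Space d)) : Prop :=
  ∀ n : ℕ, ∃ c : ℝ, ∀ (μ ν j : Fin m) (τ : ℝ) (x : Space d), τ ≠ 0 → τ⁻¹ • x ∉ K →
    ‖packet D a i f μ ν τ x j‖ ≤ c * ((1 + ‖x‖ ^ 2 + τ ^ 2) ^ n)⁻¹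

/-- The incoming packets do not overlap, and the outgoing packets do not overlap: they have
essential supports at positive distance from each other. -/
def NonOverlapping (D : Dispersion d m) (a : ℕ) (f : Fin r → Space d → Fin m → ℂ) : Prop :=
  ∃ K : Fin r → Set (Space d), (∀ i, IsEssentialSupport D a i (f i) (K i)) ∧
    ∀ i j, i ≠ j → (i.val < a ↔ j.val < a) →
      ∃ δ > 0, ∀ v ∈ K i, ∀ w ∈ K j, δ ≤ dist v w

/-- The Green function in `(τ, k)`-representation, smeared in the momenta with
`f_i^j(k) (exp (i τ_i E(k)))_{μ_i ν_i}` (in outgoing legs the momentum variable has changed its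
sign and the exponential is complex conjugated). -/
noncomputable def smearedGreen (S : TranslationInvariantState d 𝒜) (D : Dispersion d m)
    (A : Fin m → 𝒜) (a : ℕ) (f : Fin r → Space d → Fin m → ℂ) (μ ν : Fin r → Fin m)
    (τ : Fin r → ℝ) : ℂ :=
  ∑ j : Fin r → Fin m, ∫ x : Fin r → Space d,
    (∏ i, packet D a i (f i) (μ i) (ν i) (τ i) (x i) (j i)) * green S A a τ x j

/-- The times of the incoming legs tend to `-∞`, those of the outgoing legs tend to `+∞`, at
comparable rates (with ratios at most `κ`). -/
def asymptoticTimes (r a : ℕ) (κ : ℝ) : Filter (Fin r → ℝ) :=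
  Filter.pi (fun i : Fin r => if i.val < a then atBot else atTop) ⊓
    𝓟 {τ | ∀ i j, |τ i| ≤ κ * |τ j|}

/-- `C` is a generalized function of `k_1, …, k_r` with values in the `r`-th tensor power of the
`m`-dimensional space: multilinear and continuous on tuples of test functions. -/
structure IsGeneralizedFunction (C : (Fin r → Space d → Fin m → ℂ) → ℂ) : Prop where
  map_add : ∀ (h : Fin r → Space d → Fin m → ℂ) (i : Fin r) (u v : Space d → Fin m → ℂ),
    (∀ j, IsTest (h j)) → IsTest u → IsTest v →
      C (Function.update h i (u + v)) = C (Function.update h i u) + C (Function.update h i v)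
  map_smul : ∀ (h : Fin r → Space d → Fin m → ℂ) (i : Fin r) (c : ℂ) (u : Space d → Fin m → ℂ),
    (∀ j, IsTest (h j)) → IsTest u →
      C (Function.update h i (c • u)) = c * C (Function.update h i u)
  continuous : ∀ K : Set (Space d), IsCompact K → ∃ (N : ℕ) (B : ℝ),
    ∀ (h : Fin r → Space d → Fin m → ℂ) (M : Fin r → ℝ),
      (∀ i, IsTest (h i) ∧ tsupport (h i) ⊆ K ∧
        ∀ n ≤ N, ∀ k, ‖iteratedFDeriv ℝ n (h i) k‖ ≤ M i) →
      ‖C h‖ ≤ B * ∏ i, M i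

/-- `C` is the coefficient of the polar part of the Green function of the operators `A`, whose
one-particle projections are `t`.  In `(τ, k)`-representation, in the limit of infinite times,
the Green function is `⊗_i exp (- i τ_i H(k_i)) C` (with the complex conjugate matrix in outgoing
legs) up to a remainder that tends to zero, where `H = opEnergy D t` is the matrix of one-particle
energy in the operator indices.  The remainder is tested with all non-overlapping wave packets
that oscillate in time with one-particle energies, that is, it does not contribute to the poles at
these energies. -/
structure IsPolarCoefficient (S : TranslationInvariantState d 𝒜) (D : Dispersion d m)
    (A : Fin m → 𝒜) (t : Fin m → ElemSpace d m) (a : ℕ)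
    (C : (Fin r → Space d → Fin m → ℂ) → ℂ) : Prop where
  generalized : IsGeneralizedFunction C
  asymptotics : ∀ f : Fin r → Space d → Fin m → ℂ, (∀ i, IsTest (f i)) → NonOverlapping D a f →
    ∀ (μ ν : Fin r → Fin m) (κ : ℝ),
      Tendsto (fun τ : Fin r → ℝ => smearedGreen S D A a f μ ν τ -
          C fun i k => legConj a i (expI (τ i) (D.E k) (μ i) (ν i)) •
            Matrix.vecMul (f i k) (legMat a i (expI (-τ i) (opEnergy D t k))))
        (asymptoticTimes r a κ) (𝓝 0)

/-- The polar part `P_r(ε_1, k_1, …, ε_r, k_r) = ⊗_i i (H(k_i) - ε_i)⁻¹ C(k_1, …, k_r)` in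
`(ε, k)`-representation, with `H = opEnergy D t` (complex conjugated in outgoing legs).  It is a
generalized function of the momenta, evaluated here at test functions `h`, and is considered for
energies `ε_i` with negative imaginary part; its boundary value for real `ε_i` is given by
`(H - ε + i0)⁻¹`. -/
noncomputable def polarPart (D : Dispersion d m) (t : Fin m → ElemSpace d m) (a : ℕ)
    (C : (Fin r → Space d → Fin m → ℂ) → ℂ) (ε : Fin r → ℂ)
    (h : Fin r → Space d → Fin m → ℂ) : ℂ :=
  Complex.I ^ r * C fun i k => Matrix.vecMul (h i k)
    (legMat a i (opEnergy D t k) - ε i • (1 : Matrix (Fin m) (Fin m) ℂ))⁻¹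

/-- The product `(⊗_i M(k_i)) Q` of a generalized function `Q` with a matrix-valued function `M`
acting on every tensor factor (complex conjugated in outgoing legs). -/
noncomputable def tensorMul (a : ℕ) (M : Space d → Matrix (Fin m) (Fin m) ℂ)
    (Q : (Fin r → Space d → Fin m → ℂ) → ℂ) (h : Fin r → Space d → Fin m → ℂ) : ℂ :=
  Q fun i k => Matrix.vecMul (h i k) (legMat a i (M k))

/-- The normalized polar part `(⊗_i T(k_i)⁻¹) P_r`. -/
noncomputable def normalizedPolarPart (D : Dispersion d m) (t : Fin m → ElemSpace d m) (a : ℕ)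
    (C : (Fin r → Space d → Fin m → ℂ) → ℂ) (ε : Fin r → ℂ) :
    (Fin r → Space d → Fin m → ℂ) → ℂ :=
  tensorMul a (fun k => (ampMatrix t k)⁻¹) (polarPart D t a C ε)

end Polar

end AQFT

open AQFT

/-!
The amplitude of a smeared operator is found by pairing with one-particle vectors. Translations act
on them as multiplication operators, and the one-particle space contains `Φ f` for all test
functions `f`, so the smearing integral can be carried out under the pairing
(`amplitude_smearing`). In the basis of the rows of `T(k)` the result reads
`T'(k) = α(H(k), k) T(k)` (`ampMatrix_eq_symbolAt_mul`).

The Green function of the `A'` is a superposition of products of translated `A`, but these are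
ordered according to the times `τ i`, and not according to the shifted times `τ i + σ i`
(`green_smearing`). Wave packets that do not overlap are localized, up to rapidly decreasing tails,
in regions `τ K i` whose distances grow linearly in time. A shift of the times that is small
compared with `τ` interchanges only operators in such distant regions, which almost commute. Hence
the operators may be ordered by the shifted times up to a term that tends to zero
(`exists_norm_ω_reorder_le`, `exists_pointwise_reorder_le`, `tendsto_smearedGreen_sub`).

After the reordering, integration over the space arguments of the smearing functions multiplies the
test functions by `∫ α(σ, x) exp(ikx) dx`, and the shift by `σ` is compensated by the factor
`exp(-iσE)`. What remains is an integral over `σ` of Green functions of the `A` at the times `τ + σ`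
(`integral_smearedIntegrand_eq`). The same superposition of polar terms reproduces the integral that
defines `α(H, k)` (`IsGeneralizedFunction.integral_polar`). The difference of the two is an integral
over `σ` of remainders, each of which tends to zero because the modified test functions have the
essential supports of the original ones, up to an arbitrarily small thickening
(`NonOverlapping.vecMul`). Passing to the limit under the integral needs a bound uniform in `τ`. The
definition of a polar coefficient gives only convergence for every single family of test functions,
but it does so for all absolutely summable superpositions of the modified test functions, weighted
by a power of `σ`. The uniform boundedness principle on the Banach space `ℓ¹` of weights turns this
into the required bound (`AsymptoticallyVanishing.exists_norm_vecMul_le`,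
`AsymptoticallyVanishing.tendsto_integral`). Together these prove `IsPolarCoefficient.smearing`.

The polar coefficient is unique on non-overlapping families: the time dependence of the polar term
is invertible, so at any given time each test function is a finite sum of wave packets
(`sum_single_mul_polarMat`, `IsPolarCoefficient.unique`). Finally `α(H, k) = T'(k) T(k)⁻¹`
intertwines the matrices of the energy in the two bases, hence also their resolvents, which exist
for non-real energies because `E` is Hermitian (`resolvent_mul`). The relations between the polar
parts follow by matrix algebra (`polarPart_eq_tensorMul`, `normalizedPolarPart_eq`).
-/

namespace AQFT

/-! ### Bounded operators on the GNS space and chronological products -/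

section Operators

variable {d : ℕ} {𝒜 : Type*} [Ring 𝒜] [StarRing 𝒜] [Algebra ℂ 𝒜] [StarModule ℂ 𝒜]
  (S : TranslationInvariantState d 𝒜)

theorem vec_add (a b : 𝒜) : vec S (a + b) = vec S a + vec S b := rfl

theorem vec_sub (a b : 𝒜) : vec S (a - b) = vec S a - vec S b := rfl

theorem vec_zero : vec S (0 : 𝒜) = 0 := rfl

theorem vec_neg (a : 𝒜) : vec S (-a) = -vec S a := rfl

theorem vec_surjective (v : GNS S) : ∃ a, vec S a = v := by
  obtain ⟨a, rfl⟩ := SeparationQuotient.surjective_mk v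
  exact ⟨(toPreGNS S).symm a, rfl⟩

theorem norm_vec_sq (a : 𝒜) : ‖vec S a‖ ^ 2 = (S.ω (star a * a)).re := by
  rw [← inner_vec, ← inner_self_eq_norm_sq (𝕜 := ℂ)]
  rfl

theorem norm_vec_one : ‖vec S (1 : 𝒜)‖ = 1 := by
  have h := norm_vec_sq S 1
  rw [star_one, one_mul, S.ω_one, Complex.one_re] at h
  nlinarith [norm_nonneg (vec S (1 : 𝒜))]

theorem norm_ω_star_mul_le (a b : 𝒜) : ‖S.ω (star a * b)‖ ≤ ‖vec S a‖ * ‖vec S b‖ := by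
  rw [← inner_vec]
  exact norm_inner_le_norm _ _

theorem norm_ω_le (a : 𝒜) : ‖S.ω a‖ ≤ ‖vec S a‖ := by
  simpa [norm_vec_one] using norm_ω_star_mul_le S 1 a

theorem trans_zero (a : 𝒜) : S.trans 0 a = a := by
  have h := S.trans_add 0 0 a
  rw [add_zero] at h
  exact ((S.trans 0).injective h).symm

theorem trans_trans_neg (p : ℝ × Space d) (a : 𝒜) : S.trans p (S.trans (-p) a) = a := by
  rw [← S.trans_add, add_neg_cancel, trans_zero]

theorem trans_neg_trans (p : ℝ × Space d) (a : 𝒜) : S.trans (-p) (S.trans p a) = a := by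
  rw [← S.trans_add, neg_add_cancel, trans_zero]

theorem norm_vec_trans (p : ℝ × Space d) (a : 𝒜) : ‖vec S (S.trans p a)‖ = ‖vec S a‖ := by
  have h : ‖vec S (S.trans p a)‖ ^ 2 = ‖vec S a‖ ^ 2 := by
    rw [norm_vec_sq, norm_vec_sq, ← map_star, ← map_mul, S.ω_trans]
  exact (pow_left_inj₀ (norm_nonneg _) (norm_nonneg _) two_ne_zero).1 h

theorem continuous_vec_trans (a : 𝒜) : Continuous fun p => vec S (S.trans p a) := by
  refine continuous_iff_continuousAt.2 fun q => ?_
  rw [ContinuousAt, tendsto_iff_norm_sub_tendsto_zero]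
  have h : ∀ p, ‖vec S (S.trans p a) - vec S (S.trans q a)‖
      = √((S.ω (star (S.trans (p - q) a - a) * (S.trans (p - q) a - a))).re) := fun p => by
    rw [← norm_vec_sq, Real.sqrt_sq (norm_nonneg _), ← vec_sub, ← norm_vec_trans S q (_ - a),
      map_sub, ← S.trans_add, add_sub_cancel]
  simp only [h]
  have h1 : Tendsto (fun p : ℝ × Space d => p - q) (𝓝 q) (𝓝 0) := by
    have : Continuous fun p : ℝ × Space d => p - q := by fun_prop
    simpa using this.tendsto q
  simpa using ((S.trans_continuous a).comp h1).sqrt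

variable {S}

theorem OpNormLE.mono {X : 𝒜} {B B' : ℝ} (h : OpNormLE S X B) (hB : B ≤ B') : OpNormLE S X B' :=
  fun Y => (h Y).trans (mul_le_mul_of_nonneg_right hB (norm_nonneg _))

theorem OpNormLE.mul {X Y : 𝒜} {B B' : ℝ} (hX : OpNormLE S X B) (hY : OpNormLE S Y B')
    (hB : 0 ≤ B) : OpNormLE S (X * Y) (B * B') := fun Z => by
  rw [mul_assoc, mul_assoc]
  exact (hX _).trans (mul_le_mul_of_nonneg_left (hY Z) hB)

theorem OpNormLE.add {X Y : 𝒜} {B B' : ℝ} (hX : OpNormLE S X B) (hY : OpNormLE S Y B') :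
    OpNormLE S (X + Y) (B + B') := fun Z => by
  rw [add_mul, vec_add, add_mul]
  exact (norm_add_le _ _).trans (add_le_add (hX Z) (hY Z))

theorem OpNormLE.neg {X : 𝒜} {B : ℝ} (hX : OpNormLE S X B) : OpNormLE S (-X) B := fun Z => by
  rw [neg_mul, vec_neg, norm_neg]
  exact hX Z

theorem opNormLE_zero : OpNormLE S (0 : 𝒜) 0 := fun Z => by simp [vec_zero]

theorem opNormLE_one : OpNormLE S (1 : 𝒜) 1 := fun Z => by simp

theorem OpNormLE.trans {X : 𝒜} {B : ℝ} (hX : OpNormLE S X B) (p : ℝ × Space d) :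
    OpNormLE S (S.trans p X) B := fun Z => by
  have h := hX (S.trans (-p) Z)
  rwa [← norm_vec_trans S p, map_mul, trans_trans_neg, norm_vec_trans] at h

/-- On a pre-Hilbert space the bound of the adjoint is obtained without completeness, from
`‖X* Z‖² = (Z, X X* Z) ≤ ‖Z‖ B ‖X* Z‖`. -/
theorem OpNormLE.star {X : 𝒜} {B : ℝ} (hX : OpNormLE S X B) : OpNormLE S (Star.star X) B := fun Z => by
  have h : ‖vec S (Star.star X * Z)‖ ^ 2 ≤ ‖vec S Z‖ * (B * ‖vec S (Star.star X * Z)‖) := by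
    rw [norm_vec_sq]
    refine (Complex.re_le_norm _).trans ?_
    rw [star_mul, star_star, mul_assoc]
    exact (norm_ω_star_mul_le S _ _).trans (mul_le_mul_of_nonneg_left (hX _) (norm_nonneg _))
  rcases (norm_nonneg (vec S (Star.star X * Z))).eq_or_lt with h0 | h0
  · rw [← h0]
    exact (norm_nonneg _).trans (hX Z)
  · exact le_of_mul_le_mul_right (by nlinarith) h0

theorem OpNormLE.norm_ω_le {X : 𝒜} {B : ℝ} (hX : OpNormLE S X B) : ‖S.ω X‖ ≤ B := by
  have h := hX 1
  rw [norm_vec_one, mul_one, mul_one] at h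
  exact (AQFT.norm_ω_le S X).trans h

theorem opNormLE_list_prod {ι : Type*} {X : ι → 𝒜} {B : ℝ} (hB : 0 ≤ B)
    (hX : ∀ i, OpNormLE S (X i) B) (l : List ι) :
    OpNormLE S (l.map X).prod (B ^ l.length) := by
  induction l with
  | nil => simpa using opNormLE_one
  | cons a t ih =>
    rw [List.map_cons, List.prod_cons, List.length_cons, pow_succ']
    exact (hX a).mul ih hB

theorem opNormLE_commutator_list_prod {ι : Type*} {X : ι → 𝒜} {B ε : ℝ} (hB : 1 ≤ B)
    (hX : ∀ i, OpNormLE S (X i) B) (a : ι) (u : List ι)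
    (hu : ∀ b ∈ u, OpNormLE S (X a * X b - X b * X a) ε) :
    OpNormLE S (X a * (u.map X).prod - (u.map X).prod * X a) (u.length * B ^ u.length * ε) := by
  have hB0 : 0 ≤ B := zero_le_one.trans hB
  induction u with
  | nil => simpa using opNormLE_zero
  | cons b u ih =>
    simp only [List.map_cons, List.prod_cons, List.length_cons]
    have h1 := (opNormLE_list_prod hB0 hX u)
    have h2 := hu b (by simp)
    have hε : 0 ≤ ε := by
      have := h2 1
      rw [norm_vec_one, mul_one ε] at this
      exact (norm_nonneg _).trans this
    have h3 := (h2.mul h1 hε).add ((hX b).mul (ih fun c hc => hu c (by simp [hc])) hB0)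
    have e : X a * (X b * (u.map X).prod) - X b * (u.map X).prod * X a =
        (X a * X b - X b * X a) * (u.map X).prod +
          X b * (X a * (u.map X).prod - (u.map X).prod * X a) := by noncomm_ring
    rw [e]
    refine h3.mono ?_
    push_cast
    have : B ^ u.length ≤ B ^ (u.length + 1) := pow_le_pow_right₀ hB (Nat.le_succ _)
    have := mul_le_mul_of_nonneg_left this hε
    have e2 : B * (u.length * B ^ u.length * ε) = u.length * (ε * B ^ (u.length + 1)) := by
      rw [pow_succ']; ring
    rw [e2]
    linarith

/-- Two products of the same operators in different orders are close to each other if every pair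
of operators whose order differs commutes up to `ε`. -/
theorem opNormLE_prod_sub_prod_perm {ι : Type*} {X : ι → 𝒜} {B ε : ℝ} (hB : 1 ≤ B) (hε : 0 ≤ ε)
    (hX : ∀ i, OpNormLE S (X i) B) (l l' : List ι) (hl : l.Perm l')
    (h : ∀ i j, [i, j].Sublist l → [j, i].Sublist l' → OpNormLE S (X i * X j - X j * X i) ε) :
    OpNormLE S ((l.map X).prod - (l'.map X).prod) (l.length ^ 2 * B ^ l.length * ε) := by
  have hB0 : 0 ≤ B := zero_le_one.trans hB
  induction l generalizing l' with
  | nil =>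
    rw [List.nil_perm] at hl
    subst hl
    simpa using opNormLE_zero
  | cons a t ih =>
    obtain ⟨u, v, rfl⟩ := List.append_of_mem (hl.subset (List.mem_cons_self (a := a) (l := t)))
    have ht : t.Perm (u ++ v) := (List.perm_cons a).1 (hl.trans List.perm_middle)
    -- Move `a` through the operators `u` that precede it in the second product; the induction
    -- hypothesis reorders the rest.
    have h1 := ih (u ++ v) ht fun i j hi hj => h i j (hi.trans (List.sublist_cons_self _ _))
      (hj.trans (List.Sublist.append_left (List.sublist_cons_self _ _) _))
    have h2 := opNormLE_commutator_list_prod (ε := ε) hB hX a u fun b hb => h a b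
      ((List.singleton_sublist.2 (ht.symm.subset (by simp [hb]))).cons_cons a)
      (List.Sublist.append (List.singleton_sublist.2 hb) (l₁ := [b]) (r₁ := [a])
        (List.singleton_sublist.2 (List.mem_cons_self)))
    have h3 := ((hX a).mul h1 hB0).add
      (h2.mul (opNormLE_list_prod hB0 hX v) (by positivity))
    have hlen : t.length = u.length + v.length := by
      rw [ht.length_eq, List.length_append]
    have e : ((a :: t).map X).prod - ((u ++ a :: v).map X).prod =
        X a * ((t.map X).prod - ((u ++ v).map X).prod) +
          (X a * (u.map X).prod - (u.map X).prod * X a) * (v.map X).prod := by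
      simp only [List.map_cons, List.prod_cons, List.map_append, List.prod_append]
      noncomm_ring
    rw [e]
    refine h3.mono ?_
    rw [List.length_cons, hlen]
    push_cast
    have hp : B ^ (u.length + v.length) ≤ B ^ (u.length + v.length + 1) :=
      pow_le_pow_right₀ hB (Nat.le_succ _)
    have e1 : (u.length : ℝ) * B ^ u.length * ε * B ^ v.length =
        u.length * (B ^ (u.length + v.length) * ε) := by rw [pow_add]; ring
    have e2 : B * (((u.length : ℝ) + v.length) ^ 2 * B ^ (u.length + v.length) * ε) =
        ((u.length : ℝ) + v.length) ^ 2 * (B ^ (u.length + v.length + 1) * ε) := by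
      rw [pow_succ' B]; ring
    rw [e1, e2]
    have h4 : (u.length : ℝ) * (B ^ (u.length + v.length) * ε) ≤
        u.length * (B ^ (u.length + v.length + 1) * ε) := by gcongr
    have h5 : 0 ≤ B ^ (u.length + v.length + 1) * ε := by positivity
    have h6 : (0 : ℝ) ≤ u.length := by positivity
    have h7 : (0 : ℝ) ≤ v.length := by positivity
    nlinarith [mul_nonneg h6 h5, mul_nonneg h7 h5]

/-- Products of translated bounded operators are strongly continuous in the translations, like the
translations themselves. -/
theorem continuous_vec_list_prod {ι P : Type*} [TopologicalSpace P] {X : ι → 𝒜} {B : ℝ}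
    (hX : ∀ i, OpNormLE S (X i) B) {q : P → ι → ℝ × Space d} (hq : ∀ i, Continuous fun p => q p i)
    (l : List ι) (Y : 𝒜) :
    Continuous fun p => vec S ((l.map fun i => S.trans (q p i) (X i)).prod * Y) := by
  induction l with
  | nil => simpa using continuous_const
  | cons a t ih =>
    simp only [List.map_cons, List.prod_cons, mul_assoc]
    set Z : P → 𝒜 := fun p => (t.map fun i => S.trans (q p i) (X i)).prod * Y with hZ
    refine continuous_iff_continuousAt.2 fun p₀ => ?_
    rw [ContinuousAt, tendsto_iff_norm_sub_tendsto_zero]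
    set W : 𝒜 := S.trans (-q p₀ a) (Z p₀)
    -- `T_p X T_p⁻¹` is strongly continuous, and uniformly bounded in `p`.
    have key : ∀ p, ‖vec S (S.trans (q p a) (X a) * Z p) - vec S (S.trans (q p₀ a) (X a) * Z p₀)‖ ≤
        B * ‖vec S (Z p) - vec S (Z p₀)‖ +
          (B * ‖vec S (S.trans (-q p a) (Z p₀)) - vec S W‖ +
            ‖vec S (S.trans (q p a) (X a * W)) - vec S (S.trans (q p₀ a) (X a * W))‖) := by
      intro p
      have e0 : S.trans (q p₀ a) (X a * W) = S.trans (q p₀ a) (X a) * Z p₀ := by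
        rw [map_mul, trans_trans_neg]
      have e1 : vec S (S.trans (q p a) (X a) * Z p) - vec S (S.trans (q p₀ a) (X a) * Z p₀) =
          vec S (S.trans (q p a) (X a) * (Z p - Z p₀)) +
            (vec S (S.trans (q p a) (X a * (S.trans (-q p a) (Z p₀) - W))) +
            (vec S (S.trans (q p a) (X a * W)) - vec S (S.trans (q p₀ a) (X a * W)))) := by
        rw [e0]
        simp only [← vec_add, ← vec_sub, map_mul, map_sub, trans_trans_neg, mul_sub]
        congr 1
        abel
      rw [e1]
      refine (norm_add_le _ _).trans (add_le_add ?_ ((norm_add_le _ _).trans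
        (add_le_add ?_ le_rfl)))
      · rw [← vec_sub]
        exact (hX a).trans _ _
      · rw [← vec_sub, norm_vec_trans]
        exact hX a _
    refine squeeze_zero (fun _ => norm_nonneg _) key ?_
    have t1 : Tendsto (fun p => ‖vec S (Z p) - vec S (Z p₀)‖) (𝓝 p₀) (𝓝 0) :=
      tendsto_iff_norm_sub_tendsto_zero.1 (ih.tendsto p₀)
    have t2 : Tendsto (fun p => ‖vec S (S.trans (-q p a) (Z p₀)) - vec S W‖) (𝓝 p₀) (𝓝 0) :=
      tendsto_iff_norm_sub_tendsto_zero.1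
        (((continuous_vec_trans S (Z p₀)).comp (hq a).neg).tendsto p₀)
    have t3 : Tendsto (fun p => ‖vec S (S.trans (q p a) (X a * W)) -
        vec S (S.trans (q p₀ a) (X a * W))‖) (𝓝 p₀) (𝓝 0) :=
      tendsto_iff_norm_sub_tendsto_zero.1
        (((continuous_vec_trans S (X a * W)).comp (hq a)).tendsto p₀)
    simpa using (t1.const_mul B).add ((t2.const_mul B).add t3)

theorem continuous_ω_list_prod {ι P : Type*} [TopologicalSpace P] {X : ι → 𝒜} {B : ℝ}
    (hX : ∀ i, OpNormLE S (X i) B) {q : P → ι → ℝ × Space d} (hq : ∀ i, Continuous fun p => q p i)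
    (l : List ι) : Continuous fun p => S.ω (l.map fun i => S.trans (q p i) (X i)).prod := by
  have h := continuous_vec_list_prod hX hq l 1
  have e : ∀ a : 𝒜, S.ω a = inner ℂ (vec S 1) (vec S a) := fun a => by
    rw [inner_vec, star_one, one_mul]
  simp only [e, mul_one] at h ⊢
  exact continuous_const.inner h

/-! ### Green functions -/

section Green

variable {r m : ℕ} {a : ℕ}

/-- The order of the legs in the chronological product. -/
noncomputable def chronoList (τ : Fin r → ℝ) : List (Fin r) :=
  List.ofFn (Tuple.sort fun j => -τ j)

omit [StarRing 𝒜] [Algebra ℂ 𝒜] [StarModule ℂ 𝒜] in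
theorem chronological_eq (τ : Fin r → ℝ) (X : Fin r → 𝒜) :
    chronological τ X = ((chronoList τ).map X).prod := by
  rw [chronological, chronoList, List.map_ofFn]
  rfl

theorem length_chronoList (τ : Fin r → ℝ) : (chronoList τ).length = r := List.length_ofFn

theorem chronoList_perm (τ τ' : Fin r → ℝ) : (chronoList τ).Perm (chronoList τ') := by
  have h : ∀ σ : Equiv.Perm (Fin r), (List.ofFn σ).Perm (List.ofFn (id : Fin r → Fin r)) :=
    fun σ => by simpa using Equiv.Perm.ofFn_comp_perm σ (id : Fin r → Fin r)
  exact (h _).trans (h _).symm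

theorem le_of_sublist_chronoList {τ : Fin r → ℝ} {i j : Fin r}
    (h : [i, j].Sublist (chronoList τ)) : τ j ≤ τ i := by
  have h1 : (chronoList τ).Pairwise fun i j => τ j ≤ τ i := by
    rw [chronoList, List.pairwise_ofFn]
    intro i j hij
    have := Tuple.monotone_sort (fun j => -τ j) hij.le
    simpa using this
  simpa using h1.sublist h

theorem opNormLE_legOp {X : 𝒜} {B : ℝ} (hX : OpNormLE S X B) (i : Fin r) :
    OpNormLE S (legOp a i X) B := by
  unfold legOp
  split_ifs
  exacts [hX, hX.star]

theorem norm_ω_chronological_le {B : ℝ} (hB : 0 ≤ B) {X : Fin r → 𝒜}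
    (hX : ∀ i, OpNormLE S (X i) B) (τ : Fin r → ℝ) : ‖S.ω (chronological τ X)‖ ≤ B ^ r := by
  have := (opNormLE_list_prod hB hX (chronoList τ)).norm_ω_le
  rwa [length_chronoList, ← chronological_eq] at this

theorem norm_green_le {A : Fin m → 𝒜} {B : ℝ} (hB : 0 ≤ B) (hA : ∀ i, OpNormLE S (A i) B)
    (τ : Fin r → ℝ) (x : Fin r → Space d) (j : Fin r → Fin m) :
    ‖green S A a τ x j‖ ≤ B ^ r :=
  norm_ω_chronological_le hB (fun _ => (opNormLE_legOp (hA _) _).trans _) _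

theorem continuous_ω_chronological {A : Fin m → 𝒜} {B : ℝ} (hA : ∀ i, OpNormLE S (A i) B)
    {P : Type*} [TopologicalSpace P] {q : P → Fin r → ℝ × Space d}
    (hq : ∀ i, Continuous fun p => q p i) (τ : Fin r → ℝ) (j : Fin r → Fin m) :
    Continuous fun p => S.ω (chronological τ fun i => S.trans (q p i) (legOp a i (A (j i)))) := by
  simp only [chronological_eq]
  exact continuous_ω_list_prod (fun i => opNormLE_legOp (hA (j i)) i) hq _

theorem measurableSet_sort_eq (σ : Equiv.Perm (Fin r)) :
    MeasurableSet {τ : Fin r → ℝ | (Tuple.sort fun j => -τ j) = σ} := by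
  have : {τ : Fin r → ℝ | (Tuple.sort fun j => -τ j) = σ} =
      {τ | (∀ i j, i ≤ j → -τ (σ i) ≤ -τ (σ j)) ∧
        ∀ i j, i < j → -τ (σ i) = -τ (σ j) → σ i < σ j} := by
    ext τ
    rw [Set.mem_ofPred_eq, eq_comm, Tuple.eq_sort_iff]
    rfl
  rw [this]
  simp only [Set.ofPred_and, Set.ofPred_forall]
  refine .inter (.iInter fun i => .iInter fun j => .iInter fun _ => ?_)
    (.iInter fun i => .iInter fun j => .iInter fun _ => ?_)
  · exact measurableSet_le (by fun_prop) (by fun_prop)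
  · simp only [imp_iff_not_or, Set.ofPred_or]
    exact .union (measurableSet_eq_fun (by fun_prop) (by fun_prop)).compl (.const _)

/-- The chronological product is not continuous in the times, but there are only finitely many orders,
each of them on a measurable set of times. -/
theorem measurable_ω_chronological {A : Fin m → 𝒜} {B : ℝ} (hA : ∀ i, OpNormLE S (A i) B)
    {P : Type*} [TopologicalSpace P] [MeasurableSpace P] [BorelSpace P]
    {q : P → Fin r → ℝ × Space d} (hq : ∀ i, Continuous fun p => q p i) {τ : P → Fin r → ℝ}
    (hτ : Measurable τ) (j : Fin r → Fin m) :
    Measurable fun p =>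
      S.ω (chronological (τ p) fun i => S.trans (q p i) (legOp a i (A (j i)))) := by
  let _ : MeasurableSpace (Equiv.Perm (Fin r)) := ⊤
  set F : Equiv.Perm (Fin r) × P → ℂ := fun x =>
    S.ω (((List.ofFn x.1).map fun i => S.trans (q x.2 i) (legOp a i (A (j i)))).prod) with hF
  have h1 : Measurable F := measurable_from_prod_countable_right fun σ =>
    (continuous_ω_list_prod (X := fun i => legOp a i (A (j i)))
      (fun i => opNormLE_legOp (hA (j i)) i) hq (List.ofFn σ)).measurable
  have h2 : Measurable fun p => (Tuple.sort fun i => -τ p i : Equiv.Perm (Fin r)) :=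
    measurable_to_countable' fun σ => hτ (measurableSet_sort_eq σ)
  have := h1.comp (h2.prodMk measurable_id)
  simp only [chronological_eq]
  exact this

/-- The chronological products for two systems of times are close to each other if the operators
whose time order differs commute up to `ε`. -/
theorem norm_ω_chronological_sub_le {X : Fin r → 𝒜} {B ε : ℝ} (hB : 1 ≤ B) (hε : 0 ≤ ε)
    (hX : ∀ i, OpNormLE S (X i) B) (τ τ' : Fin r → ℝ)
    (h : ∀ i j, i ≠ j → τ j ≤ τ i → τ' i ≤ τ' j → OpNormLE S (X i * X j - X j * X i) ε) :
    ‖S.ω (chronological τ X) - S.ω (chronological τ' X)‖ ≤ r ^ 2 * B ^ r * ε := by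
  have := (opNormLE_prod_sub_prod_perm hB hε hX _ _ (chronoList_perm τ τ')
    fun i j hi hj => ?_).norm_ω_le
  · rwa [length_chronoList, ← chronological_eq, ← chronological_eq, map_sub] at this
  · refine h i j ?_ (le_of_sublist_chronoList hi) (le_of_sublist_chronoList hj)
    rintro rfl
    have hn : (chronoList τ).Nodup := by
      rw [chronoList, List.nodup_ofFn]
      exact (Tuple.sort _).injective
    simpa using hn.sublist hi

/-- The asymptotic commutativity carries over to the operators of two incoming or two outgoing
legs. -/
theorem opNormLE_commutator_legOp {A : Fin m → 𝒜} {n : ℕ} {c : Polynomial ℝ} {k l : Fin m}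
    (hc : ∀ (τ : ℝ) (x : Space d),
      OpNormLE S (S.trans (τ, x) (A k) * A l - A l * S.trans (τ, x) (A k))
        (c.eval τ / (1 + ‖x‖ ^ n))) {i j : Fin r} (hij : i.val < a ↔ j.val < a)
    (p q : ℝ × Space d) :
    OpNormLE S (S.trans p (legOp a i (A k)) * S.trans q (legOp a j (A l)) -
      S.trans q (legOp a j (A l)) * S.trans p (legOp a i (A k)))
        (c.eval (p.1 - q.1) / (1 + ‖p.2 - q.2‖ ^ n)) := by
  have h0 : OpNormLE S (S.trans p (A k) * S.trans q (A l) - S.trans q (A l) * S.trans p (A k))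
      (c.eval (p.1 - q.1) / (1 + ‖p.2 - q.2‖ ^ n)) := by
    have h := (hc (p.1 - q.1) (p.2 - q.2)).trans q
    have e : q + (p.1 - q.1, p.2 - q.2) = p := by
      ext1 <;> simp
    rwa [map_sub, map_mul, map_mul, ← S.trans_add, e] at h
  by_cases hi : i.val < a
  · simpa only [legOp, if_pos hi, if_pos (hij.1 hi)] using h0
  · have hj : ¬ j.val < a := fun h => hi (hij.2 h)
    have h := h0.star.neg
    rw [star_sub, star_mul, star_mul, neg_sub, ← map_star, ← map_star] at h
    simpa only [legOp, if_neg hi, if_neg hj] using h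

end Green

end Operators

end AQFT

namespace AQFT

/-! ### Functions with moderate or rapidly decreasing dependence on time -/

section ExpI

variable {m : ℕ}

theorem expI_zero (M : Matrix (Fin m) (Fin m) ℂ) : expI 0 M = 1 := by
  simp [expI]

theorem expI_add (s t : ℝ) (M : Matrix (Fin m) (Fin m) ℂ) :
    expI (s + t) M = expI s M * expI t M := by
  rw [expI, expI, expI, ← Matrix.exp_add_of_commute]
  · rw [← add_smul]
    push_cast
    rw [mul_add]
  · exact ((Commute.refl M).smul_left _).smul_right _

theorem expI_nsmul (n : ℕ) (t : ℝ) (M : Matrix (Fin m) (Fin m) ℂ) :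
    expI (n * t) M = expI t M ^ n := by
  rw [expI, expI, ← Matrix.exp_nsmul, ← Nat.cast_smul_eq_nsmul ℂ, smul_smul]
  push_cast
  congr 2
  ring

theorem expI_conj (t : ℝ) (U M : Matrix (Fin m) (Fin m) ℂ) (hU : IsUnit U) :
    expI t (U * M * U⁻¹) = U * expI t M * U⁻¹ := by
  rw [expI, expI, ← Matrix.exp_conj _ _ hU, Matrix.mul_smul, Matrix.smul_mul]

theorem expI_transpose (t : ℝ) (M : Matrix (Fin m) (Fin m) ℂ) :
    expI t M.transpose = (expI t M).transpose := by
  rw [expI, expI, ← Matrix.exp_transpose, Matrix.transpose_smul]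

theorem expI_conjTranspose (t : ℝ) {M : Matrix (Fin m) (Fin m) ℂ} (hM : M.IsHermitian) :
    (expI t M).conjTranspose = expI (-t) M := by
  rw [expI, expI, ← Matrix.exp_conjTranspose, Matrix.conjTranspose_smul, hM.eq]
  simp

theorem expI_mem_unitaryGroup (t : ℝ) {M : Matrix (Fin m) (Fin m) ℂ} (hM : M.IsHermitian) :
    expI t M ∈ Matrix.unitaryGroup (Fin m) ℂ := by
  rw [Matrix.mem_unitaryGroup_iff, Matrix.star_eq_conjTranspose, expI_conjTranspose t hM,
    ← expI_add, add_neg_cancel, expI_zero]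

theorem norm_expI_apply_le (t : ℝ) {M : Matrix (Fin m) (Fin m) ℂ} (hM : M.IsHermitian)
    (i j : Fin m) : ‖expI t M i j‖ ≤ 1 :=
  entry_norm_bound_of_unitary (expI_mem_unitaryGroup t hM) i j

end ExpI

section Derivatives

variable {E F G : Type*} [NormedAddCommGroup E] [NormedSpace ℝ E] [NormedAddCommGroup F]
  [NormedSpace ℝ F] [NormedAddCommGroup G] [NormedSpace ℝ G]

theorem norm_iteratedFDeriv_comp_clm_le (g : G →L[ℝ] E) {f : E → F}
    (hf : ContDiff ℝ ((⊤ : ℕ∞) : WithTop ℕ∞) f) (x : G) (n : ℕ) :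
    ‖iteratedFDeriv ℝ n (fun y => f (g y)) x‖ ≤ ‖iteratedFDeriv ℝ n f (g x)‖ * ‖g‖ ^ n := by
  have h := g.iteratedFDeriv_comp_right hf x (i := n) (mod_cast le_top)
  rw [show (fun y => f (g y)) = f ∘ g from rfl, h]
  simpa using ContinuousMultilinearMap.norm_compContinuousLinearMap_le
    (iteratedFDeriv ℝ n f (g x)) fun _ => g

theorem iteratedFDeriv_slice {f : G × E → F} (hf : ContDiff ℝ ((⊤ : ℕ∞) : WithTop ℕ∞) f)
    (s : G) (x : E) (n : ℕ) :
    iteratedFDeriv ℝ n (fun y => f (s, y)) x =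
      (iteratedFDeriv ℝ n f (s, x)).compContinuousLinearMap
        fun _ => ContinuousLinearMap.inr ℝ G E := by
  have h1 : (fun y => f (s, y)) = (fun z => f ((s, 0) + z)) ∘ ContinuousLinearMap.inr ℝ G E := by
    ext y
    simp
  have h2 : ContDiff ℝ ((⊤ : ℕ∞) : WithTop ℕ∞) fun z => f ((s, 0) + z) :=
    hf.comp (contDiff_const.add contDiff_id)
  rw [h1, (ContinuousLinearMap.inr ℝ G E).iteratedFDeriv_comp_right h2 x (i := n)
    (mod_cast le_top), iteratedFDeriv_comp_add_left]
  simp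

theorem norm_iteratedFDeriv_slice_le {f : G × E → F}
    (hf : ContDiff ℝ ((⊤ : ℕ∞) : WithTop ℕ∞) f) (s : G) (x : E) (n : ℕ) :
    ‖iteratedFDeriv ℝ n (fun y => f (s, y)) x‖ ≤ ‖iteratedFDeriv ℝ n f (s, x)‖ := by
  rw [iteratedFDeriv_slice hf]
  refine (ContinuousMultilinearMap.norm_compContinuousLinearMap_le _ _).trans ?_
  rw [Finset.prod_const]
  exact mul_le_of_le_one_right (norm_nonneg _)
    (pow_le_one₀ (norm_nonneg _) (ContinuousLinearMap.norm_inr_le_one ℝ G E))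

theorem continuous_iteratedFDeriv_slice {f : G × E → F}
    (hf : ContDiff ℝ ((⊤ : ℕ∞) : WithTop ℕ∞) f) (n : ℕ) :
    Continuous fun p : G × E => iteratedFDeriv ℝ n (fun y => f (p.1, y)) p.2 := by
  simp only [iteratedFDeriv_slice hf]
  exact (ContinuousMultilinearMap.compContinuousLinearMapL
    (fun _ : Fin n => ContinuousLinearMap.inr ℝ G E)).continuous.comp
      (hf.continuous_iteratedFDeriv (mod_cast le_top))

/-- Differentiation under the integral sign, to all orders. -/
theorem contDiff_integral_and_iteratedFDeriv {P : Type*} [MeasurableSpace P] {κ : Measure P}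
    {f : P → E → F}
    (hf : ∀ p, ContDiff ℝ ((⊤ : ℕ∞) : WithTop ℕ∞) (f p))
    (hm : ∀ n x, AEStronglyMeasurable (fun p => iteratedFDeriv ℝ n (f p) x) κ)
    (hb : ∀ n, ∃ b : P → ℝ, Integrable b κ ∧ ∀ p x, ‖iteratedFDeriv ℝ n (f p) x‖ ≤ b p) :
    ContDiff ℝ ((⊤ : ℕ∞) : WithTop ℕ∞) (fun x => ∫ p, f p x ∂κ) ∧
      ∀ n, iteratedFDeriv ℝ n (fun x => ∫ p, f p x ∂κ) =
        fun x => ∫ p, iteratedFDeriv ℝ n (f p) x ∂κ := by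
  have hint : ∀ n x, Integrable (fun p => iteratedFDeriv ℝ n (f p) x) κ := fun n x => by
    obtain ⟨b, hb1, hb2⟩ := hb n
    exact hb1.mono' (hm n x) (.of_forall fun p => hb2 p x)
  have key : ∀ n x, HasFDerivAt (fun x => ∫ p, iteratedFDeriv ℝ n (f p) x ∂κ)
      (∫ p, fderiv ℝ (iteratedFDeriv ℝ n (f p)) x ∂κ) x := by
    intro n x
    obtain ⟨b, hb1, hb2⟩ := hb (n + 1)
    refine hasFDerivAt_integral_of_dominated_of_fderiv_le (𝕜 := ℝ) (s := Set.univ) (bound := b)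
      (F := fun x p => iteratedFDeriv ℝ n (f p) x)
      (F' := fun x p => fderiv ℝ (iteratedFDeriv ℝ n (f p)) x)
      univ_mem (.of_forall fun x => hm n x) (hint n x) ?_ (.of_forall fun p x _ => ?_) hb1
      (.of_forall fun p x _ => ?_)
    · have h := (continuousMultilinearCurryLeftEquiv ℝ
        (fun _ : Fin (n + 1) => E) F).continuous.comp_aestronglyMeasurable (hm (n + 1) x)
      exact h
    · rw [fderiv_iteratedFDeriv, Function.comp_apply, LinearIsometryEquiv.norm_map]
      exact hb2 p x
    · exact ((hf p).differentiable_iteratedFDeriv (mod_cast ENat.natCast_lt_top n)).differentiableAt.hasFDerivAt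
  have formula : ∀ n, iteratedFDeriv ℝ n (fun x => ∫ p, f p x ∂κ) =
      fun x => ∫ p, iteratedFDeriv ℝ n (f p) x ∂κ := by
    intro n
    induction n with
    | zero =>
      ext1 x
      simp only [iteratedFDeriv_zero_eq_comp, Function.comp_apply]
      exact ((continuousMultilinearCurryFin0 ℝ E F).symm.toContinuousLinearEquiv.integral_comp_comm
        _).symm
    | succ n ih =>
      ext1 x
      simp only [iteratedFDeriv_succ_eq_comp_left, Function.comp_apply]
      rw [ih, (key n x).fderiv]
      exact (ContinuousLinearEquiv.integral_comp_comm (𝕜 := ℝ) (μ := κ)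
        (E := E →L[ℝ] ContinuousMultilinearMap ℝ (fun _ : Fin n => E) F)
        (F := ContinuousMultilinearMap ℝ (fun _ : Fin (n + 1) => E) F)
        (continuousMultilinearCurryLeftEquiv ℝ
          (fun _ : Fin (n + 1) => E) F).symm.toContinuousLinearEquiv
        fun p => fderiv ℝ (iteratedFDeriv ℝ n (f p)) x).symm
  refine ⟨contDiff_of_differentiable_iteratedFDeriv fun n _ => ?_, formula⟩
  rw [formula n]
  exact fun x => (key n x).differentiableAt

theorem norm_iteratedFDeriv_mul_le_of_le {A : Type*} [NormedRing A] [NormedAlgebra ℝ A]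
    {f g : E → A} (hf : ContDiff ℝ ((⊤ : ℕ∞) : WithTop ℕ∞) f)
    (hg : ContDiff ℝ ((⊤ : ℕ∞) : WithTop ℕ∞) g) {x : E} {n : ℕ} {a b : ℝ}
    (ha : ∀ i ≤ n, ‖iteratedFDeriv ℝ i f x‖ ≤ a) (hb : ∀ i ≤ n, ‖iteratedFDeriv ℝ i g x‖ ≤ b) :
    ‖iteratedFDeriv ℝ n (fun y => f y * g y) x‖ ≤ 2 ^ n * a * b := by
  have ha0 : 0 ≤ a := (norm_nonneg _).trans (ha 0 n.zero_le)
  refine (norm_iteratedFDeriv_mul_le hf hg x (n := n) (mod_cast le_top)).trans ?_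
  calc _ ≤ ∑ i ∈ Finset.range (n + 1), (n.choose i : ℝ) * a * b := by
        refine Finset.sum_le_sum fun i hi => ?_
        have := ha i (Finset.mem_range_succ_iff.1 hi)
        have := hb (n - i) (Nat.sub_le _ _)
        gcongr
    _ = 2 ^ n * a * b := by
        rw [← Finset.sum_mul, ← Finset.sum_mul]
        congr 2
        exact_mod_cast Nat.sum_range_choose n

/-- If the derivatives of `f` are bounded by a geometric progression, so are those of its powers,
with a ratio that grows linearly with the power. -/
theorem norm_iteratedFDeriv_pow_le {A : Type*} [NormedRing A] [NormedAlgebra ℝ A]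
    {f : E → A} (hf : ContDiff ℝ ((⊤ : ℕ∞) : WithTop ℕ∞) f) {x : E} {n : ℕ} {b : ℝ}
    (hb0 : 0 ≤ b) (hb : ∀ i ≤ n, ‖iteratedFDeriv ℝ i f x‖ ≤ b ^ i) (N : ℕ) :
    ∀ i ≤ n, ‖iteratedFDeriv ℝ i (fun y => f y ^ (N + 1)) x‖ ≤ ((N + 1) * b) ^ i := by
  induction N with
  | zero => simpa using hb
  | succ N ih =>
    intro i hi
    have e : (fun y => f y ^ (N + 1 + 1)) = fun y => f y ^ (N + 1) * f y := by
      ext y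
      rw [pow_succ]
    rw [e]
    refine (norm_iteratedFDeriv_mul_le (hf.pow _) hf x (n := i) (mod_cast le_top)).trans ?_
    have e2 : (((N + 1 : ℕ) : ℝ) + 1) * b = (N + 1) * b + b := by push_cast; ring
    rw [e2, add_pow]
    refine Finset.sum_le_sum fun j hj => ?_
    have hj' := Finset.mem_range_succ_iff.1 hj
    have h1 := ih j (hj'.trans hi)
    have h2 := hb (i - j) ((Nat.sub_le _ _).trans hi)
    rw [mul_comm _ (i.choose j : ℝ), ← mul_assoc]
    gcongr

end Derivatives

section Moderate

variable {d m : ℕ}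

/-- Smooth functions of time and momentum whose derivatives grow at most polynomially in time,
locally uniformly in momentum. -/
def Moderate (F : ℝ × Space d → ℂ) : Prop :=
  ContDiff ℝ ((⊤ : ℕ∞) : WithTop ℕ∞) F ∧ ∀ (L : Set (Space d)), IsCompact L → ∀ n : ℕ,
    ∃ (c : ℝ) (Q : ℕ), ∀ s, ∀ k ∈ L, ‖iteratedFDeriv ℝ n F (s, k)‖ ≤ c * (1 + |s|) ^ Q

/-- Smooth functions of time and momentum whose derivatives decrease in time faster than any
power, locally uniformly in momentum. -/
def Rapid (F : ℝ × Space d → ℂ) : Prop :=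
  ContDiff ℝ ((⊤ : ℕ∞) : WithTop ℕ∞) F ∧ ∀ (L : Set (Space d)), IsCompact L → ∀ n P : ℕ,
    ∃ c : ℝ, ∀ s, ∀ k ∈ L, ‖iteratedFDeriv ℝ n F (s, k)‖ * (1 + |s|) ^ P ≤ c

theorem Moderate.bound_le {F : ℝ × Space d → ℂ} (hF : Moderate F) {L : Set (Space d)}
    (hL : IsCompact L) (n : ℕ) : ∃ (c : ℝ) (Q : ℕ), 0 ≤ c ∧ ∀ i ≤ n, ∀ s, ∀ k ∈ L,
      ‖iteratedFDeriv ℝ i F (s, k)‖ ≤ c * (1 + |s|) ^ Q := by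
  choose c Q h using hF.2 L hL
  refine ⟨∑ i ∈ Finset.range (n + 1), |c i|, ∑ i ∈ Finset.range (n + 1), Q i,
    Finset.sum_nonneg fun _ _ => abs_nonneg _, fun i hi s k hk => (h i s k hk).trans ?_⟩
  have hi' : i ∈ Finset.range (n + 1) := Finset.mem_range_succ_iff.2 hi
  have h1 : c i ≤ ∑ i ∈ Finset.range (n + 1), |c i| := (le_abs_self _).trans
    (Finset.single_le_sum (f := fun i => |c i|) (fun _ _ => abs_nonneg _) hi')
  have h2 : Q i ≤ ∑ i ∈ Finset.range (n + 1), Q i :=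
    Finset.single_le_sum (f := Q) (fun _ _ => Nat.zero_le _) hi'
  have h3 : (1 : ℝ) ≤ 1 + |s| := by linarith [abs_nonneg s]
  exact mul_le_mul h1 (pow_le_pow_right₀ h3 h2) (by positivity)
    (Finset.sum_nonneg fun _ _ => abs_nonneg _)

theorem Rapid.bound_le {F : ℝ × Space d → ℂ} (hF : Rapid F) {L : Set (Space d)}
    (hL : IsCompact L) (n P : ℕ) : ∃ c : ℝ, 0 ≤ c ∧ ∀ i ≤ n, ∀ s, ∀ k ∈ L,
      ‖iteratedFDeriv ℝ i F (s, k)‖ * (1 + |s|) ^ P ≤ c := by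
  choose c h using fun n => hF.2 L hL n P
  refine ⟨∑ i ∈ Finset.range (n + 1), |c i|, Finset.sum_nonneg fun _ _ => abs_nonneg _,
    fun i hi s k hk => (h i s k hk).trans ?_⟩
  exact (le_abs_self _).trans (Finset.single_le_sum (f := fun i => |c i|)
    (fun _ _ => abs_nonneg _) (Finset.mem_range_succ_iff.2 hi))

theorem Moderate.mul {F G : ℝ × Space d → ℂ} (hF : Moderate F) (hG : Moderate G) :
    Moderate fun p => F p * G p := by
  refine ⟨hF.1.mul hG.1, fun L hL n => ?_⟩
  obtain ⟨c, Q, hc, h⟩ := hF.bound_le hL n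
  obtain ⟨c', Q', hc', h'⟩ := hG.bound_le hL n
  refine ⟨2 ^ n * c * c', Q + Q', fun s k hk => ?_⟩
  refine (norm_iteratedFDeriv_mul_le_of_le hF.1 hG.1 (fun i hi => h i hi s k hk)
    fun i hi => h' i hi s k hk).trans_eq ?_
  rw [pow_add]
  ring

theorem Rapid.mul_moderate {F G : ℝ × Space d → ℂ} (hF : Rapid F) (hG : Moderate G) :
    Rapid fun p => F p * G p := by
  refine ⟨hF.1.mul hG.1, fun L hL n P => ?_⟩
  obtain ⟨c', Q', hc', h'⟩ := hG.bound_le hL n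
  obtain ⟨c, hc, h⟩ := hF.bound_le hL n (P + Q')
  refine ⟨2 ^ n * c * c', fun s k hk => ?_⟩
  have h0 : 0 < 1 + |s| := by positivity
  have := norm_iteratedFDeriv_mul_le_of_le hF.1 hG.1 (a := c / (1 + |s|) ^ (P + Q'))
    (fun i hi => (le_div_iff₀ (by positivity)).2 (h i hi s k hk)) fun i hi => h' i hi s k hk
  refine (mul_le_mul_of_nonneg_right this (by positivity)).trans_eq ?_
  rw [pow_add]
  field_simp

theorem Moderate.of_momentum {φ : Space d → ℂ} (hφ : ContDiff ℝ ((⊤ : ℕ∞) : WithTop ℕ∞) φ) :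
    Moderate fun p : ℝ × Space d => φ p.2 := by
  refine ⟨hφ.comp contDiff_snd, fun L hL n => ?_⟩
  obtain ⟨c, hc⟩ := hL.exists_bound_of_continuousOn
    (hφ.continuous_iteratedFDeriv (m := n) (mod_cast le_top)).continuousOn
  refine ⟨c, 0, fun s k hk => ?_⟩
  rw [pow_zero, mul_one]
  refine (norm_iteratedFDeriv_comp_clm_le (ContinuousLinearMap.snd ℝ ℝ (Space d)) hφ _ n).trans ?_
  exact (mul_le_of_le_one_right (norm_nonneg _) (pow_le_one₀ (norm_nonneg _)
    (ContinuousLinearMap.norm_snd_le ℝ ℝ (Space d)))).trans (hc k hk)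

theorem Moderate.sum {ι : Type*} {s : Finset ι} {F : ι → ℝ × Space d → ℂ}
    (h : ∀ i ∈ s, Moderate (F i)) : Moderate fun p => ∑ i ∈ s, F i p := by
  refine ⟨ContDiff.sum fun i hi => (h i hi).1, fun L hL n => ?_⟩
  choose! c Q h' using fun i (hi : i ∈ s) => (h i hi).2 L hL n
  refine ⟨∑ i ∈ s, |c i|, ∑ i ∈ s, Q i, fun t k hk => ?_⟩
  have h3 : (1 : ℝ) ≤ 1 + |t| := by linarith [abs_nonneg t]
  rw [iteratedFDeriv_fun_sum_apply fun i hi => ((h i hi).1.of_le (mod_cast le_top)).contDiffAt,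
    Finset.sum_mul]
  refine (norm_sum_le _ _).trans (Finset.sum_le_sum fun i hi => (h' i hi t k hk).trans ?_)
  exact mul_le_mul (le_abs_self _) (pow_le_pow_right₀ h3
    (Finset.single_le_sum (f := Q) (fun _ _ => Nat.zero_le _) hi)) (by positivity) (abs_nonneg _)

theorem Rapid.sum {ι : Type*} {s : Finset ι} {F : ι → ℝ × Space d → ℂ}
    (h : ∀ i ∈ s, Rapid (F i)) : Rapid fun p => ∑ i ∈ s, F i p := by
  refine ⟨ContDiff.sum fun i hi => (h i hi).1, fun L hL n P => ?_⟩
  choose! c h' using fun i (hi : i ∈ s) => (h i hi).2 L hL n P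
  refine ⟨∑ i ∈ s, c i, fun t k hk => ?_⟩
  rw [iteratedFDeriv_fun_sum_apply fun i hi => ((h i hi).1.of_le (mod_cast le_top)).contDiffAt]
  refine (mul_le_mul_of_nonneg_right (norm_sum_le _ _) (by positivity)).trans ?_
  rw [Finset.sum_mul]
  exact Finset.sum_le_sum fun i hi => h' i hi t k hk

theorem contDiff_legConj {E : Type*} [NormedAddCommGroup E] [NormedSpace ℝ E] {r : ℕ} {a : ℕ}
    {i : Fin r} {f : E → ℂ} (hf : ContDiff ℝ ((⊤ : ℕ∞) : WithTop ℕ∞) f) :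
    ContDiff ℝ ((⊤ : ℕ∞) : WithTop ℕ∞) fun x => legConj a i (f x) := by
  unfold legConj
  split_ifs
  exacts [hf, Complex.conjCLE.contDiff.comp hf]

theorem norm_iteratedFDeriv_legConj {E : Type*} [NormedAddCommGroup E] [NormedSpace ℝ E] {r : ℕ}
    {a : ℕ} {i : Fin r} (f : E → ℂ) (n : ℕ) (x : E) :
    ‖iteratedFDeriv ℝ n (fun x => legConj a i (f x)) x‖ = ‖iteratedFDeriv ℝ n f x‖ := by
  unfold legConj
  split_ifs
  exacts [rfl, Complex.conjLIE.norm_iteratedFDeriv_comp_left f x n]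

theorem Moderate.legConj {r a : ℕ} {i : Fin r} {F : ℝ × Space d → ℂ} (hF : Moderate F) :
    Moderate fun p => legConj a i (F p) :=
  ⟨contDiff_legConj hF.1, by simpa only [norm_iteratedFDeriv_legConj] using hF.2⟩

theorem Rapid.legConj {r a : ℕ} {i : Fin r} {F : ℝ × Space d → ℂ} (hF : Rapid F) :
    Rapid fun p => legConj a i (F p) :=
  ⟨contDiff_legConj hF.1, by simpa only [norm_iteratedFDeriv_legConj] using hF.2⟩

theorem Moderate.comp_neg {F : ℝ × Space d → ℂ} (hF : Moderate F) :
    Moderate fun p => F (-p.1, p.2) := by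
  set g : ℝ × Space d →L[ℝ] ℝ × Space d :=
    (-ContinuousLinearMap.fst ℝ ℝ (Space d)).prod (ContinuousLinearMap.snd ℝ ℝ (Space d))
  refine ⟨hF.1.comp g.contDiff, fun L hL n => ?_⟩
  obtain ⟨c, Q, h⟩ := hF.2 L hL n
  have hg : ‖g‖ ≤ 1 := ContinuousLinearMap.opNorm_le_bound _ zero_le_one fun p => by
    simp [g, Prod.norm_def]
  refine ⟨c, Q, fun s k hk => ?_⟩
  refine (norm_iteratedFDeriv_comp_clm_le g hF.1 (s, k) n).trans ?_
  refine (mul_le_of_le_one_right (norm_nonneg _) (pow_le_one₀ (norm_nonneg _) hg)).trans ?_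
  simpa [g] using h (-s) k hk

/-- Multiplying a rapidly decreasing function by powers of time leaves its derivatives in momentum
bounded. -/
theorem Rapid.slice_bound {F : ℝ × Space d → ℂ} (hF : Rapid F) {L : Set (Space d)}
    (hL : IsCompact L) (n P : ℕ) : ∃ c : ℝ, 0 ≤ c ∧ ∀ i ≤ n, ∀ s, ∀ k ∈ L,
      ‖iteratedFDeriv ℝ i (fun k => F (s, k)) k‖ ≤ c / (1 + |s|) ^ P := by
  obtain ⟨c, hc, h⟩ := hF.bound_le hL n P
  refine ⟨c, hc, fun i hi s k hk => (norm_iteratedFDeriv_slice_le hF.1 s k i).trans ?_⟩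
  exact (le_div_iff₀ (by positivity)).2 (h i hi s k hk)

section Exp

open scoped Matrix.Norms.L2Operator

theorem norm_expI_le_one (t : ℝ) {M : Matrix (Fin m) (Fin m) ℂ} (hM : M.IsHermitian) :
    ‖expI t M‖ ≤ 1 := by
  rcases subsingleton_or_nontrivial (Matrix (Fin m) (Fin m) ℂ) with h | h
  · rw [Subsingleton.elim (expI t M) 0, norm_zero]
    exact zero_le_one
  · exact (CStarRing.norm_of_mem_unitary (expI_mem_unitaryGroup t hM)).le

theorem Dispersion.contDiff_E (D : Dispersion d m) :
    ContDiff ℝ ((⊤ : ℕ∞) : WithTop ℕ∞) D.E := by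
  have e : D.E = fun k => ∑ i, ∑ j, D.E k i j • Matrix.single i j (1 : ℂ) := by
    ext1 k
    conv_lhs => rw [Matrix.matrix_eq_sum_single (D.E k)]
    simp
  rw [e]
  refine ContDiff.sum fun i _ => ContDiff.sum fun j _ => ?_
  exact (D.growth i j).1.smul contDiff_const

theorem contDiff_expI_matrix (D : Dispersion d m) :
    ContDiff ℝ ((⊤ : ℕ∞) : WithTop ℕ∞) fun p : ℝ × Space d => expI p.1 (D.E p.2) := by
  have h1 : ContDiff ℝ ((⊤ : ℕ∞) : WithTop ℕ∞)
      (NormedSpace.exp : Matrix (Fin m) (Fin m) ℂ → Matrix (Fin m) (Fin m) ℂ) :=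
    (AnalyticOnNhd.contDiff fun x _ => NormedSpace.exp_analytic (𝕂 := ℝ) x)
  have h2 : ContDiff ℝ ((⊤ : ℕ∞) : WithTop ℕ∞)
      fun p : ℝ × Space d => (Complex.I * (p.1 : ℂ)) • D.E p.2 :=
    (contDiff_const.mul (Complex.ofRealCLM.contDiff.comp contDiff_fst)).smul
      (D.contDiff_E.comp contDiff_snd)
  exact h1.comp h2

theorem contDiff_expI (D : Dispersion d m) (μ ν : Fin m) :
    ContDiff ℝ ((⊤ : ℕ∞) : WithTop ℕ∞) fun p : ℝ × Space d => expI p.1 (D.E p.2) μ ν :=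
  ((Matrix.entryLinearMap ℂ ℂ μ ν).restrictScalars ℝ).toContinuousLinearMap.contDiff.comp
    (contDiff_expI_matrix D)

/-- The derivatives of `exp (i s E(k))` of order `n` grow at most like `|s| ^ n`: for large `s` the
exponential is a power of an exponential with bounded time. -/
theorem exists_norm_iteratedFDeriv_expI_le (D : Dispersion d m) (μ ν : Fin m)
    {L : Set (Space d)} (hL : IsCompact L) (n : ℕ) : ∃ c : ℝ, ∀ s, ∀ k ∈ L,
      ‖iteratedFDeriv ℝ n (fun p : ℝ × Space d => expI p.1 (D.E p.2) μ ν) (s, k)‖ ≤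
        c * (1 + |s|) ^ n := by
  have hG := contDiff_expI_matrix D
  set G : ℝ × Space d → Matrix (Fin m) (Fin m) ℂ := fun p => expI p.1 (D.E p.2) with hGdef
  set ent : Matrix (Fin m) (Fin m) ℂ →L[ℝ] ℂ :=
    ((Matrix.entryLinearMap ℂ ℂ μ ν).restrictScalars ℝ).toContinuousLinearMap with hent
  have hent' : (fun p : ℝ × Space d => expI p.1 (D.E p.2) μ ν) = ent ∘ G := rfl
  rw [hent']
  have hK : IsCompact (Set.Icc (-1 : ℝ) 1 ×ˢ L) := isCompact_Icc.prod hL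
  choose c hc using fun i : ℕ => hK.exists_bound_of_continuousOn
    (hG.continuous_iteratedFDeriv (m := i) (mod_cast le_top)).continuousOn
  set b : ℝ := 1 + ∑ i ∈ Finset.range (n + 1), |c i| with hb
  have hb1 : 1 ≤ b := by
    rw [hb]
    have := Finset.sum_nonneg fun i (_ : i ∈ Finset.range (n + 1)) => abs_nonneg (c i)
    linarith
  -- For `i = 0` the bound `b ^ i = 1` is the unitarity of the exponential.
  have hGb : ∀ p ∈ Set.Icc (-1 : ℝ) 1 ×ˢ L, ∀ i ≤ n, ‖iteratedFDeriv ℝ i G p‖ ≤ b ^ i := by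
    intro p hp i hi
    rcases Nat.eq_zero_or_pos i with rfl | h0
    · rw [norm_iteratedFDeriv_zero, pow_zero]
      exact norm_expI_le_one _ (D.hermitian _)
    · refine (hc i p hp).trans ((?_ : c i ≤ b).trans (le_self_pow₀ hb1 h0.ne'))
      have := Finset.single_le_sum (f := fun i => |c i|) (fun _ _ => abs_nonneg _)
        (Finset.mem_range_succ_iff.2 hi)
      linarith [le_abs_self (c i)]
  refine ⟨‖ent‖ * (2 * b) ^ n, fun s k hk => ?_⟩
  refine (ent.norm_iteratedFDeriv_comp_left (hG.contDiffAt (x := (s, k))) (n := n)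
    (mod_cast le_top)).trans ?_
  rw [mul_assoc]
  refine mul_le_mul_of_nonneg_left ?_ (norm_nonneg _)
  -- `exp (i s E) = exp (i s E / (N + 1)) ^ (N + 1)`, where `|s| / (N + 1) ≤ 1`.
  set N : ℕ := ⌈|s|⌉₊ with hN
  set g : ℝ × Space d →L[ℝ] ℝ × Space d :=
    ((((N : ℝ) + 1)⁻¹) • ContinuousLinearMap.fst ℝ ℝ (Space d)).prod
      (ContinuousLinearMap.snd ℝ ℝ (Space d)) with hg
  have hN0 : (0 : ℝ) < (N : ℝ) + 1 := by positivity
  have hinv : ((N : ℝ) + 1)⁻¹ ≤ 1 := inv_le_one_of_one_le₀ (by linarith [Nat.cast_nonneg (α := ℝ) N])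
  have hgn : ‖g‖ ≤ 1 := ContinuousLinearMap.opNorm_le_bound _ zero_le_one fun p => by
    simp only [hg, ContinuousLinearMap.prod_apply, one_mul, Prod.norm_def]
    refine max_le_max ?_ le_rfl
    simp only [smul_apply, ContinuousLinearMap.coe_fst', smul_eq_mul, norm_mul]
    refine mul_le_of_le_one_left (norm_nonneg _) ?_
    rwa [Real.norm_of_nonneg (by positivity)]
  have e : G = fun p => (fun q => G (g q)) p ^ (N + 1) := by
    ext1 p
    simp only [hGdef, hg, ContinuousLinearMap.prod_apply, smul_apply,
      ContinuousLinearMap.coe_fst', ContinuousLinearMap.coe_snd', smul_eq_mul]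
    rw [← expI_nsmul]
    congr 1
    push_cast
    field_simp
  have hmem : g (s, k) ∈ Set.Icc (-1 : ℝ) 1 ×ˢ L := by
    refine ⟨?_, hk⟩
    simp only [hg, ContinuousLinearMap.prod_apply, smul_apply,
      ContinuousLinearMap.coe_fst', smul_eq_mul]
    have : |((N : ℝ) + 1)⁻¹ * s| ≤ 1 := by
      rw [abs_mul, abs_of_pos (inv_pos.2 hN0), inv_mul_le_iff₀ hN0]
      linarith [Nat.le_ceil |s|]
    exact abs_le.1 this
  have h1 : ∀ i ≤ n, ‖iteratedFDeriv ℝ i (fun q => G (g q)) (s, k)‖ ≤ b ^ i := fun i hi =>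
    (norm_iteratedFDeriv_comp_clm_le g hG (s, k) i).trans
      ((mul_le_of_le_one_right (norm_nonneg _) (pow_le_one₀ (norm_nonneg _) hgn)).trans
        (hGb _ hmem i hi))
  have h2 := norm_iteratedFDeriv_pow_le (hG.comp g.contDiff) (zero_le_one.trans hb1) h1 N n le_rfl
  rw [e]
  refine h2.trans ?_
  rw [← mul_pow]
  refine pow_le_pow_left₀ (by positivity) ?_ n
  have : (N : ℝ) < |s| + 1 := Nat.ceil_lt_add_one (abs_nonneg s)
  nlinarith [abs_nonneg s]

theorem moderate_expI (D : Dispersion d m) (μ ν : Fin m) :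
    Moderate fun p : ℝ × Space d => expI p.1 (D.E p.2) μ ν :=
  ⟨contDiff_expI D μ ν, fun _ hL n =>
    (exists_norm_iteratedFDeriv_expI_le D μ ν hL n).imp fun _ h => ⟨n, h⟩⟩

end Exp

end Moderate

end AQFT

namespace AQFT

/-! ### Partial Fourier transforms -/

section PartialFourier

variable {d m : ℕ}

theorem integrable_inv_one_add_norm_pow :
    Integrable fun x : Space d => ((1 + ‖x‖) ^ (d + 1))⁻¹ := by
  have h := integrable_one_add_norm (E := Space d) (μ := volume) (r := ((d + 1 : ℕ) : ℝ))
    (by rw [finrank_euclideanSpace_fin]; push_cast; linarith)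
  refine h.congr (.of_forall fun x => ?_)
  simp only
  rw [Real.rpow_neg (by positivity), Real.rpow_natCast]

theorem planeWave_add (k x y : Space d) : planeWave k (x + y) = planeWave k x * planeWave k y := by
  rw [planeWave, planeWave, planeWave, ← Complex.exp_add, inner_add_right]
  push_cast
  rw [mul_add]

theorem norm_planeWave (k x : Space d) : ‖planeWave k x‖ = 1 := by
  rw [planeWave, mul_comm]
  exact Complex.norm_exp_ofReal_mul_I _

theorem conj_planeWave (k x : Space d) : (starRingEnd ℂ) (planeWave k x) = planeWave k (-x) := by
  rw [planeWave, planeWave, ← Complex.exp_conj, inner_neg_right]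
  simp

theorem contDiff_planeWave : ContDiff ℝ ((⊤ : ℕ∞) : WithTop ℕ∞)
    fun p : Space d × Space d => planeWave p.1 p.2 :=
  (contDiff_const.mul (Complex.ofRealCLM.contDiff.comp (contDiff_fst.inner ℝ contDiff_snd))).cexp

theorem continuous_planeWave : Continuous fun p : Space d × Space d => planeWave p.1 p.2 :=
  contDiff_planeWave.continuous

theorem norm_iteratedFDeriv_exp_I_mul (n : ℕ) (t : ℝ) :
    ‖iteratedFDeriv ℝ n (fun t : ℝ => Complex.exp (Complex.I * (t : ℂ))) t‖ = 1 := by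
  have h : ∀ n : ℕ, iteratedDeriv n (fun t : ℝ => Complex.exp (Complex.I * (t : ℂ))) =
      fun t : ℝ => Complex.I ^ n * Complex.exp (Complex.I * (t : ℂ)) := by
    intro n
    induction n with
    | zero => simp
    | succ n ih =>
      rw [iteratedDeriv_succ, ih]
      ext t
      have h1 : HasDerivAt (fun t : ℝ => Complex.exp (Complex.I * (t : ℂ)))
          (Complex.exp (Complex.I * (t : ℂ)) * (Complex.I * 1)) t :=
        (Complex.ofRealCLM.hasDerivAt.const_mul Complex.I).cexp
      rw [(h1.const_mul _).deriv, pow_succ]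
      ring
  rw [norm_iteratedFDeriv_eq_norm_iteratedDeriv, h, norm_mul, norm_pow, Complex.norm_I, one_pow,
    one_mul, mul_comm, Complex.norm_exp_ofReal_mul_I]

theorem norm_iteratedFDeriv_planeWave_le (y : Space d) (p : ℝ × Space d) (n : ℕ) :
    ‖iteratedFDeriv ℝ n (fun p : ℝ × Space d => planeWave p.2 y) p‖ ≤ ‖y‖ ^ n := by
  set g : ℝ × Space d →L[ℝ] ℝ := (innerSL ℝ y).comp (ContinuousLinearMap.snd ℝ ℝ (Space d))
  have e : (fun p : ℝ × Space d => planeWave p.2 y) =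
      fun p => (fun t : ℝ => Complex.exp (Complex.I * (t : ℂ))) (g p) := by
    ext p
    simp [planeWave, g, real_inner_comm]
  have hg : ‖g‖ ≤ ‖y‖ := by
    refine ((innerSL ℝ y).opNorm_comp_le _).trans ?_
    rw [innerSL_apply_norm]
    exact mul_le_of_le_one_right (norm_nonneg _) (ContinuousLinearMap.norm_snd_le ℝ ℝ (Space d))
  rw [e]
  refine (norm_iteratedFDeriv_comp_clm_le (f := fun t : ℝ => Complex.exp (Complex.I * (t : ℂ))) g
    (contDiff_const.mul Complex.ofRealCLM.contDiff).cexp p n).trans ?_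
  rw [norm_iteratedFDeriv_exp_I_mul, one_mul]
  exact pow_le_pow_left₀ (norm_nonneg _) hg n

/-- The Fourier transform of a test function of space-time with respect to the space variable. -/
noncomputable def partialFourier (φ : 𝓢(ℝ × Space d, ℂ)) (p : ℝ × Space d) : ℂ :=
  ∫ y, φ (p.1, y) * planeWave p.2 y

theorem SchwartzMap_slice_contDiff (φ : 𝓢(ℝ × Space d, ℂ)) (y : Space d) :
    ContDiff ℝ ((⊤ : ℕ∞) : WithTop ℕ∞) fun p : ℝ × Space d => φ (p.1, y) :=
  (φ.smooth ⊤).comp (contDiff_fst.prodMk contDiff_const)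

/-- The `n` powers of `y` that arise from derivatives of the plane wave are absorbed in the rapid
decrease of `φ`. -/
theorem norm_iteratedFDeriv_partialFourier_integrand_le (φ : 𝓢(ℝ × Space d, ℂ)) (n P : ℕ) :
    ∃ c : ℝ, ∀ (y : Space d) (p : ℝ × Space d),
      ‖iteratedFDeriv ℝ n (fun p : ℝ × Space d => φ (p.1, y) * planeWave p.2 y) p‖ ≤
        c * ((1 + |p.1|) ^ P)⁻¹ * ((1 + ‖y‖) ^ (d + 1))⁻¹ := by
  set M : ℕ × ℕ := (P + (n + (d + 1)), n) with hM
  set c : ℝ := 2 ^ M.1 * (Finset.Iic M).sup (fun m => SchwartzMap.seminorm ℝ m.1 m.2) φ with hc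
  refine ⟨2 ^ n * c, fun y p => ?_⟩
  have h0 : 0 < 1 + |p.1| := by positivity
  have h0' : 0 < 1 + ‖y‖ := by positivity
  have ha : ∀ i ≤ n, ‖iteratedFDeriv ℝ i (fun p : ℝ × Space d => φ (p.1, y)) p‖ ≤
      c / ((1 + |p.1|) ^ P * (1 + ‖y‖) ^ (n + (d + 1))) := by
    intro i hi
    set g : ℝ × Space d →L[ℝ] ℝ × Space d :=
      (ContinuousLinearMap.inl ℝ ℝ (Space d)).comp (ContinuousLinearMap.fst ℝ ℝ (Space d)) with hg
    have hgn : ‖g‖ ≤ 1 := ContinuousLinearMap.opNorm_le_bound _ zero_le_one fun p => by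
      simp [hg, Prod.norm_def]
    have e : (fun p : ℝ × Space d => φ (p.1, y)) = fun p => (fun z => φ ((0, y) + z)) (g p) := by
      ext p
      simp [hg]
    rw [e]
    refine (norm_iteratedFDeriv_comp_clm_le (f := fun z => φ ((0, y) + z)) g
      ((φ.smooth ⊤).comp (contDiff_const.add contDiff_id)) p i).trans ?_
    refine (mul_le_of_le_one_right (norm_nonneg _) (pow_le_one₀ (norm_nonneg _) hgn)).trans ?_
    rw [iteratedFDeriv_comp_add_left]
    have e2 : ((0, y) + g p : ℝ × Space d) = (p.1, y) := by simp [hg]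
    rw [e2, le_div_iff₀ (by positivity), mul_comm]
    refine (mul_le_mul_of_nonneg_right ?_ (norm_nonneg _)).trans
      (SchwartzMap.one_add_le_sup_seminorm_apply (𝕜 := ℝ) (m := M) (k := M.1) (n := i) le_rfl
        hi φ (p.1, y))
    have e3 : (1 + ‖((p.1, y) : ℝ × Space d)‖) ^ M.1 = (1 + ‖((p.1, y) : ℝ × Space d)‖) ^ P *
        (1 + ‖((p.1, y) : ℝ × Space d)‖) ^ (n + (d + 1)) := pow_add _ _ _
    rw [e3]
    have h1 : |p.1| ≤ ‖((p.1, y) : ℝ × Space d)‖ := norm_fst_le ((p.1, y) : ℝ × Space d)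
    have h2 : ‖y‖ ≤ ‖((p.1, y) : ℝ × Space d)‖ := norm_snd_le ((p.1, y) : ℝ × Space d)
    gcongr
  have hb : ∀ i ≤ n, ‖iteratedFDeriv ℝ i (fun p : ℝ × Space d => planeWave p.2 y) p‖ ≤
      (1 + ‖y‖) ^ n := fun i hi => by
    refine (norm_iteratedFDeriv_planeWave_le y p i).trans ?_
    calc ‖y‖ ^ i ≤ (1 + ‖y‖) ^ i := pow_le_pow_left₀ (norm_nonneg _) (by linarith) i
      _ ≤ (1 + ‖y‖) ^ n := pow_le_pow_right₀ (by linarith [norm_nonneg y]) hi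
  refine (norm_iteratedFDeriv_mul_le_of_le (SchwartzMap_slice_contDiff φ y)
    (contDiff_planeWave.comp (contDiff_snd.prodMk contDiff_const)) ha hb).trans_eq ?_
  rw [pow_add (1 + ‖y‖) n]
  field_simp

theorem rapid_partialFourier (φ : 𝓢(ℝ × Space d, ℂ)) : Rapid (partialFourier φ) := by
  set f : Space d → ℝ × Space d → ℂ := fun y p => φ (p.1, y) * planeWave p.2 y with hf
  have hsm : ∀ y, ContDiff ℝ ((⊤ : ℕ∞) : WithTop ℕ∞) (f y) := fun y =>
    (SchwartzMap_slice_contDiff φ y).mul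
      (contDiff_planeWave.comp (contDiff_snd.prodMk contDiff_const))
  have hjoint : ContDiff ℝ ((⊤ : ℕ∞) : WithTop ℕ∞)
      fun q : Space d × (ℝ × Space d) => f q.1 q.2 :=
    ((φ.smooth ⊤).comp ((contDiff_fst.comp contDiff_snd).prodMk contDiff_fst)).mul
      (contDiff_planeWave.comp ((contDiff_snd.comp contDiff_snd).prodMk contDiff_fst))
  have key := contDiff_integral_and_iteratedFDeriv (κ := volume) hsm (fun n p =>
    ((continuous_iteratedFDeriv_slice hjoint n).comp
      (continuous_id.prodMk continuous_const)).aestronglyMeasurable) (fun n => by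
      obtain ⟨c, hc⟩ := norm_iteratedFDeriv_partialFourier_integrand_le φ n 0
      refine ⟨_, integrable_inv_one_add_norm_pow.const_mul c, fun y p => ?_⟩
      simpa using hc y p)
  refine ⟨key.1, fun L hL n P => ?_⟩
  obtain ⟨c, hc⟩ := norm_iteratedFDeriv_partialFourier_integrand_le φ n P
  refine ⟨c * ∫ y : Space d, ((1 + ‖y‖) ^ (d + 1))⁻¹, fun s k _ => ?_⟩
  have h0 : 0 < 1 + |s| := by positivity
  have e : iteratedFDeriv ℝ n (partialFourier φ) (s, k) =
      ∫ y, iteratedFDeriv ℝ n (f y) (s, k) := congrFun (key.2 n) (s, k)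
  rw [e]
  have h1 := norm_integral_le_of_norm_le
    (integrable_inv_one_add_norm_pow.const_mul (c * ((1 + |s|) ^ P)⁻¹))
    (.of_forall fun y => hc y (s, k))
  rw [integral_const_mul] at h1
  refine (mul_le_mul_of_nonneg_right h1 (by positivity)).trans_eq ?_
  field_simp

end PartialFourier

/-! ### Wave packets -/

section Wave

variable {d m r : ℕ}

theorem exists_cutoff {K : Set (Space d)} (hK : IsCompact K) : ∃ χ : Space d → ℝ,
    ContDiff ℝ ((⊤ : ℕ∞) : WithTop ℕ∞) χ ∧ HasCompactSupport χ ∧ ∀ k ∈ K, χ k = 1 := by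
  have hsub : K ⊆ interior (Metric.cthickening 1 K) :=
    (Metric.self_subset_thickening one_pos K).trans
      (interior_maximal (Metric.thickening_subset_cthickening 1 K) Metric.isOpen_thickening)
  obtain ⟨f, h1, h2, -⟩ := exists_contMDiffMap_one_nhds_of_subset_interior
    (n := ⊤) (modelWithCornersSelf ℝ (Space d)) hK.isClosed hsub
  refine ⟨f, f.contMDiff.contDiff, ?_, fun k hk => h1.self_of_nhdsSet k hk⟩
  exact HasCompactSupport.intro (hK.cthickening (r := 1)) fun x hx => h2 x hx

theorem norm_legConj (a : ℕ) (i : Fin r) (z : ℂ) : ‖legConj a i z‖ = ‖z‖ := by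
  unfold legConj
  split_ifs
  exacts [rfl, RCLike.norm_conj z]

theorem legConj_mul (a : ℕ) (i : Fin r) (z w : ℂ) :
    legConj a i (z * w) = legConj a i z * legConj a i w := by
  unfold legConj
  split_ifs
  exacts [rfl, map_mul _ _ _]

theorem legConj_one (a : ℕ) (i : Fin r) : legConj a i 1 = 1 := by
  unfold legConj
  split_ifs
  exacts [rfl, map_one _]

theorem legConj_zero (a : ℕ) (i : Fin r) : legConj a i 0 = 0 := by
  unfold legConj
  split_ifs
  exacts [rfl, map_zero _]

theorem legConj_sum (a : ℕ) (i : Fin r) {ι : Type*} (s : Finset ι) (f : ι → ℂ) :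
    legConj a i (∑ j ∈ s, f j) = ∑ j ∈ s, legConj a i (f j) := by
  unfold legConj
  split_ifs
  exacts [rfl, map_sum _ _ _]

theorem legConj_integral (a : ℕ) (i : Fin r) {P : Type*} [MeasurableSpace P] {κ : Measure P}
    (f : P → ℂ) : legConj a i (∫ p, f p ∂κ) = ∫ p, legConj a i (f p) ∂κ := by
  unfold legConj
  split_ifs
  exacts [rfl, integral_conj.symm]

theorem continuous_legConj (a : ℕ) (i : Fin r) : Continuous (legConj a i) := by
  unfold legConj
  split_ifs
  exacts [continuous_id, Complex.continuous_conj]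

/-- The sign of the momentum of a leg. -/
noncomputable def legSign (a : ℕ) (i : Fin r) : ℝ := if i.val < a then 1 else -1

theorem abs_legSign (a : ℕ) (i : Fin r) : |legSign a i| = 1 := by
  unfold legSign
  split_ifs <;> simp

theorem legSign_mul_self (a : ℕ) (i : Fin r) : legSign a i * legSign a i = 1 := by
  unfold legSign
  split_ifs <;> simp

theorem legConj_planeWave (a : ℕ) (i : Fin r) (k x : Space d) :
    legConj a i (planeWave k x) = planeWave k (legSign a i • x) := by
  unfold legConj legSign
  split_ifs
  · rw [one_smul]
  · rw [conj_planeWave, neg_smul, one_smul]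

/-- The wave packet of a leg for one component of the test function. -/
noncomputable def wave (D : Dispersion d m) (a : ℕ) (i : Fin r) (φ : Space d → ℂ)
    (μ ν : Fin m) (τ : ℝ) (x : Space d) : ℂ :=
  (((2 * Real.pi) ^ d : ℝ) : ℂ)⁻¹ *
    ∫ k, φ k * legConj a i (expI τ (D.E k) μ ν * planeWave k (-x))

theorem packet_eq_wave (D : Dispersion d m) (a : ℕ) (i : Fin r) (f : Space d → Fin m → ℂ)
    (μ ν : Fin m) (τ : ℝ) (x : Space d) (j : Fin m) :
    packet D a i f μ ν τ x j = wave D a i (fun k => f k j) μ ν τ x := rfl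

theorem contDiff_expI_slice (D : Dispersion d m) (μ ν : Fin m) (τ : ℝ) :
    ContDiff ℝ ((⊤ : ℕ∞) : WithTop ℕ∞) fun k => expI τ (D.E k) μ ν :=
  (contDiff_expI D μ ν).comp (contDiff_const.prodMk contDiff_id)

theorem integrable_wave_integrand (D : Dispersion d m) (a : ℕ) (i : Fin r) {φ : Space d → ℂ}
    (hφ : Continuous φ) (hc : HasCompactSupport φ) (μ ν : Fin m) (τ : ℝ) (x : Space d) :
    Integrable fun k => φ k * legConj a i (expI τ (D.E k) μ ν * planeWave k (-x)) := by
  refine Continuous.integrable_of_hasCompactSupport ?_ hc.mul_right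
  exact hφ.mul ((continuous_legConj a i).comp ((contDiff_expI_slice D μ ν τ).continuous.mul
    (continuous_planeWave.comp (continuous_id.prodMk continuous_const))))

open scoped FourierTransform in
theorem wave_eq_fourier (D : Dispersion d m) (a : ℕ) (i : Fin r) (φ : Space d → ℂ)
    (μ ν : Fin m) (τ : ℝ) (x : Space d) :
    wave D a i φ μ ν τ x = (((2 * Real.pi) ^ d : ℝ) : ℂ)⁻¹ *
      𝓕 (fun k => φ k * legConj a i (expI τ (D.E k) μ ν))
        ((legSign a i * (2 * Real.pi)⁻¹) • x) := by
  rw [wave, Real.fourier_eq']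
  congr 1
  refine integral_congr_ae (.of_forall fun k => ?_)
  have e : (-2 * Real.pi * inner ℝ k ((legSign a i * (2 * Real.pi)⁻¹) • x) : ℝ) =
      inner ℝ k (legSign a i • -x) := by
    rw [real_inner_smul_right, real_inner_smul_right, inner_neg_right]
    field_simp
  simp only [smul_eq_mul]
  rw [legConj_mul, legConj_planeWave, planeWave, e, mul_comm (Complex.exp _), mul_assoc,
    mul_comm Complex.I]

theorem one_add_pow_le (N : ℕ) {t : ℝ} (ht : 0 ≤ t) : (1 + t) ^ N ≤ 2 ^ N * (1 + t ^ N) := by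
  have h : (1 + t) ^ N ≤ (2 * max 1 t) ^ N := by
    gcongr
    linarith [le_max_left 1 t, le_max_right 1 t]
  rw [mul_pow] at h
  refine h.trans (mul_le_mul_of_nonneg_left ?_ (by positivity))
  rcases max_cases 1 t with ⟨e, -⟩ | ⟨e, -⟩ <;> rw [e]
  · rw [one_pow]
    linarith [pow_nonneg ht N]
  · linarith

open scoped FourierTransform in
/-- The decrease of the Fourier transform is controlled by the bounds of finitely many derivatives on
the support, with a constant that depends only on the support. -/
theorem pow_mul_norm_fourier_le {L : Set (Space d)} (hL : IsCompact L) {N : ℕ} {u : Space d → ℂ}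
    (hu : ContDiff ℝ ((⊤ : ℕ∞) : WithTop ℕ∞) u) (hs : tsupport u ⊆ L) {B : ℝ}
    (hB : ∀ n ≤ N, ∀ k ∈ L, ‖iteratedFDeriv ℝ n u k‖ ≤ B) (w : Space d) {n : ℕ} (hn : n ≤ N) :
    ‖w‖ ^ n * ‖𝓕 u w‖ ≤ 2 ^ N * ((N + 1) * (B * volume.real L)) := by
  have huc : HasCompactSupport u := hL.of_isClosed_subset (isClosed_tsupport _) hs
  have hint : ∀ p ≤ N, ∫ k, ‖iteratedFDeriv ℝ p u k‖ ≤ B * volume.real L := by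
    intro p hp
    have h1 : Integrable (L.indicator fun _ : Space d => B) :=
      (integrable_indicator_iff hL.measurableSet).2 (integrableOn_const hL.measure_lt_top.ne)
    refine (integral_mono_of_nonneg (.of_forall fun _ => norm_nonneg _) h1
      (.of_forall fun k => ?_)).trans_eq ?_
    · by_cases hk : k ∈ L
      · rw [Set.indicator_of_mem hk]
        exact hB p hp k hk
      · have : k ∉ tsupport (iteratedFDeriv ℝ p u) :=
          fun h => hk (hs (tsupport_iteratedFDeriv_subset p h))
        simp only
        rw [Set.indicator_of_notMem hk, image_eq_zero_of_notMem_tsupport this, norm_zero]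
    · rw [integral_indicator_const _ hL.measurableSet, smul_eq_mul, mul_comm]
  have hI0 : 0 ≤ B * volume.real L :=
    (integral_nonneg fun _ => norm_nonneg _).trans (hint 0 N.zero_le)
  have h := Real.pow_mul_norm_iteratedFDeriv_fourier_le (f := u) (K := ⊤) (N := ⊤)
    hu (fun k n _ _ => Continuous.integrable_of_hasCompactSupport
      ((continuous_norm.pow k).mul (hu.continuous_iteratedFDeriv (mod_cast le_top)).norm)
      (huc.iteratedFDeriv n).norm.mul_left) (k := 0) (n := n) le_top le_top w
  rw [norm_iteratedFDeriv_zero] at h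
  refine h.trans ?_
  have h1 : ∑ p ∈ Finset.range (0 + 1) ×ˢ Finset.range (n + 1),
      ∫ v, ‖v‖ ^ p.1 * ‖iteratedFDeriv ℝ p.2 u v‖ ≤ (N + 1) * (B * volume.real L) := by
    rw [Finset.sum_product, zero_add, Finset.sum_range_one]
    simp only [pow_zero, one_mul]
    refine (Finset.sum_le_sum fun p hp =>
      hint p ((Finset.mem_range_succ_iff.1 hp).trans hn)).trans ?_
    rw [Finset.sum_const, Finset.card_range, nsmul_eq_mul]
    push_cast
    gcongr
  have h2 : (2 * Real.pi) ^ 0 * (2 * ((0 : ℕ) : ℝ) + 2) ^ n ≤ 2 ^ N := by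
    rw [pow_zero, one_mul, Nat.cast_zero, mul_zero, zero_add]
    exact pow_le_pow_right₀ one_le_two hn
  exact mul_le_mul h2 h1 (Finset.sum_nonneg fun _ _ => integral_nonneg fun _ => by positivity)
    (by positivity)

theorem exists_norm_iteratedFDeriv_legConj_expI_le (D : Dispersion d m) (a : ℕ) (i : Fin r)
    {L : Set (Space d)} (hL : IsCompact L) (N : ℕ) : ∃ c : ℝ, 0 ≤ c ∧
      ∀ (μ ν : Fin m) (τ : ℝ), ∀ k ∈ L, ∀ n ≤ N,
        ‖iteratedFDeriv ℝ n (fun k => legConj a i (expI τ (D.E k) μ ν)) k‖ ≤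
          c * (1 + |τ|) ^ N := by
  choose c₀ hc₀ using fun (p : (Fin m × Fin m) × ℕ) =>
    exists_norm_iteratedFDeriv_expI_le D p.1.1 p.1.2 hL p.2
  refine ⟨∑ p ∈ Finset.univ ×ˢ Finset.range (N + 1), |c₀ p|,
    Finset.sum_nonneg fun _ _ => abs_nonneg _, fun μ ν τ k hk n hn => ?_⟩
  rw [norm_iteratedFDeriv_legConj (fun k => expI τ (D.E k) μ ν)]
  refine (norm_iteratedFDeriv_slice_le (contDiff_expI D μ ν) τ k n).trans
    ((hc₀ ((μ, ν), n) τ k hk).trans ?_)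
  have h1 := Finset.single_le_sum (f := fun p => |c₀ p|) (fun _ _ => abs_nonneg _)
    (show ((μ, ν), n) ∈ Finset.univ ×ˢ Finset.range (N + 1) from
      Finset.mem_product.2 ⟨Finset.mem_univ _, Finset.mem_range_succ_iff.2 hn⟩)
  have h2 : (1 : ℝ) ≤ 1 + |τ| := by linarith [abs_nonneg τ]
  exact mul_le_mul ((le_abs_self _).trans h1) (pow_le_pow_right₀ h2 hn) (by positivity)
    (Finset.sum_nonneg fun _ _ => abs_nonneg _)

open scoped FourierTransform in
/-- Wave packets decrease in `x` faster than any power; the velocity `x / τ` sets the scale. -/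
theorem exists_norm_wave_le (D : Dispersion d m) (a : ℕ) (i : Fin r) {L : Set (Space d)}
    (hL : IsCompact L) (N : ℕ) : ∃ c : ℝ, 0 ≤ c ∧ ∀ (φ : Space d → ℂ) (M : ℝ),
      ContDiff ℝ ((⊤ : ℕ∞) : WithTop ℕ∞) φ → tsupport φ ⊆ L →
      (∀ n ≤ N, ∀ k, ‖iteratedFDeriv ℝ n φ k‖ ≤ M) → ∀ (μ ν : Fin m) (τ : ℝ) (x : Space d),
        ‖wave D a i φ μ ν τ x‖ ≤ c * M * (1 + |τ|) ^ N * ((1 + ‖x‖) ^ N)⁻¹ := by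
  obtain ⟨c₁, hc₁0, hexp⟩ := exists_norm_iteratedFDeriv_legConj_expI_le D a i hL N
  set V : ℝ := volume.real L with hV
  have hV0 : 0 ≤ V := measureReal_nonneg
  set C : ℝ := ((2 * Real.pi) ^ d)⁻¹ * (2 ^ N * (1 + (2 * Real.pi) ^ N) * (2 ^ N * ((N + 1) *
    (2 ^ N * c₁ * V)))) with hC
  refine ⟨C, by positivity, fun φ M hφ hs hM μ ν τ x => ?_⟩
  set u : Space d → ℂ := fun k => φ k * legConj a i (expI τ (D.E k) μ ν) with hu
  have hu1 : ContDiff ℝ ((⊤ : ℕ∞) : WithTop ℕ∞) u :=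
    hφ.mul (contDiff_legConj (contDiff_expI_slice D μ ν τ))
  have hu3 : tsupport u ⊆ L := (tsupport_mul_subset_left).trans hs
  have hM0 : 0 ≤ M := (norm_nonneg _).trans (hM 0 N.zero_le 0)
  have hub : ∀ n ≤ N, ∀ k ∈ L, ‖iteratedFDeriv ℝ n u k‖ ≤ 2 ^ N * M * (c₁ * (1 + |τ|) ^ N) := by
    intro n hn k hk
    refine (norm_iteratedFDeriv_mul_le_of_le hφ
      (contDiff_legConj (contDiff_expI_slice D μ ν τ)) (fun j hj => hM j (hj.trans hn) k)
        (fun j hj => hexp μ ν τ k hk j (hj.trans hn))).trans ?_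
    have : (2 : ℝ) ^ n ≤ 2 ^ N := pow_le_pow_right₀ one_le_two hn
    gcongr
  set w : Space d := (legSign a i * (2 * Real.pi)⁻¹) • x with hw
  have hpi : 0 < 2 * Real.pi := by positivity
  have hwx : ‖x‖ = 2 * Real.pi * ‖w‖ := by
    rw [hw, norm_smul, norm_mul, Real.norm_eq_abs, abs_legSign, one_mul, Real.norm_of_nonneg
      (inv_nonneg.2 hpi.le)]
    field_simp
  have h0 := pow_mul_norm_fourier_le hL hu1 hu3 hub w N.zero_le
  have hN := pow_mul_norm_fourier_le hL hu1 hu3 hub w le_rfl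
  rw [pow_zero, one_mul] at h0
  set R : ℝ := 2 ^ N * ((N + 1) * (2 ^ N * M * (c₁ * (1 + |τ|) ^ N) * V)) with hR
  have hx0 : 0 < (1 + ‖x‖) ^ N := by positivity
  rw [← div_eq_mul_inv, le_div_iff₀ hx0, wave_eq_fourier, norm_mul, norm_inv, Complex.norm_real,
    Real.norm_of_nonneg (by positivity)]
  have h1 : ‖𝓕 u w‖ * (1 + ‖x‖) ^ N ≤ 2 ^ N * (1 + (2 * Real.pi) ^ N) * R := by
    calc ‖𝓕 u w‖ * (1 + ‖x‖) ^ N ≤ ‖𝓕 u w‖ * (2 ^ N * (1 + ‖x‖ ^ N)) :=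
          mul_le_mul_of_nonneg_left (one_add_pow_le N (norm_nonneg _)) (norm_nonneg _)
      _ = 2 ^ N * (‖𝓕 u w‖ + (2 * Real.pi) ^ N * (‖w‖ ^ N * ‖𝓕 u w‖)) := by
          rw [hwx, mul_pow]; ring
      _ ≤ 2 ^ N * (R + (2 * Real.pi) ^ N * R) := by gcongr
      _ = _ := by ring
  calc ((2 * Real.pi) ^ d)⁻¹ * ‖𝓕 u w‖ * (1 + ‖x‖) ^ N
      = ((2 * Real.pi) ^ d)⁻¹ * (‖𝓕 u w‖ * (1 + ‖x‖) ^ N) := by ring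
    _ ≤ ((2 * Real.pi) ^ d)⁻¹ * (2 ^ N * (1 + (2 * Real.pi) ^ N) * R) := by gcongr
    _ = C * M * (1 + |τ|) ^ N := by rw [hC, hR]; ring

end Wave

end AQFT

namespace AQFT

section Wave

variable {d m r : ℕ}

theorem continuous_wave (D : Dispersion d m) (a : ℕ) (i : Fin r) {φ : Space d → ℂ}
    (hφ : Continuous φ) (hc : HasCompactSupport φ) (μ ν : Fin m) (τ : ℝ) :
    Continuous fun x => wave D a i φ μ ν τ x := by
  refine continuous_const.mul (continuous_of_dominated (bound := fun k =>
    ‖φ k * legConj a i (expI τ (D.E k) μ ν * planeWave k (-0))‖) (fun x => ?_) (fun x => ?_) ?_ ?_)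
  · exact (integrable_wave_integrand D a i hφ hc μ ν τ x).aestronglyMeasurable
  · refine .of_forall fun k => le_of_eq ?_
    simp only [norm_mul, norm_legConj, norm_planeWave]
  · exact (integrable_wave_integrand D a i hφ hc μ ν τ 0).norm
  · refine .of_forall fun k => continuous_const.mul ((continuous_legConj a i).comp
      (continuous_const.mul (continuous_planeWave.comp (continuous_const.prodMk continuous_neg))))

theorem wave_add (D : Dispersion d m) (a : ℕ) (i : Fin r) {φ ψ : Space d → ℂ}
    (hφ : Continuous φ) (hc : HasCompactSupport φ) (hψ : Continuous ψ) (hc' : HasCompactSupport ψ)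
    (μ ν : Fin m) (τ : ℝ) (x : Space d) :
    wave D a i (fun k => φ k + ψ k) μ ν τ x = wave D a i φ μ ν τ x + wave D a i ψ μ ν τ x := by
  simp only [wave, add_mul]
  rw [integral_add (integrable_wave_integrand D a i hφ hc μ ν τ x)
    (integrable_wave_integrand D a i hψ hc' μ ν τ x), mul_add]

theorem wave_const_mul (D : Dispersion d m) (a : ℕ) (i : Fin r) (z : ℂ) (φ : Space d → ℂ)
    (μ ν : Fin m) (τ : ℝ) (x : Space d) :
    wave D a i (fun k => z * φ k) μ ν τ x = z * wave D a i φ μ ν τ x := by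
  simp only [wave, mul_assoc]
  rw [integral_const_mul]
  ring

theorem wave_sum (D : Dispersion d m) (a : ℕ) (i : Fin r) {ι : Type*} (s : Finset ι)
    {φ : ι → Space d → ℂ} (hφ : ∀ j, Continuous (φ j)) (hc : ∀ j, HasCompactSupport (φ j))
    (μ ν : Fin m) (τ : ℝ) (x : Space d) :
    wave D a i (fun k => ∑ j ∈ s, φ j k) μ ν τ x = ∑ j ∈ s, wave D a i (φ j) μ ν τ x := by
  simp only [wave, Finset.sum_mul]
  rw [integral_finsetSum _ fun j _ => integrable_wave_integrand D a i (hφ j) (hc j) μ ν τ x,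
    Finset.mul_sum]

theorem integrable_mul_mul_phase {X Y : Type*} [MeasurableSpace X] [MeasurableSpace Y]
    {κ : Measure X} {κ' : Measure Y} [SFinite κ] [SFinite κ'] {u : X → ℂ} {v : Y → ℂ}
    (hu : Integrable u κ) (hv : Integrable v κ') {p : X → Y → ℂ}
    (hp : AEStronglyMeasurable (fun q : X × Y => p q.1 q.2) (κ.prod κ'))
    (hp1 : ∀ q : X × Y, ‖p q.1 q.2‖ ≤ 1) :
    Integrable (Function.uncurry fun k w => u k * (v w * p k w)) (κ.prod κ') := by
  refine (hu.mul_prod hv).mono (hu.aestronglyMeasurable.comp_fst.mul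
    (hv.aestronglyMeasurable.comp_snd.mul hp)) (.of_forall fun q => ?_)
  simp only [Function.uncurry, norm_mul]
  exact mul_le_mul_of_nonneg_left (mul_le_of_le_one_right (norm_nonneg _) (hp1 q)) (norm_nonneg _)

/-- On a compact set every smooth function is a superposition of plane waves with rapidly
decreasing coefficients, by Fourier inversion for a cut-off function. -/
theorem exists_eq_integral_planeWave {K : Set (Space d)} (hK : IsCompact K) {g : Space d → ℂ}
    (hg : ContDiff ℝ ((⊤ : ℕ∞) : WithTop ℕ∞) g) : ∃ θ : 𝓢(Space d, ℂ),
      ∀ k ∈ K, g k = ∫ w, θ w * planeWave k ((2 * Real.pi) • w) := by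
  obtain ⟨χ, hχ1, hχ2, hχ3⟩ := exists_cutoff hK
  have hψ1 : ContDiff ℝ ((⊤ : ℕ∞) : WithTop ℕ∞) fun k => (χ k : ℂ) * g k :=
    (Complex.ofRealCLM.contDiff.comp hχ1).mul hg
  have hψ2 : HasCompactSupport fun k => (χ k : ℂ) * g k :=
    (hχ2.comp_left (g := fun t : ℝ => (t : ℂ)) Complex.ofReal_zero).mul_right
  let ψ : 𝓢(Space d, ℂ) := hψ2.toSchwartzMap hψ1
  refine ⟨FourierTransform.fourier ψ, fun k hk => ?_⟩
  have h1 : ψ = FourierTransform.fourierInv (FourierTransform.fourier ψ) :=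
    (FourierTransform.fourierInv_fourier_eq ψ).symm
  have h2 : g k = ψ k := by
    have : ψ k = (χ k : ℂ) * g k := rfl
    rw [this, hχ3 k hk, Complex.ofReal_one, one_mul]
  generalize FourierTransform.fourier ψ = θ at h1 ⊢
  have h3 : ψ k = FourierTransform.fourierInv (θ : Space d → ℂ) k := by
    rw [← SchwartzMap.fourierInv_coe, ← h1]
  rw [h2, h3, Real.fourierInv_eq']
  refine integral_congr_ae (.of_forall fun w => ?_)
  simp only [smul_eq_mul]
  rw [planeWave, mul_comm, mul_comm Complex.I, real_inner_smul_right, real_inner_comm]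

/-- A wave packet multiplied by a function of momentum is a superposition of translated wave
packets. -/
theorem exists_wave_mul_eq (D : Dispersion d m) (a : ℕ) (i : Fin r) {φ : Space d → ℂ}
    (hφ : Continuous φ) (hc : HasCompactSupport φ) {g : Space d → ℂ}
    (hg : ContDiff ℝ ((⊤ : ℕ∞) : WithTop ℕ∞) g) : ∃ θ : 𝓢(Space d, ℂ),
      ∀ (μ ν : Fin m) (τ : ℝ) (x : Space d), wave D a i (fun k => φ k * g k) μ ν τ x =
        ∫ w, θ w * wave D a i φ μ ν τ (x - (legSign a i * (2 * Real.pi)) • w) := by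
  obtain ⟨θ, hθ⟩ := exists_eq_integral_planeWave hc.isCompact hg
  refine ⟨θ, fun μ ν τ x => ?_⟩
  have hmul : ∀ k, φ k * g k = φ k * ∫ w, θ w * planeWave k ((2 * Real.pi) • w) := by
    intro k
    by_cases hk : k ∈ tsupport φ
    · rw [← hθ k hk]
    · rw [image_eq_zero_of_notMem_tsupport hk, zero_mul, zero_mul]
  have hp : Continuous fun q : Space d × Space d => planeWave q.1 ((2 * Real.pi) • q.2) := by
    unfold planeWave; fun_prop
  have hθi : Integrable (θ : Space d → ℂ) := θ.integrable
  have hF := integrable_mul_mul_phase (p := fun k w => planeWave k ((2 * Real.pi) • w))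
    (integrable_wave_integrand D a i hφ hc μ ν τ x) hθi hp.aestronglyMeasurable
    fun p => (norm_planeWave _ _).le
  have e1 : ∫ k, φ k * g k * legConj a i (expI τ (D.E k) μ ν * planeWave k (-x)) =
      ∫ k, ∫ w, φ k * legConj a i (expI τ (D.E k) μ ν * planeWave k (-x)) *
        (θ w * planeWave k ((2 * Real.pi) • w)) := by
    refine congrArg (integral volume) (funext fun k => ?_)
    rw [integral_const_mul, hmul k]
    ring
  have e3 : ∀ w, ∫ k, φ k * legConj a i (expI τ (D.E k) μ ν * planeWave k (-x)) *
      (θ w * planeWave k ((2 * Real.pi) • w)) = θ w * ∫ k, φ k *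
      legConj a i (expI τ (D.E k) μ ν *
        planeWave k (-(x - (legSign a i * (2 * Real.pi)) • w))) := by
    intro w
    have e2 : legSign a i • -(x - (legSign a i * (2 * Real.pi)) • w) =
        legSign a i • -x + (2 * Real.pi) • w := by
      rw [neg_sub, smul_sub, smul_smul, ← mul_assoc, legSign_mul_self, one_mul, smul_neg]
      abel
    rw [← integral_const_mul]
    refine integral_congr_ae (.of_forall fun k => ?_)
    simp only [legConj_mul, legConj_planeWave]
    rw [e2, planeWave_add]
    ring
  rw [wave, e1, integral_integral_swap hF, ← integral_const_mul]
  refine integral_congr_ae (.of_forall fun w => ?_)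
  simp only [wave]
  rw [e3]
  ring

theorem integrable_schwartz_mul_pow (θ : 𝓢(Space d, ℂ)) (n : ℕ) :
    Integrable fun w => ‖θ w‖ * (1 + 2 * Real.pi * ‖w‖) ^ n := by
  set M : ℕ × ℕ := (n + (d + 1), 0) with hM
  set c : ℝ := 2 ^ M.1 * (Finset.Iic M).sup (fun m => SchwartzMap.seminorm ℝ m.1 m.2) θ with hc
  refine ((integrable_inv_one_add_norm_pow (d := d)).const_mul ((2 * Real.pi) ^ n * c)).mono'
    (Continuous.aestronglyMeasurable (by fun_prop)) (.of_forall fun w => ?_)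
  have h1 := SchwartzMap.one_add_le_sup_seminorm_apply (𝕜 := ℝ) (m := M) (k := M.1) (n := 0) le_rfl
    le_rfl θ w
  rw [norm_iteratedFDeriv_zero] at h1
  have h2 : (1 + 2 * Real.pi * ‖w‖) ^ n ≤ (2 * Real.pi) ^ n * (1 + ‖w‖) ^ n := by
    rw [← mul_pow]
    refine pow_le_pow_left₀ (by positivity) ?_ n
    nlinarith [Real.pi_gt_three]
  have h3 : (1 + ‖w‖) ^ M.1 = (1 + ‖w‖) ^ n * (1 + ‖w‖) ^ (d + 1) := pow_add _ _ _
  rw [Real.norm_of_nonneg (by positivity), ← div_eq_mul_inv, le_div_iff₀ (by positivity)]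
  calc ‖θ w‖ * (1 + 2 * Real.pi * ‖w‖) ^ n * (1 + ‖w‖) ^ (d + 1)
      ≤ ‖θ w‖ * ((2 * Real.pi) ^ n * (1 + ‖w‖) ^ n) * (1 + ‖w‖) ^ (d + 1) := by gcongr
    _ = (2 * Real.pi) ^ n * ((1 + ‖w‖) ^ M.1 * ‖θ w‖) := by rw [h3]; ring
    _ ≤ _ := by gcongr

/-- `τ K` is an essential support of the wave packets of a scalar test function. -/
def HasWaveSupport (D : Dispersion d m) (a : ℕ) (i : Fin r) (φ : Space d → ℂ)
    (K : Set (Space d)) : Prop :=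
  ∀ n : ℕ, ∃ c : ℝ, ∀ (μ ν : Fin m) (τ : ℝ) (x : Space d), τ ≠ 0 → τ⁻¹ • x ∉ K →
    ‖wave D a i φ μ ν τ x‖ ≤ c * ((1 + ‖x‖ ^ 2 + τ ^ 2) ^ n)⁻¹

/-- The Japanese bracket of `x` is controlled by that of a translated point. -/
theorem one_add_sq_le_mul (x y : Space d) (τ : ℝ) :
    1 + ‖x‖ ^ 2 + τ ^ 2 ≤ 2 * (1 + ‖x - y‖ ^ 2 + τ ^ 2) * (1 + ‖y‖) ^ 2 := by
  have h : ‖x‖ ≤ ‖x - y‖ + ‖y‖ := by simpa using norm_add_le (x - y) y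
  have h1 : ‖x‖ ^ 2 ≤ (‖x - y‖ + ‖y‖) ^ 2 := pow_le_pow_left₀ (norm_nonneg _) h 2
  have h2 : 0 ≤ ‖x - y‖ ^ 2 := by positivity
  have h3 : 0 ≤ ‖y‖ := norm_nonneg _
  have h4 : 0 ≤ τ ^ 2 := by positivity
  nlinarith [sq_nonneg (‖x - y‖ - ‖y‖), mul_nonneg h2 h3, mul_nonneg h4 h3,
    mul_nonneg h2 (sq_nonneg ‖y‖), mul_nonneg h4 (sq_nonneg ‖y‖)]

/-- Multiplication by a smooth function of momentum does not move the essential support of a wave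
packet: the packet is convolved with a rapidly decreasing function of position. -/
theorem HasWaveSupport.mul {D : Dispersion d m} {a : ℕ} {i : Fin r} {φ : Space d → ℂ}
    {K : Set (Space d)} (h : HasWaveSupport D a i φ K)
    (hφ : ContDiff ℝ ((⊤ : ℕ∞) : WithTop ℕ∞) φ) (hc : HasCompactSupport φ) {g : Space d → ℂ}
    (hg : ContDiff ℝ ((⊤ : ℕ∞) : WithTop ℕ∞) g) {η : ℝ} (hη : 0 < η) :
    HasWaveSupport D a i (fun k => φ k * g k) (Metric.cthickening η K) := by
  intro n
  obtain ⟨θ, hθ⟩ := exists_wave_mul_eq D a i hφ.continuous hc hg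
  obtain ⟨c₁, hc₁⟩ := h n
  obtain ⟨c₂, hc₂0, hc₂⟩ := exists_norm_wave_le D a i hc.isCompact (2 * n)
  choose b hb using fun p : ℕ => (hφ.continuous_iteratedFDeriv (m := p)
    (mod_cast le_top)).bounded_above_of_compact_support (hc.iteratedFDeriv p)
  set M : ℝ := ∑ p ∈ Finset.range (2 * n + 1), |b p| with hM
  have hM0 : 0 ≤ M := Finset.sum_nonneg fun _ _ => abs_nonneg _
  have hc₂' := hc₂ φ M hφ le_rfl fun p hp k => (hb p k).trans ((le_abs_self _).trans
    (Finset.single_le_sum (f := fun p => |b p|) (fun _ _ => abs_nonneg _)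
      (Finset.mem_range_succ_iff.2 hp)))
  set C : ℝ := 2 ^ n * |c₁| + 2 ^ n * (c₂ * M) * ((1 + η⁻¹) ^ (4 * n)) with hC
  refine ⟨C * ∫ w, ‖θ w‖ * (1 + 2 * Real.pi * ‖w‖) ^ (6 * n), fun μ ν τ x hτ hx => ?_⟩
  set R : ℝ := 1 + ‖x‖ ^ 2 + τ ^ 2 with hR
  have hR0 : 0 < R := by positivity
  have key : ∀ y : Space d, ‖wave D a i φ μ ν τ (x - y)‖ * R ^ n ≤ C * (1 + ‖y‖) ^ (6 * n) := by
    intro y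
    have hy1 : 1 ≤ 1 + ‖y‖ := by linarith [norm_nonneg y]
    have hR1 : R ^ n ≤ (2 * (1 + ‖x - y‖ ^ 2 + τ ^ 2) * (1 + ‖y‖) ^ 2) ^ n :=
      pow_le_pow_left₀ hR0.le (one_add_sq_le_mul x y τ) n
    have hCy : (1 + ‖y‖) ^ (2 * n) ≤ (1 + ‖y‖) ^ (6 * n) :=
      pow_le_pow_right₀ hy1 (by omega)
    -- A shift by `y` is either too small to bring `x / τ` into `K`, or powers of `τ` are bounded by
    -- powers of `y`, which the rapid decrease of `θ` absorbs.
    by_cases hy : ‖y‖ ≤ η * |τ|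
    · have hmem : τ⁻¹ • (x - y) ∉ K := by
        intro hK
        refine hx (Metric.mem_cthickening_of_dist_le _ _ _ _ hK ?_)
        rw [dist_eq_norm, ← smul_sub, sub_sub_cancel, norm_smul, norm_inv, Real.norm_eq_abs,
          inv_mul_le_iff₀ (abs_pos.2 hτ), mul_comm]
        exact hy
      have h1 := hc₁ μ ν τ (x - y) hτ hmem
      set A : ℝ := 1 + ‖x - y‖ ^ 2 + τ ^ 2 with hA
      have hA0 : 0 < A := by positivity
      calc ‖wave D a i φ μ ν τ (x - y)‖ * R ^ n
          ≤ (|c₁| * (A ^ n)⁻¹) * (2 * A * (1 + ‖y‖) ^ 2) ^ n := by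
            refine mul_le_mul (h1.trans ?_) hR1 (by positivity) (by positivity)
            exact mul_le_mul_of_nonneg_right (le_abs_self _) (by positivity)
        _ = 2 ^ n * |c₁| * (1 + ‖y‖) ^ (2 * n) := by
            rw [mul_pow, mul_pow, ← pow_mul]
            field_simp
        _ ≤ C * (1 + ‖y‖) ^ (6 * n) := by
            refine mul_le_mul ?_ hCy (by positivity) (by positivity)
            rw [hC]
            have : 0 ≤ 2 ^ n * (c₂ * M) * ((1 + η⁻¹) ^ (4 * n)) := by positivity
            linarith
    · push Not at hy
      have h1 := hc₂' μ ν τ (x - y)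
      have hτy : 1 + |τ| ≤ (1 + η⁻¹) * (1 + ‖y‖) := by
        have : |τ| ≤ η⁻¹ * ‖y‖ := by
          rw [le_inv_mul_iff₀ hη]
          exact hy.le
        have h2 : 0 ≤ η⁻¹ := by positivity
        nlinarith [norm_nonneg y]
      have hA : 2 * (1 + ‖x - y‖ ^ 2 + τ ^ 2) * (1 + ‖y‖) ^ 2 ≤
          2 * ((1 + ‖x - y‖) ^ 2 * (1 + |τ|) ^ 2) * (1 + ‖y‖) ^ 2 := by
        refine mul_le_mul_of_nonneg_right (mul_le_mul_of_nonneg_left ?_ zero_le_two) (by positivity)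
        rw [← sq_abs τ]
        have h2 := norm_nonneg (x - y)
        have h3 := abs_nonneg τ
        nlinarith [mul_nonneg h2 h3, mul_nonneg (mul_nonneg h2 h3) h3, mul_nonneg (mul_nonneg h2 h3) h2,
          mul_nonneg (mul_nonneg h2 h3) (mul_nonneg h2 h3)]
      calc ‖wave D a i φ μ ν τ (x - y)‖ * R ^ n
          ≤ (c₂ * M * (1 + |τ|) ^ (2 * n) * ((1 + ‖x - y‖) ^ (2 * n))⁻¹) *
              (2 * ((1 + ‖x - y‖) ^ 2 * (1 + |τ|) ^ 2) * (1 + ‖y‖) ^ 2) ^ n := by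
            refine mul_le_mul h1 (hR1.trans (pow_le_pow_left₀ (by positivity) hA n))
              (by positivity) (by positivity)
        _ = 2 ^ n * (c₂ * M) * (1 + |τ|) ^ (4 * n) * (1 + ‖y‖) ^ (2 * n) := by
            have e4 : 4 * n = 2 * n + 2 * n := by ring
            rw [mul_pow, mul_pow, mul_pow, ← pow_mul, ← pow_mul, ← pow_mul, e4, pow_add]
            field_simp
        _ ≤ 2 ^ n * (c₂ * M) * ((1 + η⁻¹) * (1 + ‖y‖)) ^ (4 * n) * (1 + ‖y‖) ^ (2 * n) := by
            gcongr
        _ = 2 ^ n * (c₂ * M) * (1 + η⁻¹) ^ (4 * n) * (1 + ‖y‖) ^ (6 * n) := by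
            have e6 : 6 * n = 4 * n + 2 * n := by ring
            rw [mul_pow, e6, pow_add]
            ring
        _ ≤ C * (1 + ‖y‖) ^ (6 * n) := by
            refine mul_le_mul_of_nonneg_right ?_ (by positivity)
            rw [hC]
            have : 0 ≤ 2 ^ n * |c₁| := by positivity
            linarith
  rw [← div_eq_mul_inv, le_div_iff₀ (by positivity), hθ, ← integral_const_mul]
  have hbound : ∀ w, ‖θ w * wave D a i φ μ ν τ (x - (legSign a i * (2 * Real.pi)) • w)‖ ≤
      (C * (‖θ w‖ * (1 + 2 * Real.pi * ‖w‖) ^ (6 * n))) / R ^ n := by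
    intro w
    have h1 := key ((legSign a i * (2 * Real.pi)) • w)
    rw [norm_smul, norm_mul, Real.norm_eq_abs, abs_legSign, one_mul,
      Real.norm_of_nonneg Real.two_pi_pos.le] at h1
    rw [norm_mul, le_div_iff₀ (by positivity), mul_assoc]
    calc _ ≤ ‖θ w‖ * (C * (1 + 2 * Real.pi * ‖w‖) ^ (6 * n)) := by gcongr
      _ = _ := by ring
  have hint := ((integrable_schwartz_mul_pow θ (6 * n)).const_mul C)
  have h2 := norm_integral_le_of_norm_le (hint.div_const (R ^ n)) (.of_forall hbound)
  rw [integral_div, le_div_iff₀ (by positivity)] at h2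
  exact h2

theorem HasWaveSupport.sum {D : Dispersion d m} {a : ℕ} {i : Fin r} {ι : Type*} {s : Finset ι}
    {φ : ι → Space d → ℂ} {K : Set (Space d)} (h : ∀ j, HasWaveSupport D a i (φ j) K)
    (hφ : ∀ j, Continuous (φ j)) (hc : ∀ j, HasCompactSupport (φ j)) :
    HasWaveSupport D a i (fun k => ∑ j ∈ s, φ j k) K := by
  intro n
  choose c hc' using fun j => h j n
  refine ⟨∑ j ∈ s, c j, fun μ ν τ x hτ hx => ?_⟩
  rw [wave_sum D a i s hφ hc, Finset.sum_mul]
  exact (norm_sum_le _ _).trans (Finset.sum_le_sum fun j _ => hc' j μ ν τ x hτ hx)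

theorem isEssentialSupport_iff {D : Dispersion d m} {a : ℕ} {i : Fin r}
    {f : Space d → Fin m → ℂ} {K : Set (Space d)} :
    IsEssentialSupport D a i f K ↔ ∀ j, HasWaveSupport D a i (fun k => f k j) K := by
  constructor
  · intro h j n
    obtain ⟨c, hc⟩ := h n
    exact ⟨c, fun μ ν τ x hτ hx => hc μ ν j τ x hτ hx⟩
  · intro h n
    choose c hc using fun j => h j n
    refine ⟨∑ j, |c j|, fun μ ν j τ x hτ hx => (hc j μ ν τ x hτ hx).trans ?_⟩
    refine mul_le_mul_of_nonneg_right ((le_abs_self _).trans ?_) (by positivity)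
    exact Finset.single_le_sum (f := fun j => |c j|) (fun _ _ => abs_nonneg _) (Finset.mem_univ j)

theorem IsTest.contDiff_apply {f : Space d → Fin m → ℂ} (hf : IsTest f) (j : Fin m) :
    ContDiff ℝ ((⊤ : ℕ∞) : WithTop ℕ∞) fun k => f k j :=
  contDiff_pi.1 hf.1 j

theorem IsTest.hasCompactSupport_apply {f : Space d → Fin m → ℂ} (hf : IsTest f) (j : Fin m) :
    HasCompactSupport fun k => f k j :=
  hf.2.comp_left (g := fun v : Fin m → ℂ => v j) rfl

theorem isTest_vecMul {f : Space d → Fin m → ℂ} (hf : IsTest f)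
    {M : Space d → Matrix (Fin m) (Fin m) ℂ}
    (hM : ∀ j l, ContDiff ℝ ((⊤ : ℕ∞) : WithTop ℕ∞) fun k => M k j l) :
    IsTest fun k => Matrix.vecMul (f k) (M k) := by
  have h : ∀ l, ContDiff ℝ ((⊤ : ℕ∞) : WithTop ℕ∞) fun k => ∑ j, f k j * M k j l :=
    fun l => ContDiff.sum fun j _ => (hf.contDiff_apply j).mul (hM j l)
  refine ⟨contDiff_pi.2 h, ?_⟩
  refine hf.2.mono fun k hk => ?_
  contrapose! hk
  simp only [Function.mem_support, not_not] at hk ⊢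
  rw [hk, Matrix.zero_vecMul]

theorem exists_uniform_separation {a : ℕ} {K : Fin r → Set (Space d)}
    (hd : ∀ i j, i ≠ j → (i.val < a ↔ j.val < a) → ∃ δ > 0, ∀ v ∈ K i, ∀ w ∈ K j, δ ≤ dist v w) :
    ∃ δ > 0, ∀ i j, i ≠ j → (i.val < a ↔ j.val < a) → ∀ v ∈ K i, ∀ w ∈ K j, δ ≤ dist v w := by
  choose! δ hδ hδ' using hd
  have hfin : ∀ s : Finset (Fin r × Fin r), ∃ η > 0, ∀ p ∈ s, p.1 ≠ p.2 →
      (p.1.val < a ↔ p.2.val < a) → η ≤ δ p.1 p.2 := by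
    intro s
    induction s using Finset.induction_on with
    | empty => exact ⟨1, one_pos, by simp⟩
    | insert p s _ ih =>
      obtain ⟨η, hη, hs⟩ := ih
      by_cases hp : p.1 ≠ p.2 ∧ (p.1.val < a ↔ p.2.val < a)
      · refine ⟨min η (δ p.1 p.2), lt_min hη (hδ p.1 p.2 hp.1 hp.2), ?_⟩
        intro q hq h1 h2
        rcases Finset.mem_insert.1 hq with rfl | hq
        · exact min_le_right _ _
        · exact (min_le_left _ _).trans (hs q hq h1 h2)
      · refine ⟨η, hη, fun q hq h1 h2 => ?_⟩
        rcases Finset.mem_insert.1 hq with rfl | hq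
        · exact absurd ⟨h1, h2⟩ hp
        · exact hs q hq h1 h2
  obtain ⟨η, hη, hs⟩ := hfin Finset.univ
  exact ⟨η, hη, fun i j hij hij' v hv w hw => (hs (i, j) (Finset.mem_univ _) hij hij').trans
    (hδ' i j hij hij' v hv w hw)⟩

/-- Matrix-valued functions of the momenta preserve non-overlapping families. -/
theorem NonOverlapping.vecMul {D : Dispersion d m} {a : ℕ} {f : Fin r → Space d → Fin m → ℂ}
    (h : NonOverlapping D a f) (hf : ∀ i, IsTest (f i))
    {M : Fin r → Space d → Matrix (Fin m) (Fin m) ℂ}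
    (hM : ∀ i j l, ContDiff ℝ ((⊤ : ℕ∞) : WithTop ℕ∞) fun k => M i k j l) :
    NonOverlapping D a fun i k => Matrix.vecMul (f i k) (M i k) := by
  obtain ⟨K, hK, hd⟩ := h
  obtain ⟨δ, hδ, hδ'⟩ := exists_uniform_separation hd
  -- Thicken all supports by a quarter of the smallest distance.
  obtain ⟨η, hη, rfl⟩ : ∃ η > 0, δ = 4 * η := ⟨δ / 4, by positivity, by ring⟩
  refine ⟨fun i => Metric.cthickening η (K i), fun i => ?_, fun i j hij hij' => ?_⟩
  · refine isEssentialSupport_iff.2 fun l => HasWaveSupport.sum (fun j => ?_) (fun j => ?_)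
      fun j => ?_
    · exact ((isEssentialSupport_iff.1 (hK i)) j).mul ((hf i).contDiff_apply j)
        ((hf i).hasCompactSupport_apply j) (hM i j l) hη
    · exact ((hf i).contDiff_apply j).continuous.mul (hM i j l).continuous
    · exact ((hf i).hasCompactSupport_apply j).mul_right
  · refine ⟨η, hη, fun v hv w hw => ?_⟩
    have hsub : ∀ i, Metric.cthickening η (K i) ⊆ Metric.thickening (3 / 2 * η) (K i) :=
      fun i => Metric.cthickening_subset_thickening' (by linarith) (by linarith) _
    obtain ⟨v', hv', h1⟩ := Metric.mem_thickening_iff.1 (hsub i hv)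
    obtain ⟨w', hw', h2⟩ := Metric.mem_thickening_iff.1 (hsub j hw)
    have h3 := hδ' i j hij hij' v' hv' w' hw'
    have h4 := dist_triangle4 v' v w w'
    rw [dist_comm v' v] at h4
    linarith

end Wave

end AQFT

namespace AQFT

/-! ### One-particle amplitudes of smeared operators -/

section Amplitude

variable {d m : ℕ} {𝒜 : Type*} [Ring 𝒜] [StarRing 𝒜] [Algebra ℂ 𝒜] [StarModule ℂ 𝒜]
  {S : TranslationInvariantState d 𝒜} {D : Dispersion d m}

theorem ω_star_mul_trans (p : ℝ × Space d) (a b : 𝒜) :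
    S.ω (star b * S.trans p a) = S.ω (star (S.trans (-p) b) * a) := by
  rw [← S.ω_trans (-p), map_mul, map_star, trans_neg_trans]

theorem IsOneParticleProjection.ω_star_mul {Φ : ElementaryExcitation S D} {a : 𝒜}
    {t : ElemSpace d m} (h : IsOneParticleProjection Φ a t) {b : 𝒜} {f : ElemSpace d m}
    (hb : vec S b = Φ.toFun f) : S.ω (star b * a) = ∫ k, inner ℂ (f k) (t k) := by
  have h1 := h f
  rw [inner_sub_right, sub_eq_zero, Φ.isometric, ← hb, inner_vec] at h1
  exact h1

theorem conj_expI_apply (D : Dispersion d m) (τ : ℝ) (k : Space d) (β γ : Fin m) :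
    (starRingEnd ℂ) (expI τ (D.E k) γ β) = expI (-τ) (D.E k) β γ := by
  rw [← expI_conjTranspose τ (D.hermitian k)]
  rfl

/-- The Schwartz function with a single non-vanishing component. -/
noncomputable def singleElem {φ : Space d → ℂ} (hφ : ContDiff ℝ ((⊤ : ℕ∞) : WithTop ℕ∞) φ)
    (hc : HasCompactSupport φ) (β : Fin m) : ElemSpace d m :=
  HasCompactSupport.toSchwartzMap (f := fun k => φ k • EuclideanSpace.single β (1 : ℂ))
    hc.smul_right (hφ.smul contDiff_const)

theorem singleElem_apply {φ : Space d → ℂ} (hφ : ContDiff ℝ ((⊤ : ℕ∞) : WithTop ℕ∞) φ)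
    (hc : HasCompactSupport φ) (β : Fin m) (k : Space d) :
    singleElem hφ hc β k = φ k • EuclideanSpace.single β (1 : ℂ) := rfl

theorem inner_singleElem {φ : Space d → ℂ} (hφ : ContDiff ℝ ((⊤ : ℕ∞) : WithTop ℕ∞) φ)
    (hc : HasCompactSupport φ) (β : Fin m) (t : ElemSpace d m) (k : Space d) :
    inner ℂ (singleElem hφ hc β k) (t k) = (starRingEnd ℂ) (φ k) * t k β := by
  rw [singleElem_apply, inner_smul_left, EuclideanSpace.inner_single_left, map_one, one_mul]

/-- The translated operator has the translated one-particle amplitude. -/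
theorem IsOneParticleProjection.ω_star_mul_trans {Φ : ElementaryExcitation S D} {a : 𝒜}
    {t : ElemSpace d m} (h : IsOneParticleProjection Φ a t) {b : 𝒜} {φ : Space d → ℂ}
    (hφ : ContDiff ℝ ((⊤ : ℕ∞) : WithTop ℕ∞) φ) (hc : HasCompactSupport φ) {β : Fin m}
    (hb : vec S b = Φ.toFun (singleElem hφ hc β)) (p : ℝ × Space d) :
    S.ω (star b * S.trans p a) = ∫ k, (starRingEnd ℂ) (φ k) *
      (planeWave k p.2 * (expI (-p.1) (D.E k)).mulVec (t k).ofLp β) := by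
  obtain ⟨g, hg, hg'⟩ := Φ.equivariant (-p.1) (-p.2) (singleElem hφ hc β)
  rw [AQFT.ω_star_mul_trans, show -p = (-p.1, -p.2) from rfl, h.ω_star_mul (hg' b hb)]
  refine integral_congr_ae (.of_forall fun k => ?_)
  simp only [PiLp.inner_apply, RCLike.inner_apply, hg, neg_neg, singleElem_apply, map_mul,
    conj_planeWave, WithLp.ofLp_smul, Matrix.mulVec_smul, Pi.smul_apply,
    smul_eq_mul, PiLp.ofLp_single, Matrix.mulVec_single_one, Matrix.col_apply,
    conj_expI_apply]
  simp only [Matrix.mulVec, dotProduct, Finset.mul_sum]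
  exact Finset.sum_congr rfl fun γ _ => by ring

theorem continuous_smearing_phase (D : Dispersion d m) (β γ : Fin m) :
    Continuous fun q : Space d × (ℝ × Space d) =>
      planeWave q.1 q.2.2 * expI (-q.2.1) (D.E q.1) β γ := by
  have h1 : Continuous fun q : Space d × (ℝ × Space d) => planeWave q.1 q.2.2 := by
    unfold planeWave; fun_prop
  exact h1.mul ((contDiff_expI D β γ).continuous.comp
    (continuous_snd.fst.neg.prodMk continuous_fst))

theorem norm_smearing_phase_le (D : Dispersion d m) (β γ : Fin m) (k : Space d) (p : ℝ × Space d) :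
    ‖planeWave k p.2 * expI (-p.1) (D.E k) β γ‖ ≤ 1 := by
  rw [norm_mul, norm_planeWave, one_mul]
  exact norm_expI_apply_le _ (D.hermitian k) _ _

theorem integrable_schwartz_spaceTime (α : 𝓢(ℝ × Space d, ℂ)) : Integrable (α : ℝ × Space d → ℂ) := by
  have : (volume : Measure (ℝ × Space d)).IsAddHaarMeasure := by
    rw [Measure.volume_eq_prod]
    infer_instance
  exact α.integrable

theorem integrable_symbol_integrand (D : Dispersion d m) (α : 𝓢(ℝ × Space d, ℂ)) (β γ : Fin m)
    (k : Space d) :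
    Integrable fun p : ℝ × Space d => α p * planeWave k p.2 * expI (-p.1) (D.E k) β γ := by
  have h := (continuous_smearing_phase D β γ).comp (Continuous.prodMk_right k)
  refine (integrable_schwartz_spaceTime α).norm.mono' ?_ (.of_forall fun p => ?_)
  · simp only [mul_assoc]
    exact (α.continuous.mul h).aestronglyMeasurable
  · rw [mul_assoc, norm_mul]
    exact mul_le_of_le_one_right (norm_nonneg _) (norm_smearing_phase_le D β γ k p)

/-- The entries of `α(E(k), k)`. -/
noncomputable def symbolEntry (D : Dispersion d m) (α : 𝓢(ℝ × Space d, ℂ)) (β γ : Fin m)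
    (k : Space d) : ℂ :=
  ∫ p : ℝ × Space d, α p * planeWave k p.2 * expI (-p.1) (D.E k) β γ

theorem continuous_symbolEntry (D : Dispersion d m) (α : 𝓢(ℝ × Space d, ℂ)) (β γ : Fin m) :
    Continuous (symbolEntry D α β γ) := by
  refine continuous_of_dominated (bound := fun p => ‖α p‖)
    (fun k => (integrable_symbol_integrand D α β γ k).aestronglyMeasurable)
    (fun k => .of_forall fun p => ?_) (integrable_schwartz_spaceTime α).norm (.of_forall fun p => ?_)
  · rw [mul_assoc, norm_mul]
    exact mul_le_of_le_one_right (norm_nonneg _) (norm_smearing_phase_le D β γ k p)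
  · simp only [mul_assoc]
    have h : Continuous fun k : Space d => planeWave k p.2 := by unfold planeWave; fun_prop
    exact continuous_const.mul (h.mul (contDiff_expI_slice D β γ (-p.1)).continuous)

theorem integral_smearing_mulVec (D : Dispersion d m) (α : 𝓢(ℝ × Space d, ℂ)) (t : ElemSpace d m)
    (β : Fin m) (k : Space d) :
    ∫ p : ℝ × Space d, α p * planeWave k p.2 * (expI (-p.1) (D.E k)).mulVec (t k).ofLp β =
      ∑ γ, symbolEntry D α β γ k * t k γ := by
  simp only [Matrix.mulVec, dotProduct, Finset.mul_sum, ← mul_assoc]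
  rw [integral_finsetSum _ fun γ _ => (integrable_symbol_integrand D α β γ k).mul_const _]
  exact Finset.sum_congr rfl fun γ _ => integral_mul_const _ _

theorem SchwartzMap.continuous_ofLp_apply (t : ElemSpace d m) (γ : Fin m) :
    Continuous fun k => t k γ := by
  have := t.continuous
  fun_prop

/-- Smearing in space-time and pairing with a test function commute. -/
theorem integral_mul_integral_phase (D : Dispersion d m) (α : 𝓢(ℝ × Space d, ℂ))
    (t : ElemSpace d m) {φ : Space d → ℂ} (hφ : Continuous φ) (hc : HasCompactSupport φ)
    (β : Fin m) :
    ∫ p : ℝ × Space d, α p * ∫ k, φ k *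
        (planeWave k p.2 * (expI (-p.1) (D.E k)).mulVec (t k).ofLp β) =
      ∫ k, φ k * ∑ γ, symbolEntry D α β γ k * t k γ := by
  have hI : ∀ γ, Integrable fun k => φ k * t k γ := fun γ =>
    (hφ.mul (SchwartzMap.continuous_ofLp_apply t γ)).integrable_of_hasCompactSupport hc.mul_right
  have hF : ∀ γ, Integrable (Function.uncurry fun (p : ℝ × Space d) (k : Space d) =>
      α p * ((φ k * t k γ) * (planeWave k p.2 * expI (-p.1) (D.E k) β γ)))
      (volume.prod volume) := fun γ =>
    integrable_mul_mul_phase (integrable_schwartz_spaceTime α) (hI γ)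
      (((continuous_smearing_phase D β γ).comp continuous_swap).aestronglyMeasurable)
      fun q => norm_smearing_phase_le D β γ q.2 q.1
  have e : ∀ (p : ℝ × Space d) (k : Space d), α p * (φ k *
      (planeWave k p.2 * (expI (-p.1) (D.E k)).mulVec (t k).ofLp β)) =
      ∑ γ, α p * ((φ k * t k γ) * (planeWave k p.2 * expI (-p.1) (D.E k) β γ)) := by
    intro p k
    simp only [Matrix.mulVec, dotProduct, Finset.mul_sum]
    exact Finset.sum_congr rfl fun γ _ => by ring
  simp only [← integral_const_mul, e]
  rw [integral_integral_swap]
  · refine integral_congr_ae (.of_forall fun k => ?_)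
    simp only [← e]
    rw [← integral_smearing_mulVec, ← integral_const_mul]
    exact congrArg _ (funext fun p => by ring)
  · have := integrable_finsetSum Finset.univ fun γ _ => hF γ
    refine this.congr (.of_forall fun q => ?_)
    simp [Function.uncurry]

/-- The one-particle amplitude of a smeared operator is obtained by pairing both amplitudes with an
arbitrary test function. -/
theorem amplitude_smearing {A A' : Fin m → 𝒜} {α : Fin m → Fin m → 𝓢(ℝ × Space d, ℂ)}
    (Φ : ElementaryExcitation S D) (hA' : IsSmearing S α A A') {T T' : Fin m → ElemSpace d m}
    (hT : ∀ i, IsOneParticleProjection Φ (A i) (T i))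
    (hT' : ∀ i, IsOneParticleProjection Φ (A' i) (T' i)) (i : Fin m) (k : Space d) (β : Fin m) :
    T' i k β = ∑ j, ∑ γ, symbolEntry D (α i j) β γ k * T j k γ := by
  -- Both sides are continuous, so it suffices to compare their integrals with real test functions.
  have hc1 : Continuous fun k => T' i k β := SchwartzMap.continuous_ofLp_apply _ _
  have hc2 : Continuous fun k => ∑ j, ∑ γ, symbolEntry D (α i j) β γ k * T j k γ :=
    continuous_finsetSum _ fun j _ => continuous_finsetSum _ fun γ _ =>
      (continuous_symbolEntry D _ _ _).mul (SchwartzMap.continuous_ofLp_apply _ _)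
  have hz : ∀ᵐ k, T' i k β - ∑ j, ∑ γ, symbolEntry D (α i j) β γ k * T j k γ = 0 := by
    refine ae_eq_zero_of_integral_contDiff_smul_eq_zero (hc1.sub hc2).locallyIntegrable
      fun g hg hgc => ?_
    set φ : Space d → ℂ := fun k => (g k : ℂ) with hφdef
    have hφ : ContDiff ℝ ((⊤ : ℕ∞) : WithTop ℕ∞) φ := Complex.ofRealCLM.contDiff.comp hg
    have hφc : HasCompactSupport φ :=
      hgc.comp_left (g := fun t : ℝ => (t : ℂ)) Complex.ofReal_zero
    have hreal : ∀ k, (starRingEnd ℂ) (φ k) = φ k := fun k => Complex.conj_ofReal _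
    obtain ⟨b, hb⟩ := vec_surjective S (Φ.toFun (singleElem hφ hφc β))
    have h1 := (hT' i).ω_star_mul hb
    have h2 := hA' i (star b) 1
    simp only [mul_one] at h2
    rw [h1] at h2
    have h3 : ∀ (j : Fin m) (p : ℝ × Space d), S.ω (star b * S.trans p (A j)) = _ := fun j p =>
      (hT j).ω_star_mul_trans hφ hφc hb p
    simp only [h3, inner_singleElem, hreal] at h2
    simp only [integral_mul_integral_phase D _ _ hφ.continuous hφc] at h2
    have hi : ∀ {u : Space d → ℂ}, Continuous u → Integrable fun k => φ k * u k := fun hu =>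
      (hφ.continuous.mul hu).integrable_of_hasCompactSupport hφc.mul_right
    have hI : ∀ j, Integrable fun k =>
        φ k * ∑ γ, symbolEntry D (α i j) β γ k * T j k γ := fun j =>
      hi (continuous_finsetSum _ fun γ _ =>
        (continuous_symbolEntry D _ _ _).mul (SchwartzMap.continuous_ofLp_apply _ _))
    rw [← integral_finsetSum _ fun j _ => hI j] at h2
    simp only [← Finset.mul_sum] at h2
    have e : ∀ k, g k • (T' i k β - ∑ j, ∑ γ, symbolEntry D (α i j) β γ k * T j k γ) =
        φ k * T' i k β - φ k * ∑ j, ∑ γ, symbolEntry D (α i j) β γ k * T j k γ := fun k => by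
      rw [Complex.real_smul, mul_sub]
    simp only [e]
    rw [integral_sub (hi hc1) (hi hc2), h2, sub_self]
  have h0 := (Continuous.ae_eq_iff_eq volume (hc1.sub hc2) continuous_const).1
    (show (fun k => T' i k β - ∑ j, ∑ γ, symbolEntry D (α i j) β γ k * T j k γ) =ᵐ[volume]
      fun _ => (0 : ℂ) from hz)
  exact sub_eq_zero.1 (congrFun h0 k)

theorem expI_opEnergy (D : Dispersion d m) (t : Fin m → ElemSpace d m) {k : Space d}
    (ht : (ampMatrix t k).det ≠ 0) (s : ℝ) :
    expI s (opEnergy D t k) = ampMatrix t k * (expI s (D.E k)).transpose * (ampMatrix t k)⁻¹ := by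
  rw [opEnergy, expI_conj _ _ _ ((Matrix.isUnit_iff_isUnit_det _).2 (isUnit_iff_ne_zero.2 ht)),
    expI_transpose]

theorem expI_opEnergy_apply (D : Dispersion d m) (t : Fin m → ElemSpace d m) {k : Space d}
    (ht : (ampMatrix t k).det ≠ 0) (s : ℝ) (l j : Fin m) :
    expI s (opEnergy D t k) l j =
      ∑ γ, ∑ β, expI s (D.E k) β γ * (t l k γ * (ampMatrix t k)⁻¹ β j) := by
  rw [expI_opEnergy D t ht, Matrix.mul_apply]
  simp only [Matrix.mul_apply, Finset.sum_mul, ampMatrix, Matrix.of_apply, Matrix.transpose_apply]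
  rw [Finset.sum_comm]
  exact Finset.sum_congr rfl fun γ _ => Finset.sum_congr rfl fun β _ => by ring

theorem integrable_symbolAt_integrand (D : Dispersion d m) (t : Fin m → ElemSpace d m)
    (α : 𝓢(ℝ × Space d, ℂ)) {k : Space d} (ht : (ampMatrix t k).det ≠ 0) (l j : Fin m) :
    Integrable fun p : ℝ × Space d =>
      α p * planeWave k p.2 * expI (-p.1) (opEnergy D t k) l j := by
  simp only [expI_opEnergy_apply D t ht, Finset.mul_sum, ← mul_assoc]
  exact integrable_finsetSum _ fun γ _ => integrable_finsetSum _ fun β _ =>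
    ((integrable_symbol_integrand D α β γ k).mul_const _).mul_const _

theorem symbolAt_apply (D : Dispersion d m) (t : Fin m → ElemSpace d m)
    (α : Fin m → Fin m → 𝓢(ℝ × Space d, ℂ)) {k : Space d} (ht : (ampMatrix t k).det ≠ 0)
    (i j : Fin m) : symbolAt α (opEnergy D t k) k i j =
      ∑ l, ∑ γ, ∑ β, symbolEntry D (α i l) β γ k * (t l k γ * (ampMatrix t k)⁻¹ β j) := by
  rw [symbolAt, Matrix.of_apply]
  refine Finset.sum_congr rfl fun l _ => ?_
  simp only [expI_opEnergy_apply D t ht, Finset.mul_sum]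
  have hI : ∀ β γ, Integrable fun p : ℝ × Space d => α i l p * planeWave k p.2 *
      (expI (-p.1) (D.E k) β γ * (t l k γ * (ampMatrix t k)⁻¹ β j)) := fun β γ => by
    simp only [← mul_assoc]
    exact ((integrable_symbol_integrand D _ β γ k).mul_const _).mul_const _
  rw [integral_finsetSum _ fun γ _ => integrable_finsetSum _ fun β _ => hI β γ]
  refine Finset.sum_congr rfl fun γ _ => ?_
  rw [integral_finsetSum _ fun β _ => hI β γ]
  refine Finset.sum_congr rfl fun β _ => ?_
  rw [symbolEntry, ← integral_mul_const]
  exact congrArg _ (funext fun p => by ring)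

/-- `T'(k) = α(E(k), k) T(k)`, in terms of the matrix of `E(k)` in the operator indices. -/
theorem ampMatrix_eq_symbolAt_mul {A A' : Fin m → 𝒜} {α : Fin m → Fin m → 𝓢(ℝ × Space d, ℂ)}
    (Φ : ElementaryExcitation S D) (hA' : IsSmearing S α A A') {T T' : Fin m → ElemSpace d m}
    (hT : ∀ i, IsOneParticleProjection Φ (A i) (T i))
    (hT' : ∀ i, IsOneParticleProjection Φ (A' i) (T' i)) {k : Space d}
    (hdet : (ampMatrix T k).det ≠ 0) :
    ampMatrix T' k = symbolAt α (opEnergy D T k) k * ampMatrix T k := by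
  have hN : symbolAt α (opEnergy D T k) k = ampMatrix T' k * (ampMatrix T k)⁻¹ := by
    ext i j
    rw [symbolAt_apply D T α hdet, Matrix.mul_apply]
    simp only [ampMatrix, Matrix.of_apply, amplitude_smearing Φ hA' hT hT' i k, Finset.sum_mul]
    conv_rhs => rw [Finset.sum_comm]
    refine Finset.sum_congr rfl fun l _ => ?_
    rw [Finset.sum_comm]
    exact Finset.sum_congr rfl fun β _ => Finset.sum_congr rfl fun γ _ => by ring
  rw [hN, Matrix.mul_assoc, Matrix.nonsing_inv_mul _ (isUnit_iff_ne_zero.2 hdet), Matrix.mul_one]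

end Amplitude

end AQFT

namespace AQFT

/-! ### Superpositions in every argument -/

section Slots

/-- A function of `r` arguments that turns superpositions in every single argument into integrals
turns superpositions in all arguments into multiple integrals. -/
theorem eq_sum_integral_of_slotwise {Z P L : Type*} [Fintype L] [MeasureSpace P]
    [SigmaFinite (volume : Measure P)] {r : ℕ} {adm : Fin r → Z → Prop} {Ψ : (Fin r → Z) → ℂ}
    {v : Fin r → Z} {F : Fin r → L → P → Z} {w : Fin r → L → P → ℂ}
    (hF : ∀ i l p, adm i (F i l p)) (hv : ∀ i, adm i (v i))
    (hslot : ∀ i X, (∀ j, adm j (X j)) → Ψ (Function.update X i (v i)) =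
      ∑ l, ∫ p, w i l p * Ψ (Function.update X i (F i l p)))
    (hint : ∀ l : Fin r → L, Integrable fun p : Fin r → P =>
      (∏ i, w i (l i) (p i)) * Ψ fun i => F i (l i) (p i)) :
    Ψ v = ∑ l : Fin r → L, ∫ p : Fin r → P,
      (∏ i, w i (l i) (p i)) * Ψ fun i => F i (l i) (p i) := by
  induction r with
  | zero =>
    have e : ∀ X : Fin 0 → Z, Ψ X = Ψ v := fun X => congrArg Ψ (Subsingleton.elim _ _)
    simp only [e, Fintype.sum_unique, Finset.univ_eq_empty, Finset.prod_empty, one_mul]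
    rw [integral_const, Measure.real, volume_pi, Measure.pi_of_empty (x := default),
      Measure.dirac_apply_of_mem (Set.mem_univ _)]
    simp
  | succ r ih =>
    -- Expand the first argument, and apply the induction hypothesis to the others.
    have hmp := (volume_preserving_piFinSuccAbove (fun _ : Fin (r + 1) => P) 0).symm
    have hcons : ∀ (p₀ : P) (p : Fin r → P),
        (MeasurableEquiv.piFinSuccAbove (fun _ : Fin (r + 1) => P) 0).symm (p₀, p) =
          Fin.cons p₀ p := fun p₀ p => by
      rw [← Fin.insertNth_zero']
      rfl
    have hFc : ∀ (l₀ : L) (l : Fin r → L) (p₀ : P) (p : Fin r → P),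
        (fun i => F i ((Fin.cons l₀ l : Fin (r + 1) → L) i) ((Fin.cons p₀ p : Fin (r + 1) → P) i)) =
          (Fin.cons (F 0 l₀ p₀) fun i => F i.succ (l i) (p i)) := fun l₀ l p₀ p => by
      ext i
      refine Fin.cases ?_ (fun i => ?_) i <;> simp
    have hint' : ∀ (l₀ : L) (l : Fin r → L), Integrable fun q : P × (Fin r → P) =>
        (∏ i, w i.succ (l i) (q.2 i)) * (w 0 l₀ q.1 * Ψ (Fin.cons (F 0 l₀ q.1)
          fun i => F i.succ (l i) (q.2 i))) := fun l₀ l => by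
      have := (hmp.integrable_comp_emb (MeasurableEquiv.measurableEmbedding _)).2
        (hint (Fin.cons l₀ l))
      refine this.congr (.of_forall fun q => ?_)
      simp only [Function.comp, hcons, hFc, Fin.prod_univ_succ, Fin.cons_zero, Fin.cons_succ]
      ring
    have h1 : Ψ v = ∑ l₀, ∫ p₀, w 0 l₀ p₀ * Ψ (Fin.cons (F 0 l₀ p₀) (Fin.tail v)) := by
      have := hslot 0 v hv
      rw [Function.update_eq_self] at this
      rw [this]
      have hu : ∀ z, Function.update v 0 z = Fin.cons z (Fin.tail v) := fun z => by
        conv_lhs => rw [← Fin.cons_self_tail v, Fin.update_cons_zero]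
      simp only [hu]
    have h2 : ∀ l₀, ∀ᵐ p₀, w 0 l₀ p₀ * Ψ (Fin.cons (F 0 l₀ p₀) (Fin.tail v)) =
        ∑ l : Fin r → L, ∫ p : Fin r → P, (∏ i, w i.succ (l i) (p i)) *
          (w 0 l₀ p₀ * Ψ (Fin.cons (F 0 l₀ p₀) fun i => F i.succ (l i) (p i))) := by
      intro l₀
      have hae : ∀ᵐ p₀, ∀ l : Fin r → L, Integrable fun p : Fin r → P =>
          (∏ i, w i.succ (l i) (p i)) *
            (w 0 l₀ p₀ * Ψ (Fin.cons (F 0 l₀ p₀) fun i => F i.succ (l i) (p i))) :=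
        ae_all_iff.2 fun l => (hint' l₀ l).prod_right_ae
      filter_upwards [hae] with p₀ hp₀
      refine ih (adm := fun i => adm i.succ) (v := Fin.tail v)
        (Ψ := fun X => w 0 l₀ p₀ * Ψ (Fin.cons (F 0 l₀ p₀) X))
        (F := fun i => F i.succ) (w := fun i => w i.succ)
        (fun i l p => hF _ _ _) (fun i => hv _) (fun i X hX => ?_) hp₀
      have h := hslot i.succ (Fin.cons (F 0 l₀ p₀) X) fun j => by
        refine Fin.cases ?_ (fun j => ?_) j
        · simpa using hF 0 l₀ p₀
        · simpa using hX j
      simp only [← Fin.cons_update] at h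
      simp only [Fin.tail]
      rw [h, Finset.mul_sum]
      refine Finset.sum_congr rfl fun l _ => ?_
      rw [← integral_const_mul]
      exact congrArg _ (funext fun p => by ring)
    rw [h1]
    have h3 : ∀ l₀, ∫ p₀, w 0 l₀ p₀ * Ψ (Fin.cons (F 0 l₀ p₀) (Fin.tail v)) =
        ∑ l : Fin r → L, ∫ p : Fin (r + 1) → P,
          (∏ i, w i ((Fin.cons l₀ l : Fin (r + 1) → L) i) (p i)) *
            Ψ fun i => F i ((Fin.cons l₀ l : Fin (r + 1) → L) i) (p i) := by
      intro l₀
      rw [integral_congr_ae (h2 l₀), integral_finsetSum _ fun l _ => (hint' l₀ l).integral_prod_left]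
      refine Finset.sum_congr rfl fun l _ => ?_
      rw [← integral_prod _ (hint' l₀ l),
        ← hmp.integral_comp (MeasurableEquiv.measurableEmbedding _)]
      refine integral_congr_ae (.of_forall fun q => ?_)
      simp only [hcons, hFc, Fin.prod_univ_succ, Fin.cons_zero, Fin.cons_succ]
      ring
    simp only [h3]
    rw [← (Fin.consEquiv fun _ : Fin (r + 1) => L).sum_comp, Fintype.sum_prod_type]
    rfl

end Slots

/-! ### Green functions of smeared operators -/

section Smearing

variable {d m r a : ℕ} {𝒜 : Type*} [Ring 𝒜] [StarRing 𝒜] [Algebra ℂ 𝒜] [StarModule ℂ 𝒜]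
  {S : TranslationInvariantState d 𝒜}

omit [StarRing 𝒜] [Algebra ℂ 𝒜] [StarModule ℂ 𝒜] in
/-- The chronological product is linear in each operator. -/
theorem exists_chronological_update_eq (τ : Fin r → ℝ) (X : Fin r → 𝒜) (i : Fin r) :
    ∃ P Q : 𝒜, ∀ V, chronological τ (Function.update X i V) = P * V * Q := by
  have hmem : i ∈ chronoList τ := by
    rw [chronoList, List.mem_ofFn]
    exact ⟨_, (Tuple.sort fun j => -τ j).apply_symm_apply i⟩
  have hnd : (chronoList τ).Nodup := List.nodup_ofFn.2 (Equiv.injective _)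
  obtain ⟨s, t, hst⟩ := List.append_of_mem hmem
  rw [hst, List.nodup_append'] at hnd
  have hs : i ∉ s := fun h => hnd.2.2 h (List.mem_cons_self)
  have ht : i ∉ t := (List.nodup_cons.1 hnd.2.1).1
  have hmap : ∀ (u : List (Fin r)) (V : 𝒜), i ∉ u → u.map (Function.update X i V) = u.map X :=
    fun u V hu => List.map_congr_left fun j hj => by
      rw [Function.update_of_ne]
      rintro rfl
      exact hu hj
  refine ⟨(s.map X).prod, (t.map X).prod, fun V => ?_⟩
  rw [chronological_eq, hst, List.map_append, List.map_cons, List.prod_append, List.prod_cons,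
    hmap s V hs, hmap t V ht, Function.update_self, mul_assoc]

theorem ω_mul_legOp_trans_mul {A A' : Fin m → 𝒜} {α : Fin m → Fin m → 𝓢(ℝ × Space d, ℂ)}
    (hA' : IsSmearing S α A A') (q : ℝ × Space d) (i : Fin r) (j : Fin m) (P Q : 𝒜) :
    S.ω (P * S.trans q (legOp a i (A' j)) * Q) = ∑ l, ∫ p : ℝ × Space d,
      legConj a i (α j l p) * S.ω (P * S.trans (q + p) (legOp a i (A l)) * Q) := by
  have h1 : ∀ (P Q : 𝒜), S.ω (P * S.trans q (A' j) * Q) = ∑ l, ∫ p : ℝ × Space d,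
      α j l p * S.ω (P * S.trans (q + p) (A l) * Q) := by
    intro P Q
    have e : ∀ V : 𝒜, S.ω (P * S.trans q V * Q) =
        S.ω (S.trans (-q) P * V * S.trans (-q) Q) := fun V => by
      rw [← S.ω_trans (-q), map_mul (S.trans (-q)), map_mul (S.trans (-q)), trans_neg_trans]
    rw [e, hA']
    simp only [S.trans_add, e]
  unfold legOp legConj
  split_ifs with hi
  · exact h1 P Q
  · have e : ∀ (q : ℝ × Space d) (V : 𝒜), S.ω (P * S.trans q (star V) * Q) =
        (starRingEnd ℂ) (S.ω (star Q * S.trans q V * star P)) := fun q V => by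
      rw [← S.ω_star]
      simp [mul_assoc, map_star]
    simp only [e, h1, map_sum, ← map_mul, integral_conj]

theorem integrable_prod_schwartz (α : Fin r → 𝓢(ℝ × Space d, ℂ)) :
    Integrable fun p : Fin r → ℝ × Space d => ∏ i, legConj a i (α i (p i)) :=
  Integrable.fintype_prod (f := fun i p => legConj a i (α i p)) fun i =>
    (integrable_schwartz_spaceTime (α i)).mono
      ((continuous_legConj a i).comp (α i).continuous).aestronglyMeasurable
      (.of_forall fun _ => (norm_legConj a i _).le)

/-- The Green function of smeared operators is a superposition of translated products, taken in
the order of the original times. -/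
theorem green_smearing {A A' : Fin m → 𝒜} {α : Fin m → Fin m → 𝓢(ℝ × Space d, ℂ)} {B : ℝ}
    (hA' : IsSmearing S α A A') (hA : ∀ i, OpNormLE S (A i) B) (hB : 0 ≤ B) (τ : Fin r → ℝ)
    (x : Fin r → Space d) (j : Fin r → Fin m) :
    green S A' a τ x j = ∑ l : Fin r → Fin m, ∫ p : Fin r → ℝ × Space d,
      (∏ i, legConj a i (α (j i) (l i) (p i))) * S.ω (chronological τ fun i =>
        S.trans ((τ i, x i) + p i) (legOp a i (A (l i)))) := by
  refine eq_sum_integral_of_slotwise (Ψ := fun X => S.ω (chronological τ X))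
    (adm := fun _ _ => True) (v := fun i => S.trans (τ i, x i) (legOp a i (A' (j i))))
    (F := fun i l p => S.trans ((τ i, x i) + p) (legOp a i (A l)))
    (w := fun i l p => legConj a i (α (j i) l p)) (fun _ _ _ => trivial) (fun _ => trivial)
    (fun i X _ => ?_) fun l => ?_
  · obtain ⟨P, Q, hPQ⟩ := exists_chronological_update_eq τ X i
    simp only [hPQ]
    exact ω_mul_legOp_trans_mul hA' _ i _ P Q
  · refine (integrable_prod_schwartz (a := a) fun i => α (j i) (l i)).mul_bdd (c := B ^ r) ?_
      (.of_forall fun _ => norm_ω_chronological_le hB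
        (fun i => (opNormLE_legOp (hA _) i).trans _) τ)
    exact (continuous_ω_chronological hA (q := fun (p : Fin r → ℝ × Space d) i => (τ i, x i) + p i)
      (fun i => continuous_const.add (continuous_apply i)) τ l).aestronglyMeasurable

end Smearing

end AQFT

namespace AQFT

/-! ### Reordering of the chronological product -/

section Reorder

variable {d m r a : ℕ} {𝒜 : Type*} [Ring 𝒜] [StarRing 𝒜] [Algebra ℂ 𝒜] [StarModule ℂ 𝒜]
  {S : TranslationInvariantState d 𝒜} {A : Fin m → 𝒜}

theorem exists_abs_eval_le (c : Polynomial ℝ) :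
    ∃ (C : ℝ) (Q : ℕ), 0 ≤ C ∧ ∀ u, |c.eval u| ≤ C * (1 + |u|) ^ Q := by
  refine ⟨∑ i ∈ Finset.range (c.natDegree + 1), |c.coeff i|, c.natDegree,
    Finset.sum_nonneg fun _ _ => abs_nonneg _, fun u => ?_⟩
  rw [Polynomial.eval_eq_sum_range, Finset.sum_mul]
  refine (Finset.abs_sum_le_sum_abs _ _).trans (Finset.sum_le_sum fun i hi => ?_)
  rw [abs_mul, abs_pow]
  refine mul_le_mul_of_nonneg_left ?_ (abs_nonneg _)
  have h : 0 ≤ |u| := abs_nonneg u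
  exact (pow_le_pow_left₀ h (by linarith) i).trans
    (pow_le_pow_right₀ (by linarith) (Finset.mem_range_succ_iff.1 hi))

theorem AsymptoticallyCommute.exists_bound (h : AsymptoticallyCommute S A) (n : ℕ) :
    ∃ (C : ℝ) (Q : ℕ), 0 ≤ C ∧ ∀ (k l : Fin m) (i j : Fin r), (i.val < a ↔ j.val < a) →
      ∀ p q : ℝ × Space d, OpNormLE S
        (S.trans p (legOp a i (A k)) * S.trans q (legOp a j (A l)) -
          S.trans q (legOp a j (A l)) * S.trans p (legOp a i (A k)))
        (C * (1 + |p.1 - q.1|) ^ Q / (1 + ‖p.2 - q.2‖ ^ n)) := by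
  choose c hc using fun k l => h k l n
  choose C Q hC0 hC using fun k l => exists_abs_eval_le (c k l)
  refine ⟨∑ k, ∑ l, C k l, ∑ k, ∑ l, Q k l,
    Finset.sum_nonneg fun _ _ => Finset.sum_nonneg fun _ _ => hC0 _ _, fun k l i j hij p q => ?_⟩
  refine (opNormLE_commutator_legOp (hc k l) hij p q).mono ?_
  have h1 : (1 : ℝ) ≤ 1 + |p.1 - q.1| := by linarith [abs_nonneg (p.1 - q.1)]
  have h2 : C k l ≤ ∑ k, ∑ l, C k l :=
    (Finset.single_le_sum (f := C k) (fun _ _ => hC0 _ _) (Finset.mem_univ l)).trans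
      (Finset.single_le_sum (f := fun k => ∑ l, C k l)
        (fun _ _ => Finset.sum_nonneg fun _ _ => hC0 _ _) (Finset.mem_univ k))
  have h3 : Q k l ≤ ∑ k, ∑ l, Q k l :=
    (Finset.single_le_sum (f := Q k) (fun _ _ => Nat.zero_le _) (Finset.mem_univ l)).trans
      (Finset.single_le_sum (f := fun k => ∑ l, Q k l)
        (fun _ _ => Nat.zero_le _) (Finset.mem_univ k))
  gcongr
  refine (le_abs_self _).trans ((hC k l _).trans ?_)
  exact mul_le_mul h2 (pow_le_pow_right₀ h1 h3) (by positivity) ((hC0 k l).trans h2)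

/-- Points moving with separated velocities at almost equal times are far apart. -/
theorem le_norm_sub_of_velocities {x y x' y' : Space d} {τ τ' s δ : ℝ} {M : ℕ} (hs : 1 ≤ s)
    (hτ : s ^ M ≤ |τ|) (hτ' : s ^ M ≤ |τ'|) (hδ0 : 0 ≤ δ)
    (hδ : δ ≤ dist (τ⁻¹ • x) (τ'⁻¹ • x')) (hd : |τ - τ'| ≤ 2 * s) (hx' : ‖x'‖ ≤ s ^ (M + 1))
    (hy : ‖y‖ ≤ s) (hy' : ‖y'‖ ≤ s) : δ * s ^ M - 4 * s ^ 2 ≤ ‖(x + y) - (x' + y')‖ := by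
  have hsM : 0 < s ^ M := by positivity
  have hτ0 : τ ≠ 0 := abs_pos.1 (hsM.trans_le hτ)
  have hτ0' : τ' ≠ 0 := abs_pos.1 (hsM.trans_le hτ')
  set v := τ⁻¹ • x with hv
  set v' := τ'⁻¹ • x' with hv'
  have hxv : x = τ • v := by rw [hv, smul_inv_smul₀ hτ0]
  have hxv' : x' = τ' • v' := by rw [hv', smul_inv_smul₀ hτ0']
  have hv'n : ‖v'‖ ≤ s := by
    rw [hv', norm_smul, norm_inv, Real.norm_eq_abs, inv_mul_le_iff₀ (abs_pos.2 hτ0')]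
    refine hx'.trans ?_
    rw [pow_succ]
    exact mul_le_mul_of_nonneg_right hτ' (by linarith)
  have e : τ • (v - v') = ((x + y) - (x' + y')) + ((y' - y) - (τ - τ') • v') := by
    rw [hxv, hxv', smul_sub, sub_smul]
    abel
  have h1 : ‖τ • (v - v')‖ = |τ| * dist v v' := by rw [norm_smul, Real.norm_eq_abs, dist_eq_norm]
  have h2 : δ * s ^ M ≤ |τ| * dist v v' := by
    rw [mul_comm]
    exact mul_le_mul hτ hδ hδ0 (abs_nonneg _)
  have h3 := norm_add_le ((x + y) - (x' + y')) ((y' - y) - (τ - τ') • v')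
  have h4 := norm_sub_le (y' - y) ((τ - τ') • v')
  have h5 := norm_sub_le y' y
  have h6 : ‖(τ - τ') • v'‖ ≤ 2 * s * s := by
    rw [norm_smul, Real.norm_eq_abs]
    exact mul_le_mul hd hv'n (norm_nonneg _) (by linarith)
  rw [← e, h1] at h3
  nlinarith

/-- If all points `x i` move with separated velocities, a small shift of the times reorders only
operators at large spacelike distance. -/
theorem exists_norm_ω_reorder_le (hcomm : AsymptoticallyCommute S A) {B : ℝ} (hB : 1 ≤ B)
    (hA : ∀ i, OpNormLE S (A i) B) (n : ℕ) {K : Fin r → Set (Space d)} {δ : ℝ} (hδ : 0 < δ)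
    (hK : ∀ i j, i ≠ j → (i.val < a ↔ j.val < a) → ∀ v ∈ K i, ∀ w ∈ K j, δ ≤ dist v w) :
    ∃ (M : ℕ) (C s₀ : ℝ), 0 < M ∧ 0 ≤ C ∧ 1 ≤ s₀ ∧ ∀ s, s₀ ≤ s → ∀ (τ : Fin r → ℝ)
      (x : Fin r → Space d) (p : Fin r → ℝ × Space d) (l : Fin r → Fin m),
      (∀ i, s ^ M ≤ |τ i|) → (∀ i, if i.val < a then τ i < 0 else 0 < τ i) →
      (∀ i, (τ i)⁻¹ • x i ∈ K i) → (∀ i, ‖x i‖ ≤ s ^ (M + 1)) → (∀ i, ‖p i‖ ≤ s) →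
      ‖S.ω (chronological τ fun i => S.trans ((τ i, x i) + p i) (legOp a i (A (l i)))) -
        S.ω (chronological (fun i => τ i + (p i).1) fun i =>
          S.trans ((τ i, x i) + p i) (legOp a i (A (l i))))‖ ≤ C * (s ^ M / (s ^ M) ^ n) := by
  obtain ⟨C, Q, hC, hb⟩ := hcomm.exists_bound (r := r) (a := a) n
  -- At times of order `s ^ (Q + 3)` the distances `δ s ^ (Q + 3)` exceed the uncertainty `4 s²` of
  -- the positions, and the growth `s ^ Q` of the commutators in time is compensated.
  refine ⟨Q + 3, r ^ 2 * B ^ r * (C * 5 ^ Q / (δ / 2) ^ n), 2 + 8 / δ, by omega, by positivity,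
    by linarith [show 0 < 8 / δ by positivity], fun s hs τ x p l hτ hsign hxK hx hp => ?_⟩
  have hs2 : 2 ≤ s := by linarith [show 0 < 8 / δ by positivity]
  have hs8 : 8 ≤ δ * s := by
    have : 8 / δ ≤ s := by linarith
    rwa [div_le_iff₀ hδ, mul_comm] at this
  have hsM : s ^ 3 ≤ s ^ (Q + 3) := pow_le_pow_right₀ (by linarith) (by omega)
  have hs3 : s < s ^ 3 := by nlinarith [mul_pos (show 0 < s by linarith) (show 0 < s by linarith)]
  have hsep : δ / 2 * s ^ (Q + 3) ≤ δ * s ^ (Q + 3) - 4 * s ^ 2 := by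
    have : 8 * s ^ 2 ≤ δ * s ^ 3 := by nlinarith [sq_nonneg s]
    nlinarith
  have hp1 : ∀ i, |(p i).1| ≤ s := fun i => (norm_fst_le (p i)).trans (hp i)
  have hp2 : ∀ i, ‖(p i).2‖ ≤ s := fun i => (norm_snd_le (p i)).trans (hp i)
  have key := norm_ω_chronological_sub_le (S := S)
    (X := fun i => S.trans ((τ i, x i) + p i) (legOp a i (A (l i)))) hB
    (ε := C * (5 * s) ^ Q / (δ / 2 * s ^ (Q + 3)) ^ n) (by positivity)
    (fun i => (opNormLE_legOp (hA _) i).trans _) τ (fun i => τ i + (p i).1)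
    fun i j hij h1 h2 => ?_
  · refine key.trans ?_
    have h5 : s ^ Q ≤ s ^ (Q + 3) := pow_le_pow_right₀ (by linarith) (by omega)
    calc r ^ 2 * B ^ r * (C * (5 * s) ^ Q / (δ / 2 * s ^ (Q + 3)) ^ n)
        = r ^ 2 * B ^ r * (C * 5 ^ Q / (δ / 2) ^ n) * (s ^ Q / (s ^ (Q + 3)) ^ n) := by
          rw [mul_pow, mul_pow (δ / 2)]
          field_simp
      _ ≤ _ := by gcongr
  · have hi := abs_le.1 (hp1 i)
    have hj := abs_le.1 (hp1 j)
    -- Incoming and outgoing times have opposite signs and are larger than the shifts, so only legs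
    -- of the same kind can be interchanged.
    have hsame : i.val < a ↔ j.val < a := by
      have hsi := hsign i
      have hsj := hsign j
      have hti := hτ i
      have htj := hτ j
      by_contra hne
      by_cases hia : i.val < a
      · have hja : ¬ j.val < a := fun h => hne ⟨fun _ => h, fun _ => hia⟩
        rw [if_pos hia] at hsi
        rw [if_neg hja] at hsj
        linarith
      · have hja : j.val < a := by
          by_contra h
          exact hne ⟨fun h' => absurd h' hia, fun h' => absurd h' h⟩
        rw [if_neg hia] at hsi
        rw [if_pos hja] at hsj
        rw [abs_of_pos hsi] at hti
        rw [abs_of_neg hsj] at htj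
        linarith
    have hτd : |τ i - τ j| ≤ 2 * s := abs_le.2 ⟨by linarith, by linarith⟩
    have hdist := le_norm_sub_of_velocities (x := x i) (y := (p i).2) (x' := x j) (y' := (p j).2)
      (by linarith) (hτ i) (hτ j) hδ.le (hK i j hij hsame _ (hxK i) _ (hxK j)) hτd (hx j) (hp2 i)
      (hp2 j)
    refine (hb (l i) (l j) i j hsame _ _).mono ?_
    have h4 : |((τ i, x i) + p i).1 - ((τ j, x j) + p j).1| ≤ 4 * s := by
      simp only [Prod.fst_add]
      exact abs_le.2 ⟨by linarith [abs_le.1 hτd], by linarith [abs_le.1 hτd]⟩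
    have h5 : δ / 2 * s ^ (Q + 3) ≤ ‖((τ i, x i) + p i).2 - ((τ j, x j) + p j).2‖ :=
      hsep.trans hdist
    have h6 : (δ / 2 * s ^ (Q + 3)) ^ n ≤
        1 + ‖((τ i, x i) + p i).2 - ((τ j, x j) + p j).2‖ ^ n :=
      (pow_le_pow_left₀ (by positivity) h5 n).trans (by linarith)
    have h7 : 1 + |((τ i, x i) + p i).1 - ((τ j, x j) + p j).1| ≤ 5 * s := by linarith
    gcongr

/-- If all factors are at most of order `t ^ N` and one of them is of order `t ^ (-(r * N + 1))`, then
the product of the `r` factors is of order `t⁻¹`. -/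
theorem prod_le_of_single_le {u w : Fin r → ℝ} {C t : ℝ} {N : ℕ} (hu : ∀ i, 0 ≤ u i)
    (hw : ∀ i, 0 ≤ w i) (hC : 0 ≤ C) (ht : 1 ≤ t) (h : ∀ i, u i ≤ C * t ^ N * w i) (i : Fin r)
    (hi : u i ≤ C * (t ^ (r * N + 1))⁻¹ * w i) : ∏ i, u i ≤ C ^ r * t⁻¹ * ∏ i, w i := by
  obtain ⟨r', hr⟩ : ∃ r', r = r' + 1 := ⟨r - 1, by have := i.2; omega⟩
  have ht0 : 0 < t := by linarith
  have h1 : ∏ j ∈ Finset.univ.erase i, u j ≤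
      (C * t ^ N) ^ r' * ∏ j ∈ Finset.univ.erase i, w j := by
    refine (Finset.prod_le_prod (fun j _ => hu j) fun j _ => h j).trans_eq ?_
    rw [Finset.prod_mul_distrib, Finset.prod_const, Finset.card_erase_of_mem (Finset.mem_univ i),
      Finset.card_univ, Fintype.card_fin, show r - 1 = r' by omega]
  have hw' : 0 ≤ ∏ j ∈ Finset.univ.erase i, w j := Finset.prod_nonneg fun j _ => hw j
  have hw'' := hw i
  rw [← Finset.mul_prod_erase _ _ (Finset.mem_univ i),
    ← Finset.mul_prod_erase _ w (Finset.mem_univ i)]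
  calc u i * ∏ j ∈ Finset.univ.erase i, u j
      ≤ (C * (t ^ (r * N + 1))⁻¹ * w i) *
          ((C * t ^ N) ^ r' * ∏ j ∈ Finset.univ.erase i, w j) :=
        mul_le_mul hi h1 (Finset.prod_nonneg fun j _ => hu j) (by positivity)
    _ = C ^ r * (t ^ (r * N + 1))⁻¹ * (t ^ N) ^ r' *
          (w i * ∏ j ∈ Finset.univ.erase i, w j) := by
        rw [show C ^ r = C ^ r' * C by rw [hr, pow_succ]]
        ring
    _ ≤ C ^ r * t⁻¹ * (w i * ∏ j ∈ Finset.univ.erase i, w j) := by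
        refine mul_le_mul_of_nonneg_right ?_ (by positivity)
        rw [mul_assoc]
        refine mul_le_mul_of_nonneg_left ?_ (by positivity)
        rw [← pow_mul, inv_mul_le_iff₀ (by positivity), pow_succ, mul_assoc, mul_inv_cancel₀ ht0.ne',
          mul_one]
        exact pow_le_pow_right₀ ht (by rw [hr]; nlinarith)

/-- The effect of the smearing in time on the chronological order is negligible at large times
`t = s ^ M`: either a packet or a smearing function is evaluated in its tail, or all inversions
concern operators at large spacelike distance. -/
theorem exists_pointwise_reorder_le (hcomm : AsymptoticallyCommute S A) {B : ℝ} (hB : 1 ≤ B)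
    (hA : ∀ i, OpNormLE S (A i) B) {K : Fin r → Set (Space d)} {δ : ℝ} (hδ : 0 < δ)
    (hK : ∀ i j, i ≠ j → (i.val < a ↔ j.val < a) → ∀ v ∈ K i, ∀ w ∈ K j, δ ≤ dist v w)
    {W : Fin r → ℝ → Space d → ℂ}
    (hW : ∀ i (N : ℕ), ∃ c : ℝ, 0 ≤ c ∧ ∀ τ x,
      ‖W i τ x‖ ≤ c * (1 + |τ|) ^ N * ((1 + ‖x‖) ^ N)⁻¹)
    (hWK : ∀ i (n : ℕ), ∃ c : ℝ, ∀ τ x, τ ≠ 0 → τ⁻¹ • x ∉ K i →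
      ‖W i τ x‖ ≤ c * ((1 + ‖x‖ ^ 2 + τ ^ 2) ^ n)⁻¹) {κ : ℝ} (hκ : 0 ≤ κ) :
    ∃ (M P : ℕ) (C s₀ : ℝ), 0 < M ∧ 0 ≤ C ∧ 1 ≤ s₀ ∧ ∀ s, s₀ ≤ s → ∀ (τ : Fin r → ℝ)
      (x : Fin r → Space d) (p : Fin r → ℝ × Space d) (l : Fin r → Fin m),
      (∀ i, s ^ M ≤ |τ i|) → (∀ i, |τ i| ≤ κ * s ^ M) →
      (∀ i, if i.val < a then τ i < 0 else 0 < τ i) →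
      (∏ i, ‖W i (τ i) (x i)‖) *
        ‖S.ω (chronological τ fun i => S.trans ((τ i, x i) + p i) (legOp a i (A (l i)))) -
          S.ω (chronological (fun i => τ i + (p i).1) fun i =>
            S.trans ((τ i, x i) + p i) (legOp a i (A (l i))))‖ ≤
        C * (s ^ M)⁻¹ * ((∏ i, ((1 + ‖x i‖) ^ (d + 1))⁻¹) * ∏ i, (1 + ‖p i‖) ^ P) := by
  set N : ℕ := d + 1 with hN
  obtain ⟨M, C₁, s₀, hM, hC₁, hs₀, hD⟩ := exists_norm_ω_reorder_le (r := r) (a := a) hcomm hB hA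
    (r * N + 2) hδ hK
  choose cN hcN0 hcN using fun i => hW i N
  choose cB hcB0 hcB using fun i => hW i (N + M * (r * N + 1 + N))
  choose cK hcK using fun i => hWK i (N + (r * N + 1))
  set C : ℝ := 1 + ∑ i, (cN i * (1 + κ) ^ N + cB i * (1 + κ) ^ (N + M * (r * N + 1 + N)) +
    |cK i| * 2 ^ N) with hC
  have hterm : ∀ i, 0 ≤ cN i * (1 + κ) ^ N + cB i * (1 + κ) ^ (N + M * (r * N + 1 + N)) +
      |cK i| * 2 ^ N := fun i => by
    have := hcN0 i
    have := hcB0 i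
    positivity
  have hCi : ∀ i, cN i * (1 + κ) ^ N + cB i * (1 + κ) ^ (N + M * (r * N + 1 + N)) +
      |cK i| * 2 ^ N ≤ C := fun i => by
    have := Finset.single_le_sum (f := fun i => cN i * (1 + κ) ^ N +
      cB i * (1 + κ) ^ (N + M * (r * N + 1 + N)) + |cK i| * 2 ^ N) (fun i _ => hterm i)
      (Finset.mem_univ i)
    linarith
  have hC1 : 1 ≤ C := by
    rw [hC]
    linarith [Finset.sum_nonneg fun i (_ : i ∈ Finset.univ) => hterm i]
  have hC0 : 0 ≤ C := by linarith
  refine ⟨M, M * (r * N + 1), C ^ r * (2 * B ^ r + C₁), s₀, hM, by positivity, hs₀,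
    fun s hs τ x p l hτ hτκ hsign => ?_⟩
  have hs1 : 1 ≤ s := hs₀.trans hs
  set t : ℝ := s ^ M with ht
  have ht1 : 1 ≤ t := one_le_pow₀ hs1
  have ht0 : 0 < t := by linarith
  set w : Fin r → ℝ := fun i => ((1 + ‖x i‖) ^ N)⁻¹ with hw
  have hw0 : ∀ i, 0 ≤ w i := fun i => by positivity
  set Δ : ℝ := ‖S.ω (chronological τ fun i => S.trans ((τ i, x i) + p i) (legOp a i (A (l i)))) -
          S.ω (chronological (fun i => τ i + (p i).1) fun i =>
            S.trans ((τ i, x i) + p i) (legOp a i (A (l i))))‖ with hΔ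
  have hΔ2 : Δ ≤ 2 * B ^ r := by
    refine (norm_sub_le _ _).trans ?_
    have h0 : 0 ≤ B := by linarith
    have h1 := norm_ω_chronological_le h0 (X := fun i =>
      S.trans ((τ i, x i) + p i) (legOp a i (A (l i))))
      (fun i => (opNormLE_legOp (hA _) i).trans _) τ
    have h2 := norm_ω_chronological_le h0 (X := fun i =>
      S.trans ((τ i, x i) + p i) (legOp a i (A (l i))))
      (fun i => (opNormLE_legOp (hA _) i).trans _) fun i => τ i + (p i).1
    linarith
  have hτt : ∀ i, 1 + |τ i| ≤ (1 + κ) * t := fun i => by nlinarith [hτκ i]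
  have hWN : ∀ i, ‖W i (τ i) (x i)‖ ≤ C * t ^ N * w i := by
    intro i
    have := hcN0 i
    calc ‖W i (τ i) (x i)‖ ≤ cN i * (1 + |τ i|) ^ N * w i := hcN i _ _
      _ ≤ cN i * ((1 + κ) * t) ^ N * w i := by
          have := hτt i
          gcongr
      _ = (cN i * (1 + κ) ^ N) * t ^ N * w i := by rw [mul_pow]; ring
      _ ≤ C * t ^ N * w i := by
          have h1 := hCi i
          have h2 : 0 ≤ cB i * (1 + κ) ^ (N + M * (r * N + 1 + N)) := by
            have := hcB0 i
            positivity
          have h3 : 0 ≤ |cK i| * 2 ^ N := by positivity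
          have := hw0 i
          gcongr
          linarith
  have hprodW : ∏ i, ‖W i (τ i) (x i)‖ ≤ C ^ r * t ^ (r * N) * ∏ i, w i := by
    refine (Finset.prod_le_prod (fun _ _ => norm_nonneg _) fun i _ => hWN i).trans_eq ?_
    rw [Finset.prod_mul_distrib, Finset.prod_const, Finset.card_univ, Fintype.card_fin, mul_pow,
      ← pow_mul, mul_comm N r]
  have hp1 : ∀ i, 1 ≤ (1 + ‖p i‖) ^ (M * (r * N + 1)) := fun i =>
    one_le_pow₀ (by linarith [norm_nonneg (p i)])
  have hprodp : 1 ≤ ∏ i, (1 + ‖p i‖) ^ (M * (r * N + 1)) :=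
    Finset.one_le_prod fun i _ => hp1 i
  have hw' : 0 ≤ ∏ i, w i := Finset.prod_nonneg fun i _ => hw0 i
  -- Once a packet is small, everything is small.
  have hsmall : ∀ i, ‖W i (τ i) (x i)‖ ≤ C * (t ^ (r * N + 1))⁻¹ * w i →
      (∏ i, ‖W i (τ i) (x i)‖) * Δ ≤ C ^ r * (2 * B ^ r + C₁) * t⁻¹ *
        ((∏ i, w i) * ∏ i, (1 + ‖p i‖) ^ (M * (r * N + 1))) := by
    intro i hi
    have h1 := prod_le_of_single_le (fun i => norm_nonneg (W i (τ i) (x i))) hw0 hC0 ht1 hWN i hi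
    calc (∏ i, ‖W i (τ i) (x i)‖) * Δ ≤ (C ^ r * t⁻¹ * ∏ i, w i) * (2 * B ^ r + C₁) := by
          refine mul_le_mul h1 (by linarith) (norm_nonneg _) (by positivity)
      _ = C ^ r * (2 * B ^ r + C₁) * t⁻¹ * ((∏ i, w i) * 1) := by ring
      _ ≤ _ := by gcongr
  -- A large smearing argument: powers of `t = s ^ M` are bounded by powers of `p i`.
  by_cases hA1 : ∃ i, s < ‖p i‖
  · obtain ⟨i, hi⟩ := hA1
    have h1 : t ^ (r * N + 1) ≤ ∏ i, (1 + ‖p i‖) ^ (M * (r * N + 1)) := by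
      rw [← Finset.mul_prod_erase _ _ (Finset.mem_univ i), ht, ← pow_mul]
      refine (pow_le_pow_left₀ (by linarith) (by linarith : s ≤ 1 + ‖p i‖) _).trans
        (le_mul_of_one_le_right (by positivity) (Finset.one_le_prod fun i _ => hp1 i))
    calc (∏ i, ‖W i (τ i) (x i)‖) * Δ
        ≤ (C ^ r * t ^ (r * N) * ∏ i, w i) * (2 * B ^ r + C₁) :=
          mul_le_mul hprodW (by linarith) (norm_nonneg _) (by positivity)
      _ = C ^ r * (2 * B ^ r + C₁) * t⁻¹ * ((∏ i, w i) * t ^ (r * N + 1)) := by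
          rw [pow_succ]
          field_simp
      _ ≤ _ := by gcongr
  push Not at hA1
  -- A position beyond `s t`, which is reached only with velocities of order `s`: a high power of `s`,
  -- and so of `t`, is gained from the decrease of the packet.
  by_cases hB1 : ∃ i, s ^ (M + 1) < ‖x i‖
  · obtain ⟨i, hi⟩ := hB1
    refine hsmall i ?_
    have hc := hcB0 i
    have h1 : s ^ (M * (r * N + 1 + N)) * t ^ (M * (r * N + 1 + N)) ≤
        (1 + ‖x i‖) ^ (M * (r * N + 1 + N)) := by
      rw [← mul_pow, mul_comm s, ht, ← pow_succ]
      exact pow_le_pow_left₀ (by positivity) (by linarith) _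
    rw [pow_mul, ← ht] at h1
    calc ‖W i (τ i) (x i)‖
        ≤ cB i * (1 + |τ i|) ^ (N + M * (r * N + 1 + N)) *
            ((1 + ‖x i‖) ^ (N + M * (r * N + 1 + N)))⁻¹ := hcB i _ _
      _ = cB i * (1 + |τ i|) ^ (N + M * (r * N + 1 + N)) *
            (((1 + ‖x i‖) ^ (M * (r * N + 1 + N)))⁻¹ * w i) := by
          rw [pow_add (1 + ‖x i‖), mul_inv, mul_comm ((1 + ‖x i‖) ^ N)⁻¹]
      _ ≤ cB i * ((1 + κ) * t) ^ (N + M * (r * N + 1 + N)) *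
            ((t ^ (r * N + 1 + N) * t ^ (M * (r * N + 1 + N)))⁻¹ * w i) := by
          have := hτt i
          have := hw0 i
          gcongr
      _ = cB i * (1 + κ) ^ (N + M * (r * N + 1 + N)) * (t ^ (r * N + 1))⁻¹ * w i := by
          rw [mul_pow, pow_add t N, pow_add t (r * N + 1) N]
          field_simp
      _ ≤ C * (t ^ (r * N + 1))⁻¹ * w i := by
          have h1 := hCi i
          have h2 : 0 ≤ cN i * (1 + κ) ^ N := by
            have := hcN0 i
            positivity
          have h3 : 0 ≤ |cK i| * 2 ^ N := by positivity
          have := hw0 i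
          gcongr
          linarith
  push Not at hB1
  -- A velocity outside the essential support: the packet is in its tail.
  by_cases hC2 : ∃ i, (τ i)⁻¹ • x i ∉ K i
  · obtain ⟨i, hi⟩ := hC2
    refine hsmall i ?_
    have hτ0 : τ i ≠ 0 := abs_pos.1 (ht0.trans_le (hτ i))
    have h1 : (1 + ‖x i‖) / 2 ≤ 1 + ‖x i‖ ^ 2 + τ i ^ 2 := by
      nlinarith [sq_nonneg (‖x i‖ - 1 / 2), sq_nonneg (τ i), norm_nonneg (x i)]
    have h2 : t ≤ 1 + ‖x i‖ ^ 2 + τ i ^ 2 := by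
      have := hτ i
      rw [← sq_abs (τ i)]
      nlinarith [sq_nonneg ‖x i‖]
    calc ‖W i (τ i) (x i)‖ ≤ cK i * ((1 + ‖x i‖ ^ 2 + τ i ^ 2) ^ (N + (r * N + 1)))⁻¹ :=
          hcK i _ _ hτ0 hi
      _ ≤ |cK i| * ((1 + ‖x i‖ ^ 2 + τ i ^ 2) ^ (N + (r * N + 1)))⁻¹ :=
          mul_le_mul_of_nonneg_right (le_abs_self _) (by positivity)
      _ ≤ |cK i| * (((1 + ‖x i‖) / 2) ^ N * t ^ (r * N + 1))⁻¹ := by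
          rw [pow_add]
          gcongr
      _ = |cK i| * 2 ^ N * (t ^ (r * N + 1))⁻¹ * w i := by
          rw [hw, div_pow]
          field_simp
      _ ≤ C * (t ^ (r * N + 1))⁻¹ * w i := by
          have h1 := hCi i
          have h2 : 0 ≤ cN i * (1 + κ) ^ N := by
            have := hcN0 i
            positivity
          have h3 : 0 ≤ cB i * (1 + κ) ^ (N + M * (r * N + 1 + N)) := by
            have := hcB0 i
            positivity
          have := hw0 i
          gcongr
          linarith
  push Not at hC2
  -- All velocities lie in the separated sets `K i`, and the order of the operators is immaterial.
  have hΔ3 := hD s hs τ x p l hτ hsign hC2 hB1 hA1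
  calc (∏ i, ‖W i (τ i) (x i)‖) * Δ
      ≤ (C ^ r * t ^ (r * N) * ∏ i, w i) * (C₁ * (t / t ^ (r * N + 2))) :=
        mul_le_mul hprodW hΔ3 (norm_nonneg _) (by positivity)
    _ = C ^ r * C₁ * t⁻¹ * ((∏ i, w i) * 1) := by
        rw [pow_add]
        field_simp
    _ ≤ C ^ r * (2 * B ^ r + C₁) * t⁻¹ *
          ((∏ i, w i) * ∏ i, (1 + ‖p i‖) ^ (M * (r * N + 1))) := by
        have : C₁ ≤ 2 * B ^ r + C₁ := by
          have : 0 ≤ B ^ r := by positivity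
          linarith
        gcongr

end Reorder

end AQFT

namespace AQFT

/-! ### Asymptotic times -/

section Times

variable {r a : ℕ} {κ : ℝ}

theorem tendsto_abs_asymptoticTimes (i : Fin r) :
    Tendsto (fun τ : Fin r → ℝ => |τ i|) (asymptoticTimes r a κ) atTop := by
  have h : Tendsto (fun τ : Fin r → ℝ => τ i) (asymptoticTimes r a κ)
      (if i.val < a then atBot else atTop) :=
    (tendsto_eval_pi (fun i : Fin r => if i.val < a then (atBot : Filter ℝ) else atTop) i).mono_left
      inf_le_left
  split_ifs at h
  · exact tendsto_abs_atBot_atTop.comp h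
  · exact tendsto_abs_atTop_atTop.comp h

theorem eventually_sign_asymptoticTimes :
    ∀ᶠ τ in asymptoticTimes r a κ, ∀ i, if i.val < a then τ i < 0 else 0 < τ i := by
  refine eventually_all.2 fun i => ?_
  have h : Tendsto (fun τ : Fin r → ℝ => τ i) (asymptoticTimes r a κ)
      (if i.val < a then atBot else atTop) :=
    (tendsto_eval_pi (fun i : Fin r => if i.val < a then (atBot : Filter ℝ) else atTop) i).mono_left
      inf_le_left
  split_ifs at h ⊢
  · exact h.eventually (eventually_lt_atBot 0)
  · exact h.eventually (eventually_gt_atTop 0)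

theorem eventually_ratio_asymptoticTimes :
    ∀ᶠ τ in asymptoticTimes r a κ, ∀ i j, |τ i| ≤ κ * |τ j| :=
  mem_inf_of_right (mem_principal_self _)

end Times

/-! ### Green functions of smeared operators at large times -/

section Packets

variable {d m r a : ℕ}

theorem IsTest.exists_bound {f : Space d → Fin m → ℂ} (hf : IsTest f) (N : ℕ) :
    ∃ M : ℝ, 0 ≤ M ∧ ∀ n ≤ N, ∀ k, ‖iteratedFDeriv ℝ n f k‖ ≤ M := by
  choose b hb using fun n : ℕ => (hf.1.continuous_iteratedFDeriv (m := n)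
    (mod_cast le_top)).bounded_above_of_compact_support (hf.2.iteratedFDeriv n)
  exact ⟨∑ n ∈ Finset.range (N + 1), |b n|, Finset.sum_nonneg fun _ _ => abs_nonneg _,
    fun n hn k => (hb n k).trans ((le_abs_self _).trans
      (Finset.single_le_sum (f := fun n => |b n|) (fun _ _ => abs_nonneg _)
        (Finset.mem_range_succ_iff.2 hn)))⟩

theorem norm_iteratedFDeriv_apply_le {f : Space d → Fin m → ℂ}
    (hf : ContDiff ℝ ((⊤ : ℕ∞) : WithTop ℕ∞) f) (j : Fin m) (n : ℕ) (k : Space d) :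
    ‖iteratedFDeriv ℝ n (fun k => f k j) k‖ ≤ ‖iteratedFDeriv ℝ n f k‖ := by
  have h := (ContinuousLinearMap.proj (R := ℝ) (φ := fun _ : Fin m => ℂ) j).norm_iteratedFDeriv_comp_left
    (f := f) (x := k) (hf.contDiffAt) (n := n) (mod_cast le_top)
  refine h.trans (mul_le_of_le_one_left (norm_nonneg _) ?_)
  exact ContinuousLinearMap.opNorm_le_bound _ zero_le_one fun v => by
    simpa using norm_le_pi_norm v j

theorem tsupport_apply_subset {f : Space d → Fin m → ℂ} (j : Fin m) :
    tsupport (fun k => f k j) ⊆ tsupport f :=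
  closure_mono fun k hk => by
    contrapose! hk
    simp only [Function.mem_support, not_not] at hk ⊢
    rw [hk, Pi.zero_apply]

theorem exists_norm_packet_le (D : Dispersion d m) (a : ℕ) (i : Fin r) {L : Set (Space d)}
    (hL : IsCompact L) (N : ℕ) : ∃ c : ℝ, 0 ≤ c ∧ ∀ (f : Space d → Fin m → ℂ) (M : ℝ),
      IsTest f → tsupport f ⊆ L → (∀ n ≤ N, ∀ k, ‖iteratedFDeriv ℝ n f k‖ ≤ M) →
      ∀ (μ ν j : Fin m) (τ : ℝ) (x : Space d),
        ‖packet D a i f μ ν τ x j‖ ≤ c * M * (1 + |τ|) ^ N * ((1 + ‖x‖) ^ N)⁻¹ := by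
  obtain ⟨c, hc, h⟩ := exists_norm_wave_le D a i hL N
  exact ⟨c, hc, fun f M hf hs hM μ ν j τ x => h _ M (hf.contDiff_apply j)
    ((tsupport_apply_subset j).trans hs)
    (fun n hn k => (norm_iteratedFDeriv_apply_le hf.1 j n k).trans (hM n hn k)) μ ν τ x⟩

theorem IsTest.exists_norm_packet_le {f : Space d → Fin m → ℂ} (hf : IsTest f)
    (D : Dispersion d m) (a : ℕ) (i : Fin r) (N : ℕ) : ∃ c : ℝ, 0 ≤ c ∧
      ∀ (μ ν j : Fin m) (τ : ℝ) (x : Space d),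
        ‖packet D a i f μ ν τ x j‖ ≤ c * (1 + |τ|) ^ N * ((1 + ‖x‖) ^ N)⁻¹ := by
  obtain ⟨c, hc, h⟩ := AQFT.exists_norm_packet_le D a i hf.2.isCompact N
  obtain ⟨M, hM0, hM⟩ := hf.exists_bound N
  exact ⟨c * M, by positivity, h f M hf le_rfl hM⟩

theorem IsTest.continuous_packet {f : Space d → Fin m → ℂ} (hf : IsTest f) (D : Dispersion d m)
    (a : ℕ) (i : Fin r) (μ ν j : Fin m) (τ : ℝ) :
    Continuous fun x => packet D a i f μ ν τ x j :=
  continuous_wave D a i (hf.contDiff_apply j).continuous (hf.hasCompactSupport_apply j) μ ν τ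

theorem IsTest.integrable_packet {f : Space d → Fin m → ℂ} (hf : IsTest f) (D : Dispersion d m)
    (a : ℕ) (i : Fin r) (μ ν j : Fin m) (τ : ℝ) :
    Integrable fun x => packet D a i f μ ν τ x j := by
  obtain ⟨c, -, hc⟩ := hf.exists_norm_packet_le D a i (d + 1)
  exact (integrable_inv_one_add_norm_pow.const_mul (c * (1 + |τ|) ^ (d + 1))).mono'
    (hf.continuous_packet D a i μ ν j τ).aestronglyMeasurable (.of_forall fun x => hc μ ν j τ x)

theorem integrable_prod_packet {f : Fin r → Space d → Fin m → ℂ} (hf : ∀ i, IsTest (f i))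
    (D : Dispersion d m) (a : ℕ) (μ ν j : Fin r → Fin m) (τ : Fin r → ℝ) :
    Integrable fun x : Fin r → Space d =>
      ∏ i, packet D a i (f i) (μ i) (ν i) (τ i) (x i) (j i) :=
  Integrable.fintype_prod (f := fun i x => packet D a i (f i) (μ i) (ν i) (τ i) x (j i)) fun i =>
    (hf i).integrable_packet D a i (μ i) (ν i) (j i) (τ i)

theorem integrable_schwartz_mul_one_add_pow (α : 𝓢(ℝ × Space d, ℂ)) (P : ℕ) :
    Integrable fun p : ℝ × Space d => ‖α p‖ * (1 + ‖p‖) ^ P := by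
  have : (volume : Measure (ℝ × Space d)).IsAddHaarMeasure := by
    rw [Measure.volume_eq_prod]
    infer_instance
  have h := ((α.integrable_pow_mul volume 0).add (α.integrable_pow_mul volume P)).const_mul (2 ^ P)
  have hc := α.continuous
  refine h.mono' (Continuous.aestronglyMeasurable (by fun_prop)) (.of_forall fun p => ?_)
  rw [Real.norm_of_nonneg (by positivity)]
  have h1 := mul_le_mul_of_nonneg_left (one_add_pow_le P (norm_nonneg p)) (norm_nonneg (α p))
  refine h1.trans_eq ?_
  simp only [Pi.add_apply, pow_zero]
  ring

end Packets

section Smeared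

variable {d m r a : ℕ} {𝒜 : Type*} [Ring 𝒜] [StarRing 𝒜] [Algebra ℂ 𝒜] [StarModule ℂ 𝒜]
  {S : TranslationInvariantState d 𝒜} {D : Dispersion d m} {A A' : Fin m → 𝒜}
  {α : Fin m → Fin m → 𝓢(ℝ × Space d, ℂ)} {B : ℝ}

/-- The integrand in the Green function of smeared operators: `x` are the arguments of the wave
packets, `p` those of the smearing functions, and `θ` are the times that determine the order. -/
noncomputable def smearedIntegrand (S : TranslationInvariantState d 𝒜) (D : Dispersion d m)
    (A : Fin m → 𝒜) (α : Fin m → Fin m → 𝓢(ℝ × Space d, ℂ)) (a : ℕ)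
    (f : Fin r → Space d → Fin m → ℂ) (μ ν : Fin r → Fin m) (τ : Fin r → ℝ)
    (θ : (Fin r → ℝ × Space d) → Fin r → ℝ) (j l : Fin r → Fin m)
    (z : (Fin r → Space d) × (Fin r → ℝ × Space d)) : ℂ :=
  ((∏ i, packet D a i (f i) (μ i) (ν i) (τ i) (z.1 i) (j i)) *
    ∏ i, legConj a i (α (j i) (l i) (z.2 i))) *
    S.ω (chronological (θ z.2) fun i => S.trans ((τ i, z.1 i) + z.2 i) (legOp a i (A (l i))))

theorem integrable_smearedIntegrand (hB : 0 ≤ B) (hA : ∀ i, OpNormLE S (A i) B)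
    {f : Fin r → Space d → Fin m → ℂ} (hf : ∀ i, IsTest (f i)) (μ ν : Fin r → Fin m)
    (τ : Fin r → ℝ) {θ : (Fin r → ℝ × Space d) → Fin r → ℝ} (hθ : Measurable θ)
    (j l : Fin r → Fin m) :
    Integrable (smearedIntegrand S D A α a f μ ν τ θ j l) (volume.prod volume) := by
  refine ((integrable_prod_packet hf D a μ ν j τ).mul_prod
    (integrable_prod_schwartz (a := a) fun i => α (j i) (l i))).mul_bdd (c := B ^ r) ?_
      (.of_forall fun z => norm_ω_chronological_le hB
        (fun i => (opNormLE_legOp (hA _) i).trans _) _)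
  refine (measurable_ω_chronological hA
    (q := fun (z : (Fin r → Space d) × (Fin r → ℝ × Space d)) i => (τ i, z.1 i) + z.2 i)
    (fun i => ?_) (hθ.comp measurable_snd) l).aestronglyMeasurable
  fun_prop

theorem smearedGreen_smearing (hA' : IsSmearing S α A A') (hB : 0 ≤ B)
    (hA : ∀ i, OpNormLE S (A i) B) {f : Fin r → Space d → Fin m → ℂ} (hf : ∀ i, IsTest (f i))
    (μ ν : Fin r → Fin m) (τ : Fin r → ℝ) : smearedGreen S D A' a f μ ν τ =
      ∑ j : Fin r → Fin m, ∑ l : Fin r → Fin m,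
        ∫ z, smearedIntegrand S D A α a f μ ν τ (fun _ => τ) j l z ∂(volume.prod volume) := by
  refine Finset.sum_congr rfl fun j _ => ?_
  have hI := fun l => integrable_smearedIntegrand (D := D) (α := α) (a := a) hB hA hf μ ν τ
    (θ := fun _ => τ) measurable_const j l
  simp only [integral_prod _ (hI _)]
  rw [← integral_finsetSum _ fun l _ => (hI l).integral_prod_left]
  refine integral_congr_ae (.of_forall fun x => ?_)
  simp only [green_smearing hA' hA hB, Finset.mul_sum]
  refine Finset.sum_congr rfl fun l _ => ?_
  rw [← integral_const_mul]
  exact congrArg _ (funext fun p => by simp only [smearedIntegrand]; ring)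

/-- The chronological order may be taken with respect to the shifted times: the pointwise estimate of
the reordering holds with an integrable majorant and a factor that tends to zero. -/
theorem tendsto_integral_smearedIntegrand_sub (hcomm : AsymptoticallyCommute S A) (hB : 1 ≤ B)
    (hA : ∀ i, OpNormLE S (A i) B) {f : Fin r → Space d → Fin m → ℂ} (hf : ∀ i, IsTest (f i))
    (hno : NonOverlapping D a f) (μ ν : Fin r → Fin m) (κ : ℝ) (j l : Fin r → Fin m) :
    Tendsto (fun τ =>
      (∫ z, smearedIntegrand S D A α a f μ ν τ (fun _ => τ) j l z ∂(volume.prod volume)) -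
        ∫ z, smearedIntegrand S D A α a f μ ν τ (fun p i => τ i + (p i).1) j l z
          ∂(volume.prod volume)) (asymptoticTimes r a κ) (𝓝 0) := by
  rcases Nat.eq_zero_or_pos r with rfl | hr
  · have e : ∀ τ : Fin 0 → ℝ, (fun (p : Fin 0 → ℝ × Space d) i => τ i + (p i).1) = fun _ => τ :=
      fun τ => funext fun p => Subsingleton.elim _ _
    simp only [e, sub_self]
    exact tendsto_const_nhds
  obtain ⟨K, hKf, hK⟩ := hno
  obtain ⟨δ, hδ, hK⟩ := exists_uniform_separation hK
  set i₀ : Fin r := ⟨0, hr⟩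
  set κ' : ℝ := max κ 1 with hκ'
  have hκ1 : 1 ≤ κ' := le_max_right _ _
  obtain ⟨M, P, C, s₀, hM, hC, hs₀, hbound⟩ := exists_pointwise_reorder_le (r := r) (a := a) hcomm
    hB hA hδ hK (W := fun i τ x => packet D a i (f i) (μ i) (ν i) τ x (j i))
    (fun i N => by
      obtain ⟨c, hc0, hc⟩ := (hf i).exists_norm_packet_le D a i N
      exact ⟨c, hc0, fun τ x => hc _ _ _ τ x⟩)
    (fun i n => by
      obtain ⟨c, hc⟩ := hKf i n
      exact ⟨c, fun τ x h1 h2 => hc _ _ _ τ x h1 h2⟩) (κ := κ' * κ') (by positivity)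
  set b : (Fin r → Space d) × (Fin r → ℝ × Space d) → ℝ := fun z =>
    (∏ i, ((1 + ‖z.1 i‖) ^ (d + 1))⁻¹) *
      ∏ i, (‖α (j i) (l i) (z.2 i)‖ * (1 + ‖z.2 i‖) ^ P) with hb
  have hbi : Integrable b (volume.prod volume) :=
    Integrable.mul_prod (Integrable.fintype_prod
      (f := fun (_ : Fin r) (x : Space d) => ((1 + ‖x‖) ^ (d + 1))⁻¹)
        fun _ => integrable_inv_one_add_norm_pow)
      (Integrable.fintype_prod (f := fun i p => ‖α (j i) (l i) p‖ * (1 + ‖p‖) ^ P)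
        fun i => integrable_schwartz_mul_one_add_pow _ P)
  set I : ℝ := ∫ z, b z ∂(volume.prod volume) with hI
  refine squeeze_zero_norm' (a := fun τ : Fin r → ℝ => C * (|τ i₀| / κ')⁻¹ * I) ?_ ?_
  · have hlarge : ∀ᶠ τ in asymptoticTimes r a κ, s₀ ^ M * κ' ≤ |τ i₀| :=
      (tendsto_abs_asymptoticTimes i₀).eventually_ge_atTop _
    filter_upwards [eventually_sign_asymptoticTimes, eventually_ratio_asymptoticTimes, hlarge]
      with τ hsign hratio hlarge
    have hκ0 : 0 < κ' := by linarith
    set t : ℝ := |τ i₀| / κ' with ht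
    have hts : s₀ ^ M ≤ t := (le_div_iff₀ hκ0).2 hlarge
    have ht0 : 0 ≤ t := by positivity
    -- All times are comparable with `t`, the time scale `s ^ M` of the pointwise estimate.
    set s : ℝ := t ^ (M : ℝ)⁻¹ with hs
    have hsM : s ^ M = t := Real.rpow_inv_natCast_pow ht0 hM.ne'
    have hss : s₀ ≤ s := le_of_pow_le_pow_left₀ hM.ne' (by positivity) (by rwa [hsM])
    have h1 : ∀ i, s ^ M ≤ |τ i| := fun i => by
      rw [hsM, ht, div_le_iff₀ hκ0, mul_comm]
      exact (hratio i₀ i).trans (mul_le_mul_of_nonneg_right (le_max_left _ _) (abs_nonneg _))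
    have h2 : ∀ i, |τ i| ≤ κ' * κ' * s ^ M := fun i => by
      have e : κ' * κ' * s ^ M = κ' * |τ i₀| := by
        rw [hsM, ht]
        field_simp
      rw [e]
      exact (hratio i i₀).trans (mul_le_mul_of_nonneg_right (le_max_left _ _) (abs_nonneg _))
    have hB0 : 0 ≤ B := by linarith
    rw [← integral_sub (integrable_smearedIntegrand hB0 hA hf μ ν τ measurable_const j l)
      (integrable_smearedIntegrand hB0 hA hf μ ν τ (by fun_prop) j l)]
    have h3 := norm_integral_le_of_norm_le (hbi.const_mul (C * t⁻¹)) (f := fun z =>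
      smearedIntegrand S D A α a f μ ν τ (fun _ => τ) j l z -
        smearedIntegrand S D A α a f μ ν τ (fun p i => τ i + (p i).1) j l z)
      (.of_forall fun z => ?_)
    · rwa [integral_const_mul] at h3
    · have h4 := hbound s hss τ z.1 z.2 l h1 h2 hsign
      rw [hsM] at h4
      simp only [smearedIntegrand]
      rw [← mul_sub, norm_mul, norm_mul, norm_prod, norm_prod]
      simp only [norm_legConj, hb, Finset.prod_mul_distrib]
      have h5 : 0 ≤ ∏ i, ‖α (j i) (l i) (z.2 i)‖ := Finset.prod_nonneg fun _ _ => norm_nonneg _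
      calc _ = (∏ i, ‖α (j i) (l i) (z.2 i)‖) * _ := by
            rw [mul_comm (∏ i, ‖packet D a i (f i) (μ i) (ν i) (τ i) (z.1 i) (j i)‖), mul_assoc]
        _ ≤ _ := mul_le_mul_of_nonneg_left h4 h5
        _ = _ := by ring
  · have h1 : Tendsto (fun τ : Fin r → ℝ => |τ i₀| / κ') (asymptoticTimes r a κ) atTop :=
      (tendsto_abs_asymptoticTimes i₀).atTop_div_const (by linarith)
    simpa using (h1.inv_tendsto_atTop.const_mul C).mul_const I

/-- At large times the chronological product of the smeared operators may be taken at the times of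
the original operators. -/
theorem tendsto_smearedGreen_sub (hA' : IsSmearing S α A A') (hcomm : AsymptoticallyCommute S A)
    (hB : 1 ≤ B) (hA : ∀ i, OpNormLE S (A i) B) {f : Fin r → Space d → Fin m → ℂ}
    (hf : ∀ i, IsTest (f i)) (hno : NonOverlapping D a f) (μ ν : Fin r → Fin m) (κ : ℝ) :
    Tendsto (fun τ => smearedGreen S D A' a f μ ν τ -
      ∑ j : Fin r → Fin m, ∑ l : Fin r → Fin m,
        ∫ z, smearedIntegrand S D A α a f μ ν τ (fun p i => τ i + (p i).1) j l z
          ∂(volume.prod volume)) (asymptoticTimes r a κ) (𝓝 0) := by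
  simp only [smearedGreen_smearing hA' (by linarith : 0 ≤ B) hA hf, ← Finset.sum_sub_distrib]
  have h := tendsto_finsetSum Finset.univ fun j (_ : j ∈ Finset.univ) =>
    tendsto_finsetSum Finset.univ fun l (_ : l ∈ Finset.univ) =>
      tendsto_integral_smearedIntegrand_sub (α := α) hcomm hB hA hf hno μ ν κ j l
  simpa using h

end Smeared

end AQFT

namespace AQFT

/-! ### Absorbing the smearing functions into the wave packets -/

section Absorb

variable {d m r a : ℕ}

theorem integrable_schwartz_slice (α : 𝓢(ℝ × Space d, ℂ)) (σ : ℝ) :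
    Integrable fun y : Space d => α (σ, y) := by
  obtain ⟨c, hc⟩ := norm_iteratedFDeriv_partialFourier_integrand_le α 0 0
  have h := α.continuous
  refine (integrable_inv_one_add_norm_pow.const_mul c).mono'
    (Continuous.aestronglyMeasurable (by fun_prop)) (.of_forall fun y => ?_)
  simpa [norm_planeWave] using hc y (σ, 0)

/-- The smearing matrix at a fixed time `σ`, with the time translation by `σ` that compensates the
shift of the wave packet from the time `τ` to `τ + σ`. -/
noncomputable def symbolSlice (D : Dispersion d m) (α : Fin m → Fin m → 𝓢(ℝ × Space d, ℂ))
    (ν lam : Fin m) (σ : ℝ) (k : Space d) : Matrix (Fin m) (Fin m) ℂ :=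
  Matrix.of fun j l => partialFourier (α j l) (σ, k) * expI (-σ) (D.E k) lam ν

theorem rapid_symbolSlice (D : Dispersion d m) (α : Fin m → Fin m → 𝓢(ℝ × Space d, ℂ))
    (ν lam j l : Fin m) :
    Rapid fun p : ℝ × Space d => symbolSlice D α ν lam p.1 p.2 j l :=
  (rapid_partialFourier (α j l)).mul_moderate (moderate_expI D lam ν).comp_neg

theorem contDiff_symbolSlice (D : Dispersion d m) (α : Fin m → Fin m → 𝓢(ℝ × Space d, ℂ))
    (ν lam : Fin m) (σ : ℝ) (j l : Fin m) :
    ContDiff ℝ ((⊤ : ℕ∞) : WithTop ℕ∞) fun k => symbolSlice D α ν lam σ k j l :=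
  (rapid_symbolSlice D α ν lam j l).1.comp (contDiff_const.prodMk contDiff_id)

/-- The test function of a leg, smeared at the fixed time `σ`. -/
noncomputable def smearedTest (D : Dispersion d m) (α : Fin m → Fin m → 𝓢(ℝ × Space d, ℂ)) (a : ℕ)
    (i : Fin r) (ν lam : Fin m) (f : Space d → Fin m → ℂ) (σ : ℝ) : Space d → Fin m → ℂ :=
  fun k => Matrix.vecMul (f k) (legMat a i (symbolSlice D α ν lam σ k))

theorem isTest_smearedTest (D : Dispersion d m) (α : Fin m → Fin m → 𝓢(ℝ × Space d, ℂ)) (a : ℕ)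
    (i : Fin r) (ν lam : Fin m) {f : Space d → Fin m → ℂ} (hf : IsTest f) (σ : ℝ) :
    IsTest (smearedTest D α a i ν lam f σ) :=
  isTest_vecMul hf fun j l => contDiff_legConj (contDiff_symbolSlice D α ν lam σ j l)

/-- Smearing a wave packet over space and translating it in time. -/
theorem integral_wave_sub_mul (D : Dispersion d m) (a : ℕ) (i : Fin r) {φ : Space d → ℂ}
    (hφ : Continuous φ) (hc : HasCompactSupport φ) (α : 𝓢(ℝ × Space d, ℂ)) (μ ν : Fin m)
    (τ σ : ℝ) (x : Space d) :
    ∫ y, wave D a i φ μ ν τ (x - y) * legConj a i (α (σ, y)) =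
      ∑ lam, wave D a i (fun k => φ k *
        legConj a i (partialFourier α (σ, k) * expI (-σ) (D.E k) lam ν)) μ lam (τ + σ) x := by
  have hα : Integrable fun y => legConj a i (α (σ, y)) :=
    (integrable_schwartz_slice α σ).mono
      ((continuous_legConj a i).comp_aestronglyMeasurable
        (integrable_schwartz_slice α σ).aestronglyMeasurable)
      (.of_forall fun y => (norm_legConj a i _).le)
  have hp : Continuous fun q : Space d × Space d => legConj a i (planeWave q.1 q.2) :=
    (continuous_legConj a i).comp continuous_planeWave
  have hF := integrable_mul_mul_phase (p := fun k y => legConj a i (planeWave k y))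
    (integrable_wave_integrand D a i hφ hc μ ν τ x) hα hp.aestronglyMeasurable
    fun q => by rw [norm_legConj, norm_planeWave]
  have e1 : ∀ y, wave D a i φ μ ν τ (x - y) * legConj a i (α (σ, y)) =
      (((2 * Real.pi) ^ d : ℝ) : ℂ)⁻¹ * ∫ k, φ k * legConj a i (expI τ (D.E k) μ ν *
        planeWave k (-x)) * (legConj a i (α (σ, y)) * legConj a i (planeWave k y)) := by
    intro y
    rw [wave, mul_assoc, ← integral_mul_const]
    congr 1
    refine integral_congr_ae (.of_forall fun k => ?_)
    simp only [legConj_mul]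
    rw [show -(x - y) = -x + y by abel, planeWave_add, legConj_mul]
    ring
  simp only [e1]
  rw [integral_const_mul, ← integral_integral_swap hF]
  have e2 : ∀ k, ∫ y, φ k * legConj a i (expI τ (D.E k) μ ν * planeWave k (-x)) *
      (legConj a i (α (σ, y)) * legConj a i (planeWave k y)) =
      ∑ lam, (φ k * legConj a i (partialFourier α (σ, k) * expI (-σ) (D.E k) lam ν)) *
        legConj a i (expI (τ + σ) (D.E k) μ lam * planeWave k (-x)) := by
    intro k
    -- Shift the time of the packet from `τ` to `τ + σ`.
    have h1 : expI τ (D.E k) μ ν =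
        ∑ lam, expI (τ + σ) (D.E k) μ lam * expI (-σ) (D.E k) lam ν := by
      rw [← Matrix.mul_apply, ← expI_add, add_neg_cancel_right]
    rw [integral_const_mul]
    simp only [← legConj_mul, ← legConj_integral]
    rw [h1, show ∫ y, α (σ, y) * planeWave k y = partialFourier α (σ, k) from rfl,
      Finset.sum_mul, legConj_sum, Finset.mul_sum, Finset.sum_mul]
    refine Finset.sum_congr rfl fun lam _ => ?_
    simp only [legConj_mul]
    ring
  simp only [e2]
  rw [integral_finsetSum, Finset.mul_sum]
  · rfl
  · intro lam _
    refine integrable_wave_integrand D a i (hφ.mul ?_) hc.mul_right μ lam (τ + σ) x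
    exact (contDiff_legConj (((rapid_partialFourier α).mul_moderate
      (moderate_expI D lam ν).comp_neg).1.comp
        (contDiff_const.prodMk contDiff_id))).continuous

theorem sum_integral_packet_sub_mul (D : Dispersion d m) (a : ℕ) (i : Fin r)
    {f : Space d → Fin m → ℂ} (hf : IsTest f) (α : Fin m → Fin m → 𝓢(ℝ × Space d, ℂ))
    (μ ν l : Fin m) (τ σ : ℝ) (x : Space d) :
    ∑ j, ∫ y, packet D a i f μ ν τ (x - y) j * legConj a i (α j l (σ, y)) =
      ∑ lam, packet D a i (smearedTest D α a i ν lam f σ) μ lam (τ + σ) x l := by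
  simp only [packet_eq_wave]
  have h1 : ∀ j, ∫ y, wave D a i (fun k => f k j) μ ν τ (x - y) * legConj a i (α j l (σ, y)) = _ :=
    fun j => integral_wave_sub_mul D a i (hf.contDiff_apply j).continuous
      (hf.hasCompactSupport_apply j) (α j l) μ ν τ σ x
  simp only [h1]
  rw [Finset.sum_comm]
  refine Finset.sum_congr rfl fun lam _ => ?_
  exact (wave_sum D a i Finset.univ (φ := fun j k => f k j * legConj a i
    (partialFourier (α j l) (σ, k) * expI (-σ) (D.E k) lam ν))
    (fun j => (hf.contDiff_apply j).continuous.mul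
      (contDiff_legConj (contDiff_symbolSlice D α ν lam σ j l)).continuous)
    (fun j => (hf.hasCompactSupport_apply j).mul_right) μ lam (τ + σ) x).symm

end Absorb

section Regroup

/-- Regrouping of the space-time arguments of the smearing functions. -/
noncomputable def regroup (r d : ℕ) : ((Fin r → ℝ) × ((Fin r → Space d) × (Fin r → Space d))) ≃ᵐ
    (Fin r → Space d) × (Fin r → ℝ × Space d) :=
  (MeasurableEquiv.prodAssoc.symm.trans (MeasurableEquiv.prodCongr
    (MeasurableEquiv.arrowProdEquivProdArrow ℝ (Space d) (Fin r)).symm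
    (MeasurableEquiv.refl _))).trans MeasurableEquiv.prodComm

theorem measurePreserving_regroup (r d : ℕ) :
    MeasurePreserving (regroup r d) (volume.prod (volume.prod volume)) (volume.prod volume) := by
  have h1 := (measurePreserving_prodAssoc (volume : Measure (Fin r → ℝ))
    (volume : Measure (Fin r → Space d)) (volume : Measure (Fin r → Space d))).symm
  have h2 := (volume_measurePreserving_arrowProdEquivProdArrow ℝ (Space d) (Fin r)).symm.prod
    (MeasurePreserving.id (volume : Measure (Fin r → Space d)))
  have h3 := Measure.measurePreserving_swap (μ := (volume : Measure (Fin r → ℝ × Space d)))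
    (ν := (volume : Measure (Fin r → Space d)))
  exact h3.comp (h2.comp h1)

end Regroup

section Regrouped

variable {d m r a : ℕ} {𝒜 : Type*} [Ring 𝒜] [StarRing 𝒜] [Algebra ℂ 𝒜] [StarModule ℂ 𝒜]
  {S : TranslationInvariantState d 𝒜} {D : Dispersion d m} {A : Fin m → 𝒜}
  {α : Fin m → Fin m → 𝓢(ℝ × Space d, ℂ)} {B : ℝ}

theorem integrable_regrouped (hB : 0 ≤ B) (hA : ∀ i, OpNormLE S (A i) B)
    {f : Fin r → Space d → Fin m → ℂ} (hf : ∀ i, IsTest (f i)) (μ ν : Fin r → Fin m)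
    (τ σ : Fin r → ℝ) (j l : Fin r → Fin m) :
    Integrable (fun z : (Fin r → Space d) × (Fin r → Space d) =>
      smearedIntegrand S D A α a f μ ν τ (fun p i => τ i + (p i).1) j l
        (z.2, fun i => (σ i, z.1 i))) (volume.prod volume) := by
  have h1 : Integrable fun y : Fin r → Space d => ∏ i, legConj a i (α (j i) (l i) (σ i, y i)) :=
    Integrable.fintype_prod (f := fun i y => legConj a i (α (j i) (l i) (σ i, y))) fun i =>
      (integrable_schwartz_slice (α (j i) (l i)) (σ i)).mono
        ((continuous_legConj a i).comp_aestronglyMeasurable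
          (integrable_schwartz_slice _ _).aestronglyMeasurable)
        (.of_forall fun y => (norm_legConj a i _).le)
  have h2 := (h1.mul_prod (integrable_prod_packet hf D a μ ν j τ)).mul_bdd (c := B ^ r)
    (g := fun z : (Fin r → Space d) × (Fin r → Space d) =>
      S.ω (chronological (fun i => τ i + σ i) fun i =>
        S.trans ((τ i, z.2 i) + (σ i, z.1 i)) (legOp a i (A (l i))))) ?_
      (.of_forall fun z => norm_ω_chronological_le hB
        (fun i => (opNormLE_legOp (hA _) i).trans _) _)
  · refine h2.congr (.of_forall fun z => ?_)
    simp only [smearedIntegrand]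
    ring
  · refine (continuous_ω_chronological hA
      (q := fun (z : (Fin r → Space d) × (Fin r → Space d)) i => (τ i, z.2 i) + (σ i, z.1 i))
      (fun i => ?_) (fun i => τ i + σ i) l).aestronglyMeasurable
    fun_prop

/-- Smearing over space is absorbed in the test functions of all legs. -/
theorem sum_prod_integral_packet_sub_mul {f : Fin r → Space d → Fin m → ℂ}
    (hf : ∀ i, IsTest (f i)) (μ ν : Fin r → Fin m) (τ σ : Fin r → ℝ) (l : Fin r → Fin m)
    (x : Fin r → Space d) :
    ∑ j : Fin r → Fin m, ∫ y : Fin r → Space d, ∏ i, (packet D a i (f i) (μ i) (ν i) (τ i)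
        (x i - y i) (j i) * legConj a i (α (j i) (l i) (σ i, y i))) =
      ∑ lam : Fin r → Fin m, ∏ i, packet D a i (smearedTest D α a i (ν i) (lam i) (f i) (σ i))
        (μ i) (lam i) (τ i + σ i) (x i) (l i) := by
  have h1 : ∀ j : Fin r → Fin m, ∫ y : Fin r → Space d, ∏ i, (packet D a i (f i) (μ i) (ν i) (τ i)
        (x i - y i) (j i) * legConj a i (α (j i) (l i) (σ i, y i))) =
      ∏ i, ∫ y, packet D a i (f i) (μ i) (ν i) (τ i)
        (x i - y) (j i) * legConj a i (α (j i) (l i) (σ i, y)) := fun j =>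
    integral_fintype_prod_volume_eq_prod (fun i y => packet D a i (f i) (μ i) (ν i) (τ i)
        (x i - y) (j i) * legConj a i (α (j i) (l i) (σ i, y)))
  simp only [h1]
  rw [← Fintype.prod_sum (f := fun i j => ∫ y, packet D a i (f i) (μ i) (ν i) (τ i)
      (x i - y) j * legConj a i (α j (l i) (σ i, y))),
    ← Fintype.prod_sum (f := fun i lam => packet D a i
      (smearedTest D α a i (ν i) lam (f i) (σ i)) (μ i) lam (τ i + σ i) (x i) (l i))]
  exact Finset.prod_congr rfl fun i _ =>
    sum_integral_packet_sub_mul D a i (hf i) α (μ i) (ν i) (l i) (τ i) (σ i) (x i)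

/-- At fixed smearing times the Green function of the smeared operators is the Green function of
the original operators, with modified test functions. -/
theorem sum_integral_regrouped (hB : 0 ≤ B) (hA : ∀ i, OpNormLE S (A i) B)
    {f : Fin r → Space d → Fin m → ℂ} (hf : ∀ i, IsTest (f i)) (μ ν : Fin r → Fin m)
    (τ σ : Fin r → ℝ) :
    ∑ j : Fin r → Fin m, ∑ l : Fin r → Fin m, ∫ z : (Fin r → Space d) × (Fin r → Space d),
      smearedIntegrand S D A α a f μ ν τ (fun p i => τ i + (p i).1) j l
        (z.2, fun i => (σ i, z.1 i)) ∂(volume.prod volume) =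
    ∑ lam : Fin r → Fin m, smearedGreen S D A a
      (fun i => smearedTest D α a i (ν i) (lam i) (f i) (σ i)) μ lam fun i => τ i + σ i := by
  -- Shift the position arguments by those of the smearing functions.
  have hsh := measurePreserving_prod_add (volume : Measure (Fin r → Space d))
    (volume : Measure (Fin r → Space d))
  have hemb : MeasurableEmbedding
      fun z : (Fin r → Space d) × (Fin r → Space d) => (z.1, z.1 + z.2) :=
    (MeasurableEquiv.shearAddRight (Fin r → Space d)).measurableEmbedding
  set g : (Fin r → Fin m) → (Fin r → Fin m) → (Fin r → Space d) × (Fin r → Space d) → ℂ :=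
    fun j l z => (∏ i, (packet D a i (f i) (μ i) (ν i) (τ i) (z.2 i - z.1 i) (j i) *
      legConj a i (α (j i) (l i) (σ i, z.1 i)))) *
        green S A a (fun i => τ i + σ i) z.2 l with hg
  have hgs : ∀ j l, (fun z : (Fin r → Space d) × (Fin r → Space d) =>
      smearedIntegrand S D A α a f μ ν τ (fun p i => τ i + (p i).1) j l
        (z.2, fun i => (σ i, z.1 i))) = g j l ∘ fun z => (z.1, z.1 + z.2) := by
    intro j l
    ext z
    simp only [hg, Function.comp, smearedIntegrand, Pi.add_apply, add_sub_cancel_left,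
      Finset.prod_mul_distrib, green]
    simp only [Prod.mk_add_mk, add_comm (z.2 _)]
  have hgi : ∀ j l, Integrable (g j l) (volume.prod volume) := fun j l => by
    rw [← hsh.integrable_comp_emb hemb, ← hgs]
    exact integrable_regrouped hB hA hf μ ν τ σ j l
  have h1 : ∀ j l, ∫ z : (Fin r → Space d) × (Fin r → Space d),
      smearedIntegrand S D A α a f μ ν τ (fun p i => τ i + (p i).1) j l
        (z.2, fun i => (σ i, z.1 i)) ∂(volume.prod volume) =
      ∫ x, ∫ y, g j l (y, x) := fun j l => by
    rw [show ∫ z : (Fin r → Space d) × (Fin r → Space d),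
      smearedIntegrand S D A α a f μ ν τ (fun p i => τ i + (p i).1) j l
        (z.2, fun i => (σ i, z.1 i)) ∂(volume.prod volume) =
        ∫ z : (Fin r → Space d) × (Fin r → Space d), g j l (z.1, z.1 + z.2)
          ∂(volume.prod volume) from congrArg _ (hgs j l), hsh.integral_comp hemb]
    exact integral_prod_symm _ (hgi j l)
  simp only [h1]
  rw [Finset.sum_comm]
  simp only [smearedGreen]
  conv_rhs => rw [Finset.sum_comm]
  refine Finset.sum_congr rfl fun l _ => ?_
  rw [← integral_finsetSum _ fun j _ => (hgi j l).integral_prod_right,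
    ← integral_finsetSum]
  · refine integral_congr_ae (.of_forall fun x => ?_)
    simp only [hg, integral_mul_const]
    rw [← Finset.sum_mul, ← Finset.sum_mul, sum_prod_integral_packet_sub_mul hf]
  · intro lam _
    refine (integrable_prod_packet (fun i => isTest_smearedTest D α a i (ν i) (lam i) (hf i) (σ i))
      D a μ lam l fun i => τ i + σ i).mul_bdd (c := B ^ r) ?_
      (.of_forall fun x => norm_green_le hB hA _ _ _)
    exact (continuous_ω_chronological hA
      (q := fun (x : Fin r → Space d) i => (τ i + σ i, x i))
      (fun i => by fun_prop) (fun i => τ i + σ i) l).aestronglyMeasurable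

/-- With the operators ordered by the shifted times, the Green function of the smeared operators is a
superposition, over the smearing times `σ`, of Green functions of the original operators at the
times `τ + σ`. -/
theorem integral_smearedIntegrand_eq (hB : 0 ≤ B) (hA : ∀ i, OpNormLE S (A i) B)
    {f : Fin r → Space d → Fin m → ℂ} (hf : ∀ i, IsTest (f i)) (μ ν : Fin r → Fin m)
    (τ : Fin r → ℝ) :
    Integrable (fun σ : Fin r → ℝ => ∑ lam : Fin r → Fin m, smearedGreen S D A a
      (fun i => smearedTest D α a i (ν i) (lam i) (f i) (σ i)) μ lam fun i => τ i + σ i) ∧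
    ∑ j : Fin r → Fin m, ∑ l : Fin r → Fin m,
      ∫ z, smearedIntegrand S D A α a f μ ν τ (fun p i => τ i + (p i).1) j l z
        ∂(volume.prod volume) =
    ∫ σ : Fin r → ℝ, ∑ lam : Fin r → Fin m, smearedGreen S D A a
      (fun i => smearedTest D α a i (ν i) (lam i) (f i) (σ i)) μ lam fun i => τ i + σ i := by
  have hmp := measurePreserving_regroup r d
  have : SFinite ((volume : Measure (Fin r → Space d)).prod
    (volume : Measure (Fin r → Space d))) := Measure.prod.instSFinite
  have hI : ∀ j l, Integrable (fun q : (Fin r → ℝ) × ((Fin r → Space d) × (Fin r → Space d)) =>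
      smearedIntegrand S D A α a f μ ν τ (fun p i => τ i + (p i).1) j l (regroup r d q))
      (volume.prod (volume.prod volume)) := fun j l =>
    (hmp.integrable_comp_emb (regroup r d).measurableEmbedding).2
      (integrable_smearedIntegrand hB hA hf μ ν τ (by fun_prop) j l)
  have h1 : ∀ j l, ∫ z, smearedIntegrand S D A α a f μ ν τ (fun p i => τ i + (p i).1) j l z
        ∂(volume.prod volume) =
      ∫ σ : Fin r → ℝ, ∫ z : (Fin r → Space d) × (Fin r → Space d),
        smearedIntegrand S D A α a f μ ν τ (fun p i => τ i + (p i).1) j l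
          (z.2, fun i => (σ i, z.1 i)) ∂(volume.prod volume) := fun j l => by
    rw [← hmp.integral_comp (regroup r d).measurableEmbedding]
    exact integral_prod _ (hI j l)
  have hI' : ∀ j l, Integrable fun σ : Fin r → ℝ =>
      ∫ z : (Fin r → Space d) × (Fin r → Space d),
        smearedIntegrand S D A α a f μ ν τ (fun p i => τ i + (p i).1) j l
          (z.2, fun i => (σ i, z.1 i)) ∂(volume.prod volume) :=
    fun j l => (hI j l).integral_prod_left
  simp only [h1, ← sum_integral_regrouped (α := α) (D := D) (a := a) hB hA hf μ ν τ]
  refine ⟨integrable_finsetSum _ fun j _ => integrable_finsetSum _ fun l _ => hI' j l, ?_⟩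
  rw [integral_finsetSum _ fun j _ => integrable_finsetSum _ fun l _ => hI' j l]
  refine Finset.sum_congr rfl fun j _ => ?_
  exact (integral_finsetSum _ fun l _ => hI' j l).symm

end Regrouped

end AQFT

namespace AQFT

/-! ### Spaces of test functions with fixed support -/

section TestSpace

variable {d m : ℕ}

theorem IsTest.add {f g : Space d → Fin m → ℂ} (hf : IsTest f) (hg : IsTest g) : IsTest (f + g) :=
  ⟨hf.1.add hg.1, hf.2.add hg.2⟩

theorem IsTest.smul {f : Space d → Fin m → ℂ} (hf : IsTest f) (c : ℂ) : IsTest (c • f) :=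
  ⟨hf.1.const_smul c, hf.2.smul_left⟩

theorem isTest_zero : IsTest (0 : Space d → Fin m → ℂ) :=
  ⟨contDiff_const, HasCompactSupport.zero⟩

/-- The test functions supported in `L`. -/
def testSubmodule (m : ℕ) (L : Set (Space d)) : Submodule ℂ (Space d → Fin m → ℂ) where
  carrier := {f | IsTest f ∧ tsupport f ⊆ L}
  add_mem' hf hg := ⟨hf.1.add hg.1, (tsupport_add _ _).trans (Set.union_subset hf.2 hg.2)⟩
  zero_mem' := ⟨isTest_zero, by simp⟩
  smul_mem' c f hf := ⟨hf.1.smul c, (tsupport_smul_subset_right (fun _ => c) f).trans hf.2⟩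

/-- The test functions supported in `L`, to be normed by their derivatives up to order `N`. -/
def BoundedTest (m : ℕ) (L : TopologicalSpace.Compacts (Space d)) (_ : ℕ) : Type :=
  testSubmodule m (L : Set (Space d))

namespace BoundedTest

variable {L : TopologicalSpace.Compacts (Space d)} {N : ℕ}

noncomputable instance : AddCommGroup (BoundedTest m L N) :=
  inferInstanceAs (AddCommGroup (testSubmodule m (L : Set (Space d))))

noncomputable instance : Module ℂ (BoundedTest m L N) :=
  inferInstanceAs (Module ℂ (testSubmodule m (L : Set (Space d))))

/-- The underlying function. -/
def val (h : BoundedTest m L N) : Space d → Fin m → ℂ := Subtype.val h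

theorem isTest (h : BoundedTest m L N) : IsTest h.val := (Subtype.property h).1

theorem tsupport_val_subset (h : BoundedTest m L N) : tsupport h.val ⊆ L := (Subtype.property h).2

theorem val_add (h g : BoundedTest m L N) : (h + g).val = h.val + g.val := rfl

theorem val_smul (c : ℂ) (h : BoundedTest m L N) : (c • h).val = c • h.val := rfl

theorem val_sum {ι : Type*} (s : Finset ι) (h : ι → BoundedTest m L N) :
    (∑ l ∈ s, h l).val = ∑ l ∈ s, (h l).val := by
  classical
  induction s using Finset.induction_on with
  | empty => rfl
  | insert l s hl ih => rw [Finset.sum_insert hl, Finset.sum_insert hl, val_add, ih]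

theorem val_injective : Function.Injective (val : BoundedTest m L N → Space d → Fin m → ℂ) :=
  Subtype.val_injective

/-- A test function supported in `L`. -/
def mk' (L : TopologicalSpace.Compacts (Space d)) (N : ℕ) (f : Space d → Fin m → ℂ)
    (hf : IsTest f) (hs : tsupport f ⊆ L) : BoundedTest m L N := ⟨f, hf, hs⟩

theorem val_mk' (f : Space d → Fin m → ℂ) (hf : IsTest f) (hs : tsupport f ⊆ L) :
    (mk' L N f hf hs).val = f := rfl

/-- The space of continuous functions on `L` with values in the jets of order `N`. -/
def JetSpace (m : ℕ) (L : TopologicalSpace.Compacts (Space d)) (N : ℕ) : Type :=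
  (n : Fin (N + 1)) → C(L, Space d [×n]→L[ℝ] (Fin m → ℂ))

noncomputable instance : NormedAddCommGroup (JetSpace m L N) :=
  inferInstanceAs
    (NormedAddCommGroup ((n : Fin (N + 1)) → C(L, Space d [×n]→L[ℝ] (Fin m → ℂ))))

set_option synthInstance.maxHeartbeats 200000 in
noncomputable instance : NormedSpace ℂ (JetSpace m L N) :=
  inferInstanceAs
    (NormedSpace ℂ ((n : Fin (N + 1)) → C(L, Space d [×n]→L[ℝ] (Fin m → ℂ))))

set_option synthInstance.maxHeartbeats 200000 in
instance : CompleteSpace (JetSpace m L N) :=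
  inferInstanceAs
    (CompleteSpace ((n : Fin (N + 1)) → C(L, Space d [×n]→L[ℝ] (Fin m → ℂ))))

theorem JetSpace.norm_apply_le (w : JetSpace m L N) (n : Fin (N + 1)) (k : L) :
    ‖w n k‖ ≤ ‖w‖ :=
  ((w n).norm_coe_le_norm k).trans (norm_le_pi_norm
    (f := (w : (n : Fin (N + 1)) → C(L, Space d [×n]→L[ℝ] (Fin m → ℂ)))) n)

/-- Evaluation of a jet at a point. -/
noncomputable def JetSpace.eval (n : Fin (N + 1)) (k : L) :
    JetSpace m L N →L[ℝ] (Space d [×n]→L[ℝ] (Fin m → ℂ)) :=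
  LinearMap.mkContinuous
    { toFun := fun w => w n k
      map_add' := fun _ _ => rfl
      map_smul' := fun _ _ => rfl } 1 fun w => by
    rw [one_mul]
    exact JetSpace.norm_apply_le w n k

/-- The derivatives of a test function up to order `N`, as continuous functions on `L`. -/
noncomputable def jet : BoundedTest m L N →ₗ[ℂ] JetSpace m L N where
  toFun h n := ⟨fun k => iteratedFDeriv ℝ n h.val k,
    (h.isTest.1.continuous_iteratedFDeriv (mod_cast le_top)).comp continuous_subtype_val⟩
  map_add' h g := by
    funext n
    ext1 k
    exact iteratedFDeriv_add_apply (h.isTest.1.of_le (mod_cast le_top)).contDiffAt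
      (g.isTest.1.of_le (mod_cast le_top)).contDiffAt
  map_smul' c h := by
    funext n
    ext1 k
    exact iteratedFDeriv_const_smul_apply (h.isTest.1.of_le (mod_cast le_top)).contDiffAt

theorem jet_injective : Function.Injective (jet : BoundedTest m L N →ₗ[ℂ] _) := by
  intro h g hhg
  refine val_injective (funext fun k => ?_)
  by_cases hk : k ∈ L
  · have h1 : iteratedFDeriv ℝ 0 h.val k = iteratedFDeriv ℝ 0 g.val k :=
      congrFun (congrArg DFunLike.coe (congrFun hhg 0)) ⟨k, hk⟩
    have h2 := congrArg (fun M => M 0) h1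
    simpa only [iteratedFDeriv_zero_apply] using h2
  · rw [image_eq_zero_of_notMem_tsupport fun h' => hk (h.tsupport_val_subset h'),
      image_eq_zero_of_notMem_tsupport fun h' => hk (g.tsupport_val_subset h')]

noncomputable instance : NormedAddCommGroup (BoundedTest m L N) :=
  NormedAddCommGroup.induced _ _ (jet (m := m) (L := L) (N := N)) jet_injective

noncomputable instance : NormedSpace ℂ (BoundedTest m L N) :=
  NormedSpace.induced ℂ _ _ (jet (m := m) (L := L) (N := N))

theorem norm_eq (h : BoundedTest m L N) : ‖h‖ = ‖jet h‖ := rfl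

theorem norm_iteratedFDeriv_le (h : BoundedTest m L N) {n : ℕ} (hn : n ≤ N) (k : Space d) :
    ‖iteratedFDeriv ℝ n h.val k‖ ≤ ‖h‖ := by
  by_cases hk : k ∈ L
  · rw [norm_eq]
    exact JetSpace.norm_apply_le (jet h) ⟨n, Nat.lt_succ_of_le hn⟩ ⟨k, hk⟩
  · have : k ∉ tsupport (iteratedFDeriv ℝ n h.val) := fun h' =>
      hk (h.tsupport_val_subset (tsupport_iteratedFDeriv_subset n h'))
    rw [image_eq_zero_of_notMem_tsupport this, norm_zero]
    exact norm_nonneg _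

theorem norm_le {h : BoundedTest m L N} {M : ℝ} (hM : 0 ≤ M)
    (hb : ∀ n ≤ N, ∀ k, ‖iteratedFDeriv ℝ n h.val k‖ ≤ M) : ‖h‖ ≤ M := by
  rw [norm_eq]
  refine (pi_norm_le_iff_of_nonneg (x := (jet h : (n : Fin (N + 1)) →
    C(L, Space d [×n]→L[ℝ] (Fin m → ℂ)))) hM).2 ?_
  exact fun n => (ContinuousMap.norm_le _ hM).2 fun k => hb n (Nat.le_of_lt_succ n.2) k

/-- The linear isometric embedding of test functions in a complete space. -/
noncomputable def jetIsometry : BoundedTest m L N →ₗᵢ[ℂ] JetSpace m L N where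
  toLinearMap := jet
  norm_map' _ := rfl

/-- A jointly smooth family of test functions is continuous in its parameter. -/
theorem continuous_of_contDiff {P : Type*} [NormedAddCommGroup P] [NormedSpace ℝ P]
    {F : P → BoundedTest m L N}
    (hF : ContDiff ℝ ((⊤ : ℕ∞) : WithTop ℕ∞) fun p : P × Space d => (F p.1).val p.2) :
    Continuous F := by
  rw [jetIsometry.isometry.isEmbedding.continuous_iff]
  refine continuous_pi fun n => ?_
  have h := (continuous_iteratedFDeriv_slice hF n).comp
    (continuous_id.prodMap (continuous_subtype_val (p := fun k => k ∈ L)))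
  exact (ContinuousMap.curry ⟨_, h⟩).continuous

/-- Continuous functionals on test functions commute with integrals.  The space of test functions
is not complete; the functional is extended to the space of jets by the Hahn-Banach theorem. -/
theorem integral_apply (ℓ : BoundedTest m L N →L[ℂ] ℂ) {F : ℝ → BoundedTest m L N}
    (hF : ContDiff ℝ ((⊤ : ℕ∞) : WithTop ℕ∞) fun p : ℝ × Space d => (F p.1).val p.2)
    (hb : ∀ n, ∃ b : ℝ → ℝ, Integrable b ∧ ∀ σ k, ‖iteratedFDeriv ℝ n (F σ).val k‖ ≤ b σ)
    {G : BoundedTest m L N} (hG : ∀ k, G.val k = ∫ σ, (F σ).val k) :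
    ℓ G = ∫ σ, ℓ (F σ) := by
  have hFc := continuous_of_contDiff hF
  have hFi : Integrable fun σ => jetIsometry (F σ) := by
    choose b hb1 hb2 using hb
    refine (integrable_finsetSum (Finset.range (N + 1)) fun n _ => (hb1 n).norm).mono'
      (jetIsometry.continuous.comp hFc).aestronglyMeasurable (.of_forall fun σ => ?_)
    rw [LinearIsometry.norm_map]
    refine norm_le (Finset.sum_nonneg fun _ _ => norm_nonneg _) fun n hn k => (hb2 n σ k).trans ?_
    exact (le_abs_self _).trans (Finset.single_le_sum (f := fun n => ‖b n σ‖)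
      (fun _ _ => norm_nonneg _) (Finset.mem_range_succ_iff.2 hn))
  have hjet : jetIsometry G = ∫ σ, jetIsometry (F σ) := by
    have hder := (contDiff_integral_and_iteratedFDeriv (κ := volume) (f := fun σ => (F σ).val)
      (fun σ => (F σ).isTest.1) (fun n x => ((continuous_iteratedFDeriv_slice hF n).comp
        (continuous_id.prodMk continuous_const)).aestronglyMeasurable) hb).2
    funext n
    ext1 k
    have e1 : (∫ σ, jetIsometry (F σ)) n k = ∫ σ, jetIsometry (F σ) n k := by
      exact ((JetSpace.eval n k).integral_comp_comm hFi).symm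
    rw [e1]
    have e2 : G.val = fun k => ∫ σ, (F σ).val k := funext hG
    change iteratedFDeriv ℝ n G.val k = ∫ σ, iteratedFDeriv ℝ n (F σ).val k
    rw [e2, hder]
  obtain ⟨g, hg, -⟩ := exists_extension_norm_eq (𝕜 := ℂ)
    (LinearMap.range (jetIsometry (m := m) (L := L) (N := N)).toLinearMap)
    (ℓ.comp (jetIsometry (m := m) (L := L) (N := N)).equivRange.symm.toContinuousLinearEquiv.toContinuousLinearMap)
  have hg' : ∀ h, g (jetIsometry h) = ℓ h := fun h => by
    have h1 := hg (jetIsometry.equivRange h)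
    simpa using h1
  rw [← hg', hjet, ← g.integral_comp_comm hFi]
  simp only [hg']

end BoundedTest

theorem IsGeneralizedFunction.exists_continuousMultilinearMap_of_bound {r : ℕ}
    {C : (Fin r → Space d → Fin m → ℂ) → ℂ} (hC : IsGeneralizedFunction C)
    {L : TopologicalSpace.Compacts (Space d)} {N : ℕ} {B : ℝ}
    (hB : ∀ h : Fin r → BoundedTest m L N, ‖C fun i => (h i).val‖ ≤ B * ∏ i, ‖h i‖) :
    ∃ Ψ : ContinuousMultilinearMap ℂ (fun _ : Fin r => BoundedTest m L N) ℂ,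
      ∀ h, Ψ h = C fun i => (h i).val := by
  have hu : ∀ (h : Fin r → BoundedTest m L N) (i : Fin r) (z : BoundedTest m L N),
      (fun j => (Function.update h i z j).val) = Function.update (fun j => (h j).val) i z.val :=
    fun h i z => funext fun j => Function.apply_update (fun _ => BoundedTest.val) h i z j
  refine ⟨MultilinearMap.mkContinuous
    { toFun := fun h => C fun i => (h i).val
      map_update_add' := ?_
      map_update_smul' := ?_ } B hB, fun h => rfl⟩
  · intro inst h i x y
    rw [Subsingleton.elim inst (instDecidableEqFin r)]
    simp only [hu, BoundedTest.val_add]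
    exact hC.map_add _ i _ _ (fun j => (h j).isTest) x.isTest y.isTest
  · intro inst h i c x
    rw [Subsingleton.elim inst (instDecidableEqFin r)]
    simp only [hu, BoundedTest.val_smul]
    exact hC.map_smul _ i c _ (fun j => (h j).isTest) x.isTest

theorem IsGeneralizedFunction.exists_continuousMultilinearMap {r : ℕ}
    {C : (Fin r → Space d → Fin m → ℂ) → ℂ} (hC : IsGeneralizedFunction C)
    (L : TopologicalSpace.Compacts (Space d)) : ∃ (N : ℕ)
      (Ψ : ContinuousMultilinearMap ℂ (fun _ : Fin r => BoundedTest m L N) ℂ),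
      ∀ h, Ψ h = C fun i => (h i).val := by
  obtain ⟨N, B, hB⟩ := hC.continuous L L.isCompact
  exact ⟨N, hC.exists_continuousMultilinearMap_of_bound fun h => hB _ _ fun i =>
    ⟨(h i).isTest, (h i).tsupport_val_subset, fun n hn k => (h i).norm_iteratedFDeriv_le hn k⟩⟩

end TestSpace

end AQFT

namespace AQFT

/-! ### Families of test functions depending on a time -/

section Families

variable {d m r a : ℕ}

theorem Moderate.comp_add {F : ℝ × Space d → ℂ} (hF : Moderate F) (τ : ℝ) :
    Moderate fun p => F (τ + p.1, p.2) := by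
  have e : (fun p : ℝ × Space d => F (τ + p.1, p.2)) = fun p => F ((τ, 0) + p) := by
    ext p
    congr 1
    simp [Prod.ext_iff]
  refine ⟨e ▸ hF.1.comp (contDiff_const.add contDiff_id), fun L hL n => ?_⟩
  obtain ⟨c, Q, hc⟩ := hF.2 L hL n
  refine ⟨|c| * (1 + |τ|) ^ Q, Q, fun s k hk => ?_⟩
  rw [e, iteratedFDeriv_comp_add_left]
  have h1 := hc (τ + s) k hk
  have h2 : 1 + |τ + s| ≤ (1 + |τ|) * (1 + |s|) := by
    have := abs_add_le τ s
    nlinarith [abs_nonneg τ, abs_nonneg s]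
  rw [show ((τ, 0) + (s, k) : ℝ × Space d) = (τ + s, k) by simp]
  calc _ ≤ c * (1 + |τ + s|) ^ Q := h1
    _ ≤ |c| * ((1 + |τ|) * (1 + |s|)) ^ Q :=
        mul_le_mul (le_abs_self c) (pow_le_pow_left₀ (by positivity) h2 Q) (by positivity)
          (abs_nonneg c)
    _ = _ := by rw [mul_pow, mul_assoc]

theorem legMat_mul (a : ℕ) (i : Fin r) (M N : Matrix (Fin m) (Fin m) ℂ) :
    legMat a i (M * N) = legMat a i M * legMat a i N := by
  ext j l
  simp only [legMat, Matrix.map_apply, Matrix.mul_apply, legConj_sum, legConj_mul]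

theorem legMat_one (a : ℕ) (i : Fin r) : legMat a i (1 : Matrix (Fin m) (Fin m) ℂ) = 1 := by
  ext j l
  by_cases h : j = l
  · subst h
    simp [legMat, legConj_one]
  · simp [legMat, Matrix.one_apply_ne h, legConj_zero]

theorem legMat_smul (a : ℕ) (i : Fin r) (z : ℂ) (M : Matrix (Fin m) (Fin m) ℂ) :
    legMat a i (z • M) = legConj a i z • legMat a i M := by
  ext j l
  simp only [legMat, Matrix.map_apply, Matrix.smul_apply, smul_eq_mul, legConj_mul]

theorem vecMul_legMat_mul (a : ℕ) (i : Fin r) (v : Fin m → ℂ) (M N : Matrix (Fin m) (Fin m) ℂ) :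
    Matrix.vecMul (Matrix.vecMul v (legMat a i M)) (legMat a i N) =
      Matrix.vecMul v (legMat a i (M * N)) := by
  rw [Matrix.vecMul_vecMul, legMat_mul]

theorem tsupport_vecMul_subset {f : Space d → Fin m → ℂ}
    (M : Space d → Matrix (Fin m) (Fin m) ℂ) :
    tsupport (fun k => Matrix.vecMul (f k) (M k)) ⊆ tsupport f :=
  closure_mono fun k hk => by
    contrapose! hk
    simp only [Function.mem_support, not_not] at hk ⊢
    rw [hk, Matrix.zero_vecMul]

theorem norm_iteratedFDeriv_le_sum_apply {f : Space d → Fin m → ℂ}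
    (hf : ContDiff ℝ ((⊤ : ℕ∞) : WithTop ℕ∞) f) (n : ℕ) (k : Space d) :
    ‖iteratedFDeriv ℝ n f k‖ ≤ ∑ l, ‖iteratedFDeriv ℝ n (fun k => f k l) k‖ := by
  have e : f = fun k => ∑ l, ContinuousLinearMap.single ℝ (fun _ : Fin m => ℂ) l (f k l) := by
    ext1 k
    exact (Finset.univ_sum_single (f k)).symm
  have hl : ∀ l, ContDiff ℝ ((⊤ : ℕ∞) : WithTop ℕ∞) fun k => f k l := contDiff_pi.1 hf
  have hs : ∀ l, ContDiff ℝ n fun k => ContinuousLinearMap.single ℝ (fun _ : Fin m => ℂ) l (f k l) :=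
    fun l => ((ContinuousLinearMap.single ℝ (fun _ : Fin m => ℂ) l).contDiff.comp (hl l)).of_le
      (mod_cast le_top)
  conv_lhs => rw [e]
  rw [iteratedFDeriv_fun_sum_apply fun l _ => (hs l).contDiffAt]
  refine (norm_sum_le _ _).trans (Finset.sum_le_sum fun l _ => ?_)
  refine ((ContinuousLinearMap.single ℝ (fun _ : Fin m => ℂ) l).norm_iteratedFDeriv_comp_left
    (f := fun k => f k l) (x := k) (hl l).contDiffAt (n := n) (mod_cast le_top)).trans
      (mul_le_of_le_one_left (norm_nonneg _) ?_)
  refine ContinuousLinearMap.opNorm_le_bound _ zero_le_one fun z => ?_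
  rw [one_mul]
  exact (Pi.norm_single (G := fun _ : Fin m => ℂ) (i := l) z).le

theorem norm_iteratedFDeriv_vecMul_le {f : Space d → Fin m → ℂ} (hf : IsTest f)
    {M : Space d → Matrix (Fin m) (Fin m) ℂ}
    (hM : ∀ j l, ContDiff ℝ ((⊤ : ℕ∞) : WithTop ℕ∞) fun k => M k j l) {N : ℕ} {b K : ℝ}
    (hK : 0 ≤ K) (hfb : ∀ n ≤ N, ∀ k, ‖iteratedFDeriv ℝ n f k‖ ≤ b)
    (hMK : ∀ j l, ∀ n ≤ N, ∀ k ∈ tsupport f, ‖iteratedFDeriv ℝ n (fun k => M k j l) k‖ ≤ K)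
    {n : ℕ} (hn : n ≤ N) (k : Space d) :
    ‖iteratedFDeriv ℝ n (fun k => Matrix.vecMul (f k) (M k)) k‖ ≤ m ^ 2 * 2 ^ N * b * K := by
  have hb : 0 ≤ b := (norm_nonneg _).trans (hfb 0 (Nat.zero_le _) k)
  refine (norm_iteratedFDeriv_le_sum_apply (isTest_vecMul hf hM).1 n k).trans ?_
  have hl : ∀ l, ‖iteratedFDeriv ℝ n (fun k => Matrix.vecMul (f k) (M k) l) k‖ ≤
      ∑ _j : Fin m, 2 ^ N * b * K := by
    intro l
    have e : (fun k => Matrix.vecMul (f k) (M k) l) = fun k => ∑ j, f k j * M k j l := rfl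
    rw [e, iteratedFDeriv_fun_sum_apply fun j _ =>
      (((hf.contDiff_apply j).mul (hM j l)).of_le (mod_cast le_top)).contDiffAt]
    refine (norm_sum_le _ _).trans (Finset.sum_le_sum fun j _ => ?_)
    by_cases hk : k ∈ tsupport f
    · refine (norm_iteratedFDeriv_mul_le_of_le (hf.contDiff_apply j) (hM j l)
        (fun p hp => (norm_iteratedFDeriv_apply_le hf.1 j p k).trans (hfb p (hp.trans hn) k))
        (fun p hp => hMK j l p (hp.trans hn) k hk)).trans ?_
      have : (2 : ℝ) ^ n ≤ 2 ^ N := pow_le_pow_right₀ one_le_two hn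
      gcongr
    · have : k ∉ tsupport (iteratedFDeriv ℝ n fun k => f k j * M k j l) := fun h =>
        hk (tsupport_apply_subset j (tsupport_mul_subset_left
          (tsupport_iteratedFDeriv_subset n h)))
      rw [image_eq_zero_of_notMem_tsupport this, norm_zero]
      positivity
  refine (Finset.sum_le_sum fun l _ => hl l).trans (le_of_eq ?_)
  simp only [Finset.sum_const, Finset.card_univ, Fintype.card_fin, nsmul_eq_mul]
  ring

/-- A test function multiplied by a matrix that is rapidly decreasing in time. -/
theorem exists_norm_iteratedFDeriv_vecMul_le {f : Space d → Fin m → ℂ} (hf : IsTest f) (a : ℕ)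
    (i : Fin r) {Q : ℝ → Space d → Matrix (Fin m) (Fin m) ℂ}
    (hQ : ∀ j l, Rapid fun p : ℝ × Space d => Q p.1 p.2 j l) (N P : ℕ) :
    ∃ c : ℝ, 0 ≤ c ∧ ∀ n ≤ N, ∀ σ k,
      ‖iteratedFDeriv ℝ n (fun k => Matrix.vecMul (f k) (legMat a i (Q σ k))) k‖ ≤
        c * ((1 + |σ|) ^ P)⁻¹ := by
  obtain ⟨b, hb0, hb⟩ := hf.exists_bound N
  choose c hc0 hc using fun p : Fin m × Fin m =>
    ((hQ p.1 p.2).legConj (a := a) (i := i)).slice_bound hf.2.isCompact N P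
  have hcd : ∀ σ j l, ContDiff ℝ ((⊤ : ℕ∞) : WithTop ℕ∞) fun k => legConj a i (Q σ k j l) :=
    fun σ j l => contDiff_legConj ((hQ j l).1.comp (contDiff_const.prodMk contDiff_id))
  have hc1 : 0 ≤ ∑ p, c p := Finset.sum_nonneg fun p _ => hc0 p
  refine ⟨m ^ 2 * 2 ^ N * b * ∑ p, c p, by positivity, fun n hn σ k => ?_⟩
  have h := norm_iteratedFDeriv_vecMul_le hf (M := fun k => legMat a i (Q σ k)) (hcd σ) (N := N)
    (K := (∑ p, c p) * ((1 + |σ|) ^ P)⁻¹) (by positivity) hb (fun j l n hn k hk => by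
      refine (hc (j, l) n hn σ k hk).trans ?_
      rw [div_eq_mul_inv]
      exact mul_le_mul_of_nonneg_right
        (Finset.single_le_sum (fun p _ => hc0 p) (Finset.mem_univ (j, l))) (by positivity)) hn k
  rwa [← mul_assoc] at h

theorem contDiff_vecMul_family {f : Space d → Fin m → ℂ} (hf : IsTest f) (a : ℕ)
    (i : Fin r) {Q : ℝ → Space d → Matrix (Fin m) (Fin m) ℂ}
    (hQ : ∀ j l, ContDiff ℝ ((⊤ : ℕ∞) : WithTop ℕ∞) fun p : ℝ × Space d => Q p.1 p.2 j l) :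
    ContDiff ℝ ((⊤ : ℕ∞) : WithTop ℕ∞) fun p : ℝ × Space d =>
      Matrix.vecMul (f p.2) (legMat a i (Q p.1 p.2)) := by
  refine contDiff_pi.2 fun l => ?_
  have : ContDiff ℝ ((⊤ : ℕ∞) : WithTop ℕ∞) fun p : ℝ × Space d =>
      ∑ j, f p.2 j * legConj a i (Q p.1 p.2 j l) :=
    ContDiff.sum fun j _ => ((hf.contDiff_apply j).comp contDiff_snd).mul (contDiff_legConj (hQ j l))
  exact this

theorem integrable_inv_one_add_abs_sq : Integrable fun σ : ℝ => ((1 + |σ|) ^ 2)⁻¹ := by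
  have h := integrable_one_add_norm (E := ℝ) (μ := volume) (r := ((2 : ℕ) : ℝ)) (by simp)
  refine h.congr (.of_forall fun x => ?_)
  simp only
  rw [Real.rpow_neg (by positivity), Real.rpow_natCast, Real.norm_eq_abs]

end Families

/-! ### Matrices of one-particle energies -/

section Energy

variable {d m r a : ℕ} {D : Dispersion d m} {t : Fin m → ElemSpace d m}

theorem contDiff_ampMatrix (t : Fin m → ElemSpace d m) (i j : Fin m) :
    ContDiff ℝ ((⊤ : ℕ∞) : WithTop ℕ∞) fun k => ampMatrix t k i j := by
  have h := (t i).smooth ((⊤ : ℕ∞))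
  exact ((EuclideanSpace.proj j : EuclideanSpace ℂ (Fin m) →L[ℂ] ℂ).restrictScalars
    ℝ).contDiff.comp h

theorem contDiff_det {M : Space d → Matrix (Fin m) (Fin m) ℂ}
    (hM : ∀ i j, ContDiff ℝ ((⊤ : ℕ∞) : WithTop ℕ∞) fun k => M k i j) :
    ContDiff ℝ ((⊤ : ℕ∞) : WithTop ℕ∞) fun k => (M k).det := by
  simp only [Matrix.det_apply]
  exact ContDiff.sum fun σ _ => (contDiff_prod fun i _ => hM _ _).const_smul _

theorem contDiff_matrix_inv {M : Space d → Matrix (Fin m) (Fin m) ℂ}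
    (hM : ∀ i j, ContDiff ℝ ((⊤ : ℕ∞) : WithTop ℕ∞) fun k => M k i j)
    (hdet : ∀ k, (M k).det ≠ 0) (i j : Fin m) :
    ContDiff ℝ ((⊤ : ℕ∞) : WithTop ℕ∞) fun k => (M k)⁻¹ i j := by
  simp only [Matrix.inv_def, Ring.inverse_eq_inv', Matrix.smul_apply, smul_eq_mul,
    Matrix.adjugate_apply]
  refine ((contDiff_det hM).inv hdet).mul (contDiff_det fun p q => ?_)
  by_cases hp : p = j
  · subst hp
    simp only [Matrix.updateRow_self]
    exact contDiff_const
  · simp only [Matrix.updateRow_ne hp]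
    exact hM p q

theorem contDiff_matrix_mul {M N : Space d → Matrix (Fin m) (Fin m) ℂ}
    (hM : ∀ i j, ContDiff ℝ ((⊤ : ℕ∞) : WithTop ℕ∞) fun k => M k i j)
    (hN : ∀ i j, ContDiff ℝ ((⊤ : ℕ∞) : WithTop ℕ∞) fun k => N k i j) (i j : Fin m) :
    ContDiff ℝ ((⊤ : ℕ∞) : WithTop ℕ∞) fun k => (M k * N k) i j := by
  simp only [Matrix.mul_apply]
  exact ContDiff.sum fun l _ => (hM i l).mul (hN l j)

theorem moderate_expI_opEnergy (D : Dispersion d m) (ht : ∀ k, (ampMatrix t k).det ≠ 0)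
    (l j : Fin m) : Moderate fun p : ℝ × Space d => expI p.1 (opEnergy D t p.2) l j := by
  have e : (fun p : ℝ × Space d => expI p.1 (opEnergy D t p.2) l j) = fun p => ∑ γ, ∑ β,
      expI p.1 (D.E p.2) β γ * (ampMatrix t p.2 l γ * (ampMatrix t p.2)⁻¹ β j) :=
    funext fun p => expI_opEnergy_apply D t (ht p.2) p.1 l j
  rw [e]
  exact Moderate.sum fun γ _ => Moderate.sum fun β _ => (moderate_expI D β γ).mul
    (Moderate.of_momentum ((contDiff_ampMatrix t l γ).mul
      (contDiff_matrix_inv (contDiff_ampMatrix t) ht β j)))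

/-- The matrix by which the coefficient of the polar part is multiplied at the time `τ`. -/
noncomputable def polarMat (D : Dispersion d m) (t : Fin m → ElemSpace d m) (μ ν : Fin m) (τ : ℝ)
    (k : Space d) : Matrix (Fin m) (Fin m) ℂ :=
  expI τ (D.E k) μ ν • expI (-τ) (opEnergy D t k)

theorem moderate_polarMat (D : Dispersion d m) (ht : ∀ k, (ampMatrix t k).det ≠ 0)
    (μ ν l j : Fin m) : Moderate fun p : ℝ × Space d => polarMat D t μ ν p.1 p.2 l j :=
  (moderate_expI D μ ν).mul (moderate_expI_opEnergy D ht l j).comp_neg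

theorem smul_vecMul_eq_polarMat (D : Dispersion d m) (t : Fin m → ElemSpace d m) (a : ℕ)
    (i : Fin r) (μ ν : Fin m) (τ : ℝ) (k : Space d) (v : Fin m → ℂ) :
    legConj a i (expI τ (D.E k) μ ν) • Matrix.vecMul v (legMat a i (expI (-τ) (opEnergy D t k))) =
      Matrix.vecMul v (legMat a i (polarMat D t μ ν τ k)) := by
  rw [polarMat, legMat_smul, Matrix.vecMul_smul]

/-- The integrand of `symbolAt` after integration over space. -/
noncomputable def smearedPropagator (D : Dispersion d m) (t : Fin m → ElemSpace d m)
    (α : Fin m → Fin m → 𝓢(ℝ × Space d, ℂ)) (σ : ℝ) (k : Space d) : Matrix (Fin m) (Fin m) ℂ :=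
  (Matrix.of fun j l => partialFourier (α j l) (σ, k)) * expI (-σ) (opEnergy D t k)

theorem integral_smearedPropagator (D : Dispersion d m) (α : Fin m → Fin m → 𝓢(ℝ × Space d, ℂ))
    {k : Space d} (ht : (ampMatrix t k).det ≠ 0) (j y : Fin m) :
    Integrable (fun σ => smearedPropagator D t α σ k j y) ∧
      ∫ σ, smearedPropagator D t α σ k j y = symbolAt α (opEnergy D t k) k j y := by
  have hI : ∀ l, Integrable (fun p : ℝ × Space d =>
      α j l p * planeWave k p.2 * expI (-p.1) (opEnergy D t k) l y) (volume.prod volume) :=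
    fun l => integrable_symbolAt_integrand D t (α j l) ht l y
  have e : ∀ σ, smearedPropagator D t α σ k j y = ∑ l, ∫ x : Space d,
      α j l (σ, x) * planeWave k x * expI (-σ) (opEnergy D t k) l y := by
    intro σ
    rw [smearedPropagator, Matrix.mul_apply]
    exact Finset.sum_congr rfl fun l _ => (integral_mul_const _ _).symm
  simp only [e]
  refine ⟨integrable_finsetSum _ fun l _ => (hI l).integral_prod_left, ?_⟩
  rw [integral_finsetSum _ fun l _ => (hI l).integral_prod_left, symbolAt, Matrix.of_apply]
  exact Finset.sum_congr rfl fun l _ => (integral_prod _ (hI l)).symm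

theorem sum_symbolSlice_mul_polarMat (D : Dispersion d m) (t : Fin m → ElemSpace d m)
    (α : Fin m → Fin m → 𝓢(ℝ × Space d, ℂ)) (μ ν : Fin m) (τ σ : ℝ) (k : Space d) :
    ∑ lam, symbolSlice D α ν lam σ k * polarMat D t μ lam (τ + σ) k =
      expI τ (D.E k) μ ν • (smearedPropagator D t α σ k * expI (-τ) (opEnergy D t k)) := by
  have e1 : ∀ lam, symbolSlice D α ν lam σ k * polarMat D t μ lam (τ + σ) k =
      (expI (τ + σ) (D.E k) μ lam * expI (-σ) (D.E k) lam ν) •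
        (smearedPropagator D t α σ k * expI (-τ) (opEnergy D t k)) := by
    intro lam
    have h1 : symbolSlice D α ν lam σ k = expI (-σ) (D.E k) lam ν •
        Matrix.of fun j l => partialFourier (α j l) (σ, k) := by
      ext j l
      simp only [symbolSlice, Matrix.of_apply, Matrix.smul_apply, smul_eq_mul, mul_comm]
    rw [h1, polarMat, smearedPropagator, Matrix.mul_assoc, ← expI_add, neg_add, add_comm (-τ),
      Matrix.smul_mul, Matrix.mul_smul, smul_smul, mul_comm]
  simp only [e1, ← Finset.sum_smul]
  rw [← Matrix.mul_apply, ← expI_add, add_neg_cancel_right]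

end Energy

end AQFT

namespace AQFT

/-! ### Superpositions of test functions in a generalized function -/

section Superposition

variable {d m r a : ℕ}

theorem Rapid.integrable_time {F : ℝ × Space d → ℂ} (hF : Rapid F) (k : Space d) :
    Integrable fun σ => F (σ, k) := by
  obtain ⟨c, -, hc⟩ := hF.slice_bound (isCompact_singleton (x := k)) 0 2
  refine (integrable_inv_one_add_abs_sq.const_mul c).mono'
    (hF.1.continuous.comp (Continuous.prodMk_left k)).aestronglyMeasurable (.of_forall fun σ => ?_)
  have h := hc 0 le_rfl σ k rfl
  rwa [norm_iteratedFDeriv_zero, div_eq_mul_inv] at h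

theorem contDiff_slice {F : ℝ × Space d → ℂ} (hF : ContDiff ℝ ((⊤ : ℕ∞) : WithTop ℕ∞) F) (σ : ℝ) :
    ContDiff ℝ ((⊤ : ℕ∞) : WithTop ℕ∞) fun k => F (σ, k) :=
  hF.comp (contDiff_const.prodMk contDiff_id)

theorem isTest_vecMul_rapid {f : Space d → Fin m → ℂ} (hf : IsTest f) (a : ℕ) (i : Fin r)
    {Q : ℝ → Space d → Matrix (Fin m) (Fin m) ℂ}
    (hQ : ∀ j l, Rapid fun p : ℝ × Space d => Q p.1 p.2 j l) (σ : ℝ) :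
    IsTest fun k => Matrix.vecMul (f k) (legMat a i (Q σ k)) :=
  isTest_vecMul hf fun j l => contDiff_legConj (contDiff_slice (hQ j l).1 σ)

theorem integral_vecMul_rapid (f : Space d → Fin m → ℂ) (a : ℕ) (i : Fin r)
    {Q : ℝ → Space d → Matrix (Fin m) (Fin m) ℂ}
    (hQ : ∀ j l, Rapid fun p : ℝ × Space d => Q p.1 p.2 j l) (k : Space d) :
    ∫ σ, Matrix.vecMul (f k) (legMat a i (Q σ k)) =
      Matrix.vecMul (f k) (legMat a i (Matrix.of fun j y => ∫ σ, Q σ k j y)) := by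
  have hI : ∀ j y, Integrable fun σ => f k j * legConj a i (Q σ k j y) := fun j y =>
    ((hQ j y).legConj.integrable_time k).const_mul _
  have hI' : ∀ y, Integrable fun σ => Matrix.vecMul (f k) (legMat a i (Q σ k)) y := fun y =>
    (integrable_finsetSum Finset.univ fun j _ => hI j y :)
  ext1 y
  rw [eval_integral hI']
  change ∫ σ, ∑ j, f k j * legConj a i (Q σ k j y) =
    ∑ j, f k j * legConj a i (∫ σ, Q σ k j y)
  rw [integral_finsetSum _ fun j _ => hI j y]
  refine Finset.sum_congr rfl fun j _ => ?_
  rw [legConj_integral, integral_const_mul]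

theorem isTest_vecMul_integral {f : Space d → Fin m → ℂ} (hf : IsTest f) (a : ℕ) (i : Fin r)
    {Q : ℝ → Space d → Matrix (Fin m) (Fin m) ℂ}
    (hQ : ∀ j l, Rapid fun p : ℝ × Space d => Q p.1 p.2 j l) :
    IsTest fun k => Matrix.vecMul (f k) (legMat a i (Matrix.of fun j y => ∫ σ, Q σ k j y)) := by
  refine ⟨?_, hf.2.mono fun k hk => ?_⟩
  · have h := (contDiff_integral_and_iteratedFDeriv (κ := (volume : Measure ℝ))
      (f := fun σ k => Matrix.vecMul (f k) (legMat a i (Q σ k)))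
      (fun σ => (isTest_vecMul_rapid hf a i hQ σ).1)
      (fun n x => ((continuous_iteratedFDeriv_slice
        (contDiff_vecMul_family hf a i fun j l => (hQ j l).1) n).comp
          (continuous_id.prodMk continuous_const)).aestronglyMeasurable) fun n => by
        obtain ⟨c, -, hc⟩ := exists_norm_iteratedFDeriv_vecMul_le hf a i hQ n 2
        exact ⟨_, integrable_inv_one_add_abs_sq.const_mul c, fun σ k => hc n le_rfl σ k⟩).1
    simpa only [integral_vecMul_rapid f a i hQ] using h
  · contrapose! hk
    simp only [Function.mem_support, not_not] at hk ⊢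
    rw [hk, Matrix.zero_vecMul]

/-- If every test function is a superposition `∑ l, ∫ dσ` of test functions that are rapidly
decreasing in the times `σ`, then a generalized function commutes with all superpositions. -/
theorem IsGeneralizedFunction.integral_vecMul {C : (Fin r → Space d → Fin m → ℂ) → ℂ}
    (hC : IsGeneralizedFunction C) {f : Fin r → Space d → Fin m → ℂ} (hf : ∀ i, IsTest (f i))
    {L : Type*} [Fintype L] {Q : Fin r → L → ℝ → Space d → Matrix (Fin m) (Fin m) ℂ}
    (hQ : ∀ i l j y, Rapid fun p : ℝ × Space d => Q i l p.1 p.2 j y)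
    {R : Fin r → Space d → Matrix (Fin m) (Fin m) ℂ}
    (hR : ∀ i k j y, R i k j y = ∑ l, ∫ σ, Q i l σ k j y) :
    Integrable (fun σ : Fin r → ℝ => ∑ l : Fin r → L, C fun i k =>
        Matrix.vecMul (f i k) (legMat a i (Q i (l i) (σ i) k))) ∧
      C (fun i k => Matrix.vecMul (f i k) (legMat a i (R i k))) =
        ∫ σ : Fin r → ℝ, ∑ l : Fin r → L, C fun i k =>
          Matrix.vecMul (f i k) (legMat a i (Q i (l i) (σ i) k)) := by
  let K : TopologicalSpace.Compacts (Space d) :=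
    ⟨⋃ i, tsupport (f i), isCompact_iUnion fun i => (hf i).2.isCompact⟩
  have hsub : ∀ i, tsupport (f i) ⊆ K := fun i => Set.subset_iUnion (fun i => tsupport (f i)) i
  obtain ⟨N, Ψ, hΨ⟩ := hC.exists_continuousMultilinearMap K
  let F : Fin r → L → ℝ → BoundedTest m K N := fun i l σ =>
    BoundedTest.mk' K N (fun k => Matrix.vecMul (f i k) (legMat a i (Q i l σ k)))
      (isTest_vecMul_rapid (hf i) a i (hQ i l) σ) ((tsupport_vecMul_subset _).trans (hsub i))
  let V : Fin r → L → BoundedTest m K N := fun i l =>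
    BoundedTest.mk' K N
      (fun k => Matrix.vecMul (f i k) (legMat a i (Matrix.of fun j y => ∫ σ, Q i l σ k j y)))
      (isTest_vecMul_integral (hf i) a i (hQ i l)) ((tsupport_vecMul_subset _).trans (hsub i))
  have hF : ∀ i l, ContDiff ℝ ((⊤ : ℕ∞) : WithTop ℕ∞) fun p : ℝ × Space d => (F i l p.1).val p.2 :=
    fun i l => contDiff_vecMul_family (hf i) a i fun j y => (hQ i l j y).1
  have hV : (fun i => (∑ l, V i l).val) =
      fun i k => Matrix.vecMul (f i k) (legMat a i (R i k)) := by
    ext i k y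
    rw [BoundedTest.val_sum, Finset.sum_apply, Finset.sum_apply]
    change ∑ l, ∑ j, f i k j * legConj a i (∫ σ, Q i l σ k j y) =
      ∑ j, f i k j * legConj a i (R i k j y)
    rw [Finset.sum_comm]
    refine Finset.sum_congr rfl fun j _ => ?_
    rw [hR, legConj_sum, Finset.mul_sum]
  have hint : ∀ l : Fin r → L, Integrable fun p : Fin r → ℝ =>
      (∏ _i : Fin r, (1 : ℂ)) * Ψ fun i => F i (l i) (p i) := by
    intro l
    choose c hc0 hc using fun i => exists_norm_iteratedFDeriv_vecMul_le (hf i) a i (hQ i (l i)) N 2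
    have hg : Integrable fun p : Fin r → ℝ => ‖Ψ‖ * ∏ i, (c i * ((1 + |p i|) ^ 2)⁻¹) :=
      (Integrable.fintype_prod (f := fun i (s : ℝ) => c i * ((1 + |s|) ^ 2)⁻¹)
        fun i => integrable_inv_one_add_abs_sq.const_mul _).const_mul _
    simp only [Finset.prod_const_one, one_mul]
    refine hg.mono' ?_ (.of_forall fun p => (Ψ.le_opNorm _).trans ?_)
    · refine (Ψ.cont.comp (continuous_pi fun i => ?_)).aestronglyMeasurable
      exact (BoundedTest.continuous_of_contDiff (hF i (l i))).comp (continuous_apply i)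
    · refine mul_le_mul_of_nonneg_left (Finset.prod_le_prod (fun _ _ => norm_nonneg _)
        fun i _ => BoundedTest.norm_le ?_ fun n hn k => hc i n hn (p i) k) (norm_nonneg _)
      exact mul_nonneg (hc0 i) (by positivity)
  -- `C` is linear and continuous in each slot, so it commutes with a superposition there.
  have key := eq_sum_integral_of_slotwise (adm := fun _ _ => True) (Ψ := Ψ)
    (v := fun i => ∑ l, V i l) (F := F) (w := fun _ _ _ => 1) (fun _ _ _ => trivial)
    (fun _ => trivial) (fun i X _ => by
      simp only [one_mul]
      change Ψ.toContinuousLinearMap X i (∑ l, V i l) =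
        ∑ l, ∫ p, Ψ.toContinuousLinearMap X i (F i l p)
      rw [map_sum]
      refine Finset.sum_congr rfl fun l _ => ?_
      refine BoundedTest.integral_apply _ (hF i l) (fun n => ?_) fun k => ?_
      · obtain ⟨c, -, hc⟩ := exists_norm_iteratedFDeriv_vecMul_le (hf i) a i (hQ i l) n 2
        exact ⟨_, integrable_inv_one_add_abs_sq.const_mul c, fun σ k => hc n le_rfl σ k⟩
      · exact (integral_vecMul_rapid (f i) a i (hQ i l) k).symm) hint
  rw [hΨ, hV] at key
  simp only [Finset.prod_const_one, one_mul, hΨ] at key hint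
  refine ⟨integrable_finsetSum _ fun l _ => hint l, ?_⟩
  exact key.trans (integral_finsetSum _ fun l _ => hint l).symm

/-- The contribution of the polar part to the Green function of the smeared operators. -/
theorem IsGeneralizedFunction.integral_polar {D : Dispersion d m} {t : Fin m → ElemSpace d m}
    {C : (Fin r → Space d → Fin m → ℂ) → ℂ} (hC : IsGeneralizedFunction C)
    (ht : ∀ k, (ampMatrix t k).det ≠ 0) (α : Fin m → Fin m → 𝓢(ℝ × Space d, ℂ))
    {f : Fin r → Space d → Fin m → ℂ} (hf : ∀ i, IsTest (f i)) (μ ν : Fin r → Fin m)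
    (τ : Fin r → ℝ) :
    Integrable (fun σ : Fin r → ℝ => ∑ lam : Fin r → Fin m, C fun i k =>
        Matrix.vecMul (smearedTest D α a i (ν i) (lam i) (f i) (σ i) k)
          (legMat a i (polarMat D t (μ i) (lam i) (τ i + σ i) k))) ∧
      C (fun i k => Matrix.vecMul (f i k) (legMat a i (expI (τ i) (D.E k) (μ i) (ν i) •
          (symbolAt α (opEnergy D t k) k * expI (-τ i) (opEnergy D t k))))) =
        ∫ σ : Fin r → ℝ, ∑ lam : Fin r → Fin m, C fun i k =>
          Matrix.vecMul (smearedTest D α a i (ν i) (lam i) (f i) (σ i) k)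
            (legMat a i (polarMat D t (μ i) (lam i) (τ i + σ i) k)) := by
  simp only [smearedTest, vecMul_legMat_mul]
  have hQ : ∀ i lam j y, Rapid fun p : ℝ × Space d =>
      (symbolSlice D α (ν i) lam p.1 p.2 * polarMat D t (μ i) lam (τ i + p.1) p.2) j y := by
    intro i lam j y
    simp only [Matrix.mul_apply]
    exact Rapid.sum fun l _ => (rapid_symbolSlice D α (ν i) lam j l).mul_moderate
      ((moderate_polarMat D ht (μ i) lam l y).comp_add (τ i))
  refine hC.integral_vecMul hf
    (Q := fun i lam σ k => symbolSlice D α (ν i) lam σ k * polarMat D t (μ i) lam (τ i + σ) k)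
    hQ fun i k j y => ?_
  rw [← integral_finsetSum _ fun lam _ => (hQ i lam j y).integrable_time k]
  have e : ∀ σ, ∑ lam, (symbolSlice D α (ν i) lam σ k * polarMat D t (μ i) lam (τ i + σ) k) j y =
      ∑ l, smearedPropagator D t α σ k j l *
        (expI (τ i) (D.E k) (μ i) (ν i) * expI (-τ i) (opEnergy D t k) l y) := by
    intro σ
    rw [← Matrix.sum_apply, sum_symbolSlice_mul_polarMat, Matrix.smul_apply, Matrix.mul_apply,
      smul_eq_mul, Finset.mul_sum]
    exact Finset.sum_congr rfl fun l _ => by ring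
  simp only [e]
  have hP := fun l => integral_smearedPropagator D (t := t) α (ht k) j l
  rw [integral_finsetSum _ fun l _ => (hP l).1.mul_const _]
  simp only [integral_mul_const, (hP _).2]
  rw [Matrix.smul_apply, Matrix.mul_apply, smul_eq_mul, Finset.mul_sum]
  exact Finset.sum_congr rfl fun l _ => by ring

end Superposition

end AQFT

/-- The uniform boundedness principle for multilinear maps. -/
theorem ContinuousMultilinearMap.exists_norm_le_of_pointwise {𝕜 X F ι : Type*}
    [NontriviallyNormedField 𝕜] [NormedAddCommGroup X] [NormedSpace 𝕜 X] [CompleteSpace X]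
    [NormedAddCommGroup F] [NormedSpace 𝕜 F] {r : ℕ}
    {g : ι → ContinuousMultilinearMap 𝕜 (fun _ : Fin r => X) F}
    (h : ∀ x, ∃ C, ∀ i, ‖g i x‖ ≤ C) : ∃ C, ∀ i, ‖g i‖ ≤ C := by
  induction r generalizing ι with
  | zero =>
    obtain ⟨C, hC⟩ := h 0
    refine ⟨max C 0, fun i => ContinuousMultilinearMap.opNorm_le_bound (le_max_right _ _)
      fun x => ?_⟩
    rw [Subsingleton.elim x 0]
    simpa using Or.inl (hC i)
  | succ r ih =>
    obtain ⟨C, hC⟩ := banach_steinhaus (g := fun i => (g i).curryLeft) fun x₀ =>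
      ih (g := fun i => (g i).curryLeft x₀) fun x => by
        obtain ⟨C, hC⟩ := h (Fin.cons x₀ x)
        exact ⟨C, fun i => hC i⟩
    exact ⟨C, fun i => (ContinuousMultilinearMap.curryLeft_norm (g i)).symm.trans_le (hC i)⟩

namespace AQFT

/-! ### Uniform boundedness on families of test functions -/

section Mixtures

variable {d m r a : ℕ}

/-- Absolutely summable families of complex numbers indexed by the times. -/
noncomputable abbrev Weights : Type := lp (fun _ : ℝ => ℂ) 1

theorem Weights.summable_norm (c : Weights) : Summable fun σ => ‖c σ‖ := by
  have h := (lp.memℓp c).summable (by simp)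
  simpa using h

theorem Weights.norm_eq (c : Weights) : ‖c‖ = ∑' σ, ‖c σ‖ := by
  have h := lp.norm_eq_tsum_rpow (p := 1) (by simp) c
  simpa using h

/-- A family of functions all derivatives of which are uniformly bounded. -/
def BoundedFamily (u : ℝ → Space d → ℂ) : Prop :=
  (∀ σ, ContDiff ℝ ((⊤ : ℕ∞) : WithTop ℕ∞) (u σ)) ∧
    ∀ n : ℕ, ∃ K : ℝ, ∀ σ k, ‖iteratedFDeriv ℝ n (u σ) k‖ ≤ K

/-- The superposition of the functions of a family with given weights. -/
noncomputable def mixture (u : ℝ → Space d → ℂ) (c : Weights) (k : Space d) : ℂ :=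
  ∑' σ, c σ * u σ k

variable {u : ℝ → Space d → ℂ}

theorem BoundedFamily.norm_iteratedFDeriv_mul_le (hu : BoundedFamily u) {n : ℕ} {K : ℝ}
    (hK : ∀ σ k, ‖iteratedFDeriv ℝ n (u σ) k‖ ≤ K) (c : Weights) (σ : ℝ) (k : Space d) :
    ‖iteratedFDeriv ℝ n (fun k => c σ * u σ k) k‖ ≤ ‖c σ‖ * K := by
  have e : ∀ z : ℂ, iteratedFDeriv ℝ n (fun k => z * u σ k) k = z • iteratedFDeriv ℝ n (u σ) k :=
    fun z => iteratedFDeriv_const_smul_apply' (a := z) ((hu.1 σ).of_le (mod_cast le_top)).contDiffAt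
  rw [e, norm_smul]
  exact mul_le_mul_of_nonneg_left (hK σ k) (norm_nonneg _)

/-- The series may be differentiated term by term. -/
theorem BoundedFamily.contDiff_mixture (hu : BoundedFamily u) (c : Weights) :
    ContDiff ℝ ((⊤ : ℕ∞) : WithTop ℕ∞) (mixture u c) := by
  choose K hK using hu.2
  exact contDiff_tsum (v := fun n σ => ‖c σ‖ * K n) (fun σ => contDiff_const.mul (hu.1 σ))
    (fun n _ => c.summable_norm.mul_right _)
    fun n σ k _ => hu.norm_iteratedFDeriv_mul_le (hK n) c σ k

theorem BoundedFamily.exists_norm_iteratedFDeriv_mixture_le (hu : BoundedFamily u) (N : ℕ) :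
    ∃ K : ℝ, 0 ≤ K ∧ ∀ (c : Weights), ∀ n ≤ N, ∀ k,
      ‖iteratedFDeriv ℝ n (mixture u c) k‖ ≤ K * ‖c‖ := by
  choose K hK using hu.2
  have hK0 : ∀ n, 0 ≤ K n := fun n => (norm_nonneg _).trans (hK n 0 0)
  refine ⟨∑ n ∈ Finset.range (N + 1), K n, Finset.sum_nonneg fun n _ => hK0 n,
    fun c n hn k => ?_⟩
  have e := iteratedFDeriv_tsum_apply (𝕜 := ℝ) (N := ⊤) (v := fun n σ => ‖c σ‖ * K n)
    (f := fun σ k => c σ * u σ k) (fun σ => contDiff_const.mul (hu.1 σ))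
    (fun n _ => c.summable_norm.mul_right _)
    (fun n σ k _ => hu.norm_iteratedFDeriv_mul_le (hK n) c σ k) (k := n) le_top k
  change ‖iteratedFDeriv ℝ n (fun y => ∑' σ, c σ * u σ y) k‖ ≤ _
  rw [e]
  have hs : Summable fun σ => ‖c σ‖ * K n := c.summable_norm.mul_right _
  refine (tsum_of_norm_bounded hs.hasSum fun σ =>
    hu.norm_iteratedFDeriv_mul_le (hK n) c σ k).trans ?_
  rw [tsum_mul_right, ← c.norm_eq, mul_comm]
  exact mul_le_mul_of_nonneg_right (Finset.single_le_sum (f := K) (fun n _ => hK0 n)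
    (Finset.mem_range_succ_iff.2 hn)) (norm_nonneg _)

theorem BoundedFamily.summable_mul (hu : BoundedFamily u) (c : Weights) (k : Space d) :
    Summable fun σ => c σ * u σ k := by
  obtain ⟨K, hK⟩ := hu.2 0
  refine .of_norm_bounded (c.summable_norm.mul_right K) fun σ => ?_
  rw [norm_mul]
  exact mul_le_mul_of_nonneg_left (by simpa using hK σ k) (norm_nonneg _)

theorem BoundedFamily.mixture_add (hu : BoundedFamily u) (b c : Weights) (k : Space d) :
    mixture u (b + c) k = mixture u b k + mixture u c k := by
  simp only [mixture, lp.coeFn_add, Pi.add_apply, add_mul]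
  exact (hu.summable_mul b k).tsum_add (hu.summable_mul c k)

theorem mixture_smul (z : ℂ) (c : Weights) (k : Space d) :
    mixture u (z • c) k = z * mixture u c k := by
  simp only [mixture, lp.coeFn_smul, Pi.smul_apply, smul_eq_mul, mul_assoc]
  exact tsum_mul_left

theorem mixture_single (σ : ℝ) (k : Space d) : mixture u (lp.single 1 σ 1) k = u σ k := by
  rw [mixture, tsum_eq_single σ fun s hs => by rw [lp.single_apply_ne _ _ _ hs, zero_mul],
    lp.single_apply_self, one_mul]

/-- Superpositions of a rapidly decreasing family of multiples of a test function, as a continuous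
linear function of the weights, which may be as large as the square of time. -/
theorem exists_mixture_clm {f : Space d → Fin m → ℂ} (hf : IsTest f) (a : ℕ) (i : Fin r)
    {Q : ℝ → Space d → Matrix (Fin m) (Fin m) ℂ}
    (hQ : ∀ j l, Rapid fun p : ℝ × Space d => Q p.1 p.2 j l)
    {L : TopologicalSpace.Compacts (Space d)} (hL : tsupport f ⊆ L) (N : ℕ) :
    ∃ T : Weights →L[ℂ] BoundedTest m L N,
      (∀ c, ∃ M : Space d → Matrix (Fin m) (Fin m) ℂ,
        (∀ j l, ContDiff ℝ ((⊤ : ℕ∞) : WithTop ℕ∞) fun k => M k j l) ∧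
          (T c).val = fun k => Matrix.vecMul (f k) (M k)) ∧
      ∀ σ, (T (lp.single 1 σ 1)).val = fun k =>
        ((1 + |σ| : ℝ) : ℂ) ^ 2 • Matrix.vecMul (f k) (legMat a i (Q σ k)) := by
  -- `Q` is bounded only locally in momentum; a cut-off equal to one on the support of `f` makes
  -- the family globally bounded without changing the products with `f`.
  obtain ⟨χ, hχ, hχc, hχ1⟩ : ∃ χ : Space d → ℂ, ContDiff ℝ ((⊤ : ℕ∞) : WithTop ℕ∞) χ ∧
      HasCompactSupport χ ∧ ∀ k ∈ tsupport f, χ k = 1 := by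
    obtain ⟨χ, hχ, hχc, hχ1⟩ := exists_cutoff hf.2.isCompact
    exact ⟨fun k => χ k, Complex.ofRealCLM.contDiff.comp hχ,
      hχc.comp_left (g := fun x : ℝ => (x : ℂ)) Complex.ofReal_zero,
      fun k hk => by simp only [hχ1 k hk, Complex.ofReal_one]⟩
  let u : Fin m → Fin m → ℝ → Space d → ℂ := fun j l σ k =>
    χ k * (((1 + |σ| : ℝ) : ℂ) ^ 2 • legConj a i (Q σ k j l))
  have hu : ∀ j l, BoundedFamily (u j l) := by
    intro j l
    have hq : ∀ σ, ContDiff ℝ ((⊤ : ℕ∞) : WithTop ℕ∞) fun k => legConj a i (Q σ k j l) :=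
      fun σ => contDiff_legConj (contDiff_slice (hQ j l).1 σ)
    have hq2 : ∀ σ, ContDiff ℝ ((⊤ : ℕ∞) : WithTop ℕ∞) fun k =>
        ((1 + |σ| : ℝ) : ℂ) ^ 2 • legConj a i (Q σ k j l) := fun σ => (hq σ).const_smul _
    refine ⟨fun σ => hχ.mul (hq2 σ), fun n => ?_⟩
    obtain ⟨c, hc0, hc⟩ := ((hQ j l).legConj (a := a) (i := i)).slice_bound hχc.isCompact n 2
    have hb : ∃ b : ℝ, 0 ≤ b ∧ ∀ p ≤ n, ∀ k, ‖iteratedFDeriv ℝ p χ k‖ ≤ b := by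
      choose b hb using fun p : ℕ => (hχc.iteratedFDeriv (𝕜 := ℝ) p).exists_bound_of_continuous
        (hχ.continuous_iteratedFDeriv (m := p) (mod_cast le_top))
      refine ⟨∑ p ∈ Finset.range (n + 1), b p, Finset.sum_nonneg fun p _ =>
        (norm_nonneg _).trans (hb p 0), fun p hp k => (hb p k).trans ?_⟩
      exact Finset.single_le_sum (f := b) (fun p _ => (norm_nonneg _).trans (hb p 0))
        (Finset.mem_range_succ_iff.2 hp)
    obtain ⟨b, hb0, hb⟩ := hb
    refine ⟨2 ^ n * b * c, fun σ k => ?_⟩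
    by_cases hk : k ∈ tsupport χ
    · refine norm_iteratedFDeriv_mul_le_of_le hχ (hq2 σ) (fun p hp => hb p hp k) fun p hp => ?_
      rw [iteratedFDeriv_const_smul_apply' ((hq σ).of_le (mod_cast le_top)).contDiffAt, norm_smul,
        norm_pow, Complex.norm_real, Real.norm_of_nonneg (by positivity), mul_comm]
      exact (le_div_iff₀ (by positivity)).1 (hc p hp σ k hk)
    · have : k ∉ tsupport (iteratedFDeriv ℝ n (u j l σ)) := fun h =>
        hk (tsupport_mul_subset_left (tsupport_iteratedFDeriv_subset n h))
      rw [image_eq_zero_of_notMem_tsupport this, norm_zero]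
      positivity
  let M : Weights → Space d → Matrix (Fin m) (Fin m) ℂ := fun c k =>
    Matrix.of fun j l => mixture (u j l) c k
  have hM : ∀ c j l, ContDiff ℝ ((⊤ : ℕ∞) : WithTop ℕ∞) fun k => M c k j l :=
    fun c j l => (hu j l).contDiff_mixture c
  have hadd : ∀ b c k, M (b + c) k = M b k + M c k := fun b c k => by
    ext j l
    exact (hu j l).mixture_add b c k
  have hsmul : ∀ z c k, M (z • c) k = z • M c k := fun z c k => by
    ext j l
    exact mixture_smul z c k
  let T₀ : Weights →ₗ[ℂ] BoundedTest m L N :=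
    { toFun := fun c => BoundedTest.mk' L N (fun k => Matrix.vecMul (f k) (M c k))
        (isTest_vecMul hf (hM c)) ((tsupport_vecMul_subset _).trans hL)
      map_add' := fun b c => BoundedTest.val_injective (funext fun k => by
        rw [BoundedTest.val_add, Pi.add_apply]
        simp only [BoundedTest.val_mk', hadd, Matrix.vecMul_add])
      map_smul' := fun z c => BoundedTest.val_injective (funext fun k => by
        rw [RingHom.id_apply, BoundedTest.val_smul, Pi.smul_apply]
        simp only [BoundedTest.val_mk', hsmul, Matrix.vecMul_smul]) }
  have hT₀ : ∀ c, (T₀ c).val = fun k => Matrix.vecMul (f k) (M c k) := fun c => rfl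
  obtain ⟨b, hb0, hb⟩ := hf.exists_bound N
  choose K hK0 hK using fun p : Fin m × Fin m =>
    (hu p.1 p.2).exists_norm_iteratedFDeriv_mixture_le N
  have hK1 : 0 ≤ ∑ p, K p := Finset.sum_nonneg fun p _ => hK0 p
  refine ⟨T₀.mkContinuous (m ^ 2 * 2 ^ N * b * ∑ p, K p) fun c =>
    BoundedTest.norm_le (by positivity) fun n hn k => ?_, fun c => ⟨M c, hM c, hT₀ c⟩, fun σ => ?_⟩
  · rw [hT₀, mul_assoc]
    refine norm_iteratedFDeriv_vecMul_le hf (hM c) (by positivity) hb (fun j l n hn k _ => ?_) hn k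
    exact (hK (j, l) c n hn k).trans (mul_le_mul_of_nonneg_right
      (Finset.single_le_sum (fun p _ => hK0 p) (Finset.mem_univ (j, l))) (norm_nonneg _))
  · rw [LinearMap.mkContinuous_apply, hT₀]
    ext1 k
    by_cases hk : k ∈ tsupport f
    · have e : M (lp.single 1 σ 1) k = ((1 + |σ| : ℝ) : ℂ) ^ 2 • legMat a i (Q σ k) := by
        ext j l
        change mixture (u j l) (lp.single 1 σ 1) k = _
        rw [mixture_single]
        change χ k * (((1 + |σ| : ℝ) : ℂ) ^ 2 • legConj a i (Q σ k j l)) = _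
        rw [hχ1 k hk, one_mul]
        rfl
      rw [e, Matrix.vecMul_smul]
    · rw [image_eq_zero_of_notMem_tsupport hk, Matrix.zero_vecMul, Matrix.zero_vecMul, smul_zero]

end Mixtures

end AQFT

namespace AQFT

/-! ### Dominated convergence at large times -/

section Vanishing

variable {d m r a : ℕ} {D : Dispersion d m}

/-- A family of generalized functions, depending on the times of the legs, that grows at most
polynomially in time and tends to zero at infinite times on all non-overlapping families of test
functions. -/
structure AsymptoticallyVanishing (D : Dispersion d m) (a : ℕ)
    (G : (Fin r → ℝ) → (Fin r → Space d → Fin m → ℂ) → ℂ) : Prop where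
  generalized : ∀ τ, IsGeneralizedFunction (G τ)
  growth : ∀ K : Set (Space d), IsCompact K → ∃ (N Q : ℕ) (B : ℝ), 0 ≤ B ∧
    ∀ (τ : Fin r → ℝ) (h : Fin r → Space d → Fin m → ℂ) (M : Fin r → ℝ),
      (∀ i, IsTest (h i) ∧ tsupport (h i) ⊆ K ∧
        ∀ n ≤ N, ∀ k, ‖iteratedFDeriv ℝ n (h i) k‖ ≤ M i) →
      ‖G τ h‖ ≤ B * ∏ i, ((1 + |τ i|) ^ Q * M i)
  tendsto : ∀ h : Fin r → Space d → Fin m → ℂ, (∀ i, IsTest (h i)) → NonOverlapping D a h →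
    ∀ κ : ℝ, Tendsto (fun τ => G τ h) (asymptoticTimes r a κ) (𝓝 0)

/-- The times that have the asymptotic signs, are at least one, and have ratios at most `κ`. -/
def timeRegion (r a : ℕ) (κ : ℝ) : Set (Fin r → ℝ) :=
  {τ | (∀ i : Fin r, if i.val < a then τ i ≤ -1 else 1 ≤ τ i) ∧ ∀ i j, |τ i| ≤ κ * |τ j|}

theorem exists_abs_le_imp_of_mem_asymptoticTimes {κ : ℝ} {s : Set (Fin r → ℝ)}
    (hs : s ∈ asymptoticTimes r a κ) :
    ∃ R : ℝ, ∀ τ ∈ timeRegion r a κ, (∀ i, R ≤ |τ i|) → τ ∈ s := by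
  obtain ⟨I, -, t, ht, hsub⟩ := Filter.mem_pi.1 (mem_inf_principal.1 hs)
  have h1 : ∀ i : Fin r, ∃ R : ℝ, ∀ x, (if i.val < a then x ≤ -R else R ≤ x) → x ∈ t i := by
    intro i
    have hi := ht i
    split_ifs at hi with h
    · obtain ⟨R, hR⟩ := mem_atBot_sets.1 hi
      exact ⟨-R, fun x hx => hR x (by simpa [h] using hx)⟩
    · obtain ⟨R, hR⟩ := mem_atTop_sets.1 hi
      exact ⟨R, fun x hx => hR x (by simpa [h] using hx)⟩
  choose R hR using h1
  refine ⟨∑ i, |R i|, fun τ hτ hle => hsub (fun i _ => hR i _ ?_) hτ.2⟩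
  have h2 : R i ≤ |τ i| := (le_abs_self _).trans
    ((Finset.single_le_sum (f := fun i => |R i|) (fun _ _ => abs_nonneg _)
      (Finset.mem_univ i)).trans (hle i))
  have h3 := hτ.1 i
  split_ifs at h3 ⊢
  · rw [abs_of_nonpos (by linarith)] at h2
    linarith
  · rwa [abs_of_nonneg (by linarith)] at h2

variable {G : (Fin r → ℝ) → (Fin r → Space d → Fin m → ℂ) → ℂ}

/-- On the region of admissible times a single family of test functions gives bounded values: far out
by convergence, and elsewhere by the bound on the growth. -/
theorem AsymptoticallyVanishing.exists_norm_le (hG : AsymptoticallyVanishing D a G)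
    {h : Fin r → Space d → Fin m → ℂ} (hh : ∀ i, IsTest (h i)) (hno : NonOverlapping D a h)
    (κ : ℝ) : ∃ B : ℝ, ∀ τ ∈ timeRegion r a κ, ‖G τ h‖ ≤ B := by
  have h1 : {τ | ‖G τ h‖ ≤ 1} ∈ asymptoticTimes r a κ := by
    have := (hG.tendsto h hh hno κ).norm
    rw [norm_zero] at this
    exact this.eventually_le_const one_pos
  obtain ⟨R, hR⟩ := exists_abs_le_imp_of_mem_asymptoticTimes h1
  obtain ⟨N, Q, B, hB, hb⟩ := hG.growth (⋃ i, tsupport (h i))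
    (isCompact_iUnion fun i => (hh i).2.isCompact)
  choose M hM0 hM using fun i => (hh i).exists_bound N
  refine ⟨max 1 (B * ∏ i, ((1 + |κ| * R) ^ Q * M i)), fun τ hτ => ?_⟩
  by_cases hle : ∀ i, R ≤ |τ i|
  · exact (hR τ hτ hle).trans (le_max_left _ _)
  · push Not at hle
    obtain ⟨i, hi⟩ := hle
    refine (hb τ h M fun i => ⟨hh i, Set.subset_iUnion (fun i => tsupport (h i)) i, hM i⟩).trans
      (le_trans ?_ (le_max_right _ _))
    refine mul_le_mul_of_nonneg_left (Finset.prod_le_prod (fun j _ => ?_) fun j _ => ?_) hB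
    · have := hM0 j
      positivity
    · refine mul_le_mul_of_nonneg_right (pow_le_pow_left₀ (by positivity) ?_ Q) (hM0 j)
      have h2 : κ * |τ i| ≤ |κ| * R :=
        (mul_le_mul_of_nonneg_right (le_abs_self κ) (abs_nonneg _)).trans
          (mul_le_mul_of_nonneg_left hi.le (abs_nonneg _))
      linarith [hτ.2 j i]

/-- By the uniform boundedness principle, a family of generalized functions that vanishes
asymptotically is bounded uniformly on superpositions of non-overlapping test functions. -/
theorem AsymptoticallyVanishing.exists_norm_vecMul_le (hG : AsymptoticallyVanishing D a G)
    {f : Fin r → Space d → Fin m → ℂ} (hf : ∀ i, IsTest (f i)) (hno : NonOverlapping D a f)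
    {Q : Fin r → ℝ → Space d → Matrix (Fin m) (Fin m) ℂ}
    (hQ : ∀ i j l, Rapid fun p : ℝ × Space d => Q i p.1 p.2 j l) (κ : ℝ) :
    ∃ B : ℝ, ∀ τ ∈ timeRegion r a κ, ∀ σ : Fin r → ℝ,
      ‖G τ fun i k => Matrix.vecMul (f i k) (legMat a i (Q i (σ i) k))‖ ≤
        B * ∏ i, ((1 + |σ i|) ^ 2)⁻¹ := by
  let L : TopologicalSpace.Compacts (Space d) :=
    ⟨⋃ i, tsupport (f i), isCompact_iUnion fun i => (hf i).2.isCompact⟩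
  have hsub : ∀ i, tsupport (f i) ⊆ L := fun i => Set.subset_iUnion (fun i => tsupport (f i)) i
  obtain ⟨N, P, B, hB, hb⟩ := hG.growth L L.isCompact
  have hΨ : ∀ τ, ∃ Ψ : ContinuousMultilinearMap ℂ (fun _ : Fin r => BoundedTest m L N) ℂ,
      ∀ h, Ψ h = G τ fun i => (h i).val := fun τ =>
    (hG.generalized τ).exists_continuousMultilinearMap_of_bound
      (B := B * ∏ i, (1 + |τ i|) ^ P) fun h => by
      have := hb τ (fun i => (h i).val) (fun i => ‖h i‖) fun i => ⟨(h i).isTest,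
        (h i).tsupport_val_subset, fun n hn k => (h i).norm_iteratedFDeriv_le hn k⟩
      rwa [Finset.prod_mul_distrib, ← mul_assoc] at this
  choose Ψ hΨ using hΨ
  choose T hT1 hT2 using fun i => exists_mixture_clm (hf i) a i (hQ i) (hsub i) N
  let F : Fin r → ℝ → BoundedTest m L N := fun i σ =>
    BoundedTest.mk' L N (fun k => Matrix.vecMul (f i k) (legMat a i (Q i σ k)))
      (isTest_vecMul_rapid (hf i) a i (hQ i) σ) ((tsupport_vecMul_subset _).trans (hsub i))
  have hTF : ∀ i σ, T i (lp.single 1 σ 1) = ((1 + |σ| : ℝ) : ℂ) ^ 2 • F i σ := fun i σ =>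
    BoundedTest.val_injective (by
      rw [hT2, BoundedTest.val_smul]
      rfl)
  -- A superposition multiplies each test function by a smooth matrix, hence is non-overlapping, and
  -- the values on it are bounded in `τ`; so the multilinear maps on weights are uniformly bounded.
  obtain ⟨K, hK⟩ := ContinuousMultilinearMap.exists_norm_le_of_pointwise
    (g := fun τ : timeRegion r a κ => (Ψ τ).compContinuousLinearMap T) fun c => by
      choose M hM1 hM2 using fun i => hT1 i (c i)
      obtain ⟨B, hB⟩ := hG.exists_norm_le (fun i => isTest_vecMul (hf i) (hM1 i))
        (hno.vecMul hf hM1) κ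
      refine ⟨B, fun τ => ?_⟩
      rw [ContinuousMultilinearMap.compContinuousLinearMap_apply, hΨ]
      simp only [hM2]
      exact hB τ τ.2
  refine ⟨K, fun τ hτ σ => ?_⟩
  -- Evaluate at unit weights: `T` maps them to `(1 + |σ|) ^ 2` times the modified test functions.
  have h1 := ((Ψ τ).compContinuousLinearMap T).le_of_opNorm_le (hK ⟨τ, hτ⟩)
    fun i => lp.single 1 (σ i) 1
  have h2 : ∏ i, ‖(lp.single 1 (σ i) 1 : Weights)‖ = 1 :=
    Finset.prod_eq_one fun i _ => (lp.norm_single (by simp) (σ i) _).trans norm_one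
  rw [ContinuousMultilinearMap.compContinuousLinearMap_apply] at h1
  simp only [hTF, h2, mul_one] at h1
  rw [ContinuousMultilinearMap.map_smul_univ, norm_smul, norm_prod, hΨ] at h1
  have h3 : ∏ i, ‖((1 + |σ i| : ℝ) : ℂ) ^ 2‖ = ∏ i, (1 + |σ i|) ^ 2 :=
    Finset.prod_congr rfl fun i _ => by
      rw [norm_pow, Complex.norm_real, Real.norm_of_nonneg (by positivity)]
  rw [h3] at h1
  rw [Finset.prod_inv_distrib, ← div_eq_mul_inv, le_div_iff₀ (by positivity), mul_comm]
  exact h1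

theorem add_mem_timeRegion {κ : ℝ} {τ σ : Fin r → ℝ}
    (hs : ∀ i : Fin r, if i.val < a then τ i < 0 else 0 < τ i) (h2 : ∀ i, 2 ≤ |τ i|)
    (hκ : ∀ i j, |τ i| ≤ κ * |τ j|) (hσ : ∀ i, |σ i| ≤ |τ i| / 2) :
    (fun i => τ i + σ i) ∈ timeRegion r a (3 * κ) := by
  refine ⟨fun i => ?_, fun i j => ?_⟩
  · have h3 := hs i
    have h4 := h2 i
    have h5 := abs_le.1 (hσ i)
    split_ifs at h3 ⊢
    · rw [abs_of_neg h3] at h4 h5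
      linarith
    · rw [abs_of_pos h3] at h4 h5
      linarith
  · have h3 : |τ i + σ i| ≤ 3 / 2 * |τ i| := (abs_add_le _ _).trans (by linarith [hσ i])
    have h4 : |τ j| / 2 ≤ |τ j + σ j| := by
      have := abs_sub_abs_le_abs_sub (τ j) (-σ j)
      rw [abs_neg, sub_neg_eq_add] at this
      linarith [hσ j]
    have h5 : 0 ≤ κ := by
      have := hκ j j
      nlinarith [h2 j]
    nlinarith [hκ i j, mul_le_mul_of_nonneg_left h4 h5]

/-- A majorant, integrable in the shifts `σ` and independent of the times. Small shifts stay within the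
admissible times; when a shift is comparable with the times, the growth in time is compensated by
the rapid decrease in that shift. -/
theorem AsymptoticallyVanishing.exists_eventually_norm_le (hG : AsymptoticallyVanishing D a G)
    {f : Fin r → Space d → Fin m → ℂ} (hf : ∀ i, IsTest (f i)) (hno : NonOverlapping D a f)
    {Q : Fin r → ℝ → Space d → Matrix (Fin m) (Fin m) ℂ}
    (hQ : ∀ i j l, Rapid fun p : ℝ × Space d => Q i p.1 p.2 j l) (κ : ℝ) :
    ∃ B : ℝ, ∀ᶠ τ in asymptoticTimes r a κ, ∀ σ : Fin r → ℝ,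
      ‖G (fun i => τ i + σ i) fun i k => Matrix.vecMul (f i k) (legMat a i (Q i (σ i) k))‖ ≤
        B * ∏ i, ((1 + |σ i|) ^ 2)⁻¹ := by
  obtain ⟨B₁, hB₁⟩ := hG.exists_norm_vecMul_le hf hno hQ (3 * κ)
  obtain ⟨N, P, B, hB, hb⟩ := hG.growth (⋃ i, tsupport (f i))
    (isCompact_iUnion fun i => (hf i).2.isCompact)
  -- The decrease in `σ i` has to compensate the growth in all times.
  choose c hc0 hc using fun i =>
    exists_norm_iteratedFDeriv_vecMul_le (hf i) a i (hQ i) N (2 * P * r + 2)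
  let B₂ := B * ((1 + 2 * |κ|) ^ (P * r) * ∏ i, c i)
  have hB₂ : 0 ≤ B₂ := mul_nonneg hB (mul_nonneg (by positivity)
    (Finset.prod_nonneg fun i _ => hc0 i))
  refine ⟨max B₁ B₂, ?_⟩
  filter_upwards [eventually_sign_asymptoticTimes, eventually_ratio_asymptoticTimes,
    eventually_all.2 fun i => (tendsto_abs_asymptoticTimes i).eventually_ge_atTop 2]
    with τ hs hκ h2 σ
  have hprod : 0 ≤ ∏ i, ((1 + |σ i|) ^ 2)⁻¹ := Finset.prod_nonneg fun i _ => by positivity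
  by_cases hσ : ∀ i, |σ i| ≤ |τ i| / 2
  · exact (hB₁ _ (add_mem_timeRegion hs h2 hκ hσ) σ).trans
      (mul_le_mul_of_nonneg_right (le_max_left _ _) hprod)
  · refine le_trans ?_ (mul_le_mul_of_nonneg_right (le_max_right B₁ B₂) hprod)
    push Not at hσ
    obtain ⟨i₀, hi₀⟩ := hσ
    set p := ∏ i, (1 + |σ i|) with hp
    have hp0 : 0 < p := Finset.prod_pos fun i _ => by positivity
    have hle : ∀ i, 1 + |σ i| ≤ p := fun i => by
      rw [hp, ← Finset.mul_prod_erase _ _ (Finset.mem_univ i)]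
      exact le_mul_of_one_le_right (by positivity)
        (Finset.one_le_prod fun j _ => by linarith [abs_nonneg (σ j)])
    refine (hb _ _ (fun i => c i * ((1 + |σ i|) ^ (2 * P * r + 2))⁻¹) fun i =>
      ⟨isTest_vecMul_rapid (hf i) a i (hQ i) (σ i), (tsupport_vecMul_subset _).trans
        (Set.subset_iUnion (fun i => tsupport (f i)) i),
        fun n hn k => hc i n hn (σ i) k⟩).trans ?_
    have h3 : ∀ j, 1 + |τ j + σ j| ≤ (1 + 2 * |κ|) * p ^ 2 := by
      intro j
      have e1 : |τ j| ≤ 2 * |κ| * |σ i₀| := by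
        have := mul_le_mul_of_nonneg_right (le_abs_self κ) (abs_nonneg (τ i₀))
        nlinarith [hκ j i₀, abs_nonneg κ]
      have e2 := abs_add_le (τ j) (σ j)
      have e3 : (1 + |σ i₀|) * (1 + |σ j|) ≤ p * p :=
        mul_le_mul (hle i₀) (hle j) (by positivity) hp0.le
      have e4 := mul_le_mul_of_nonneg_left e3 (by positivity : 0 ≤ 1 + 2 * |κ|)
      have e5 : 1 + |τ j + σ j| ≤ (1 + 2 * |κ|) * ((1 + |σ i₀|) * (1 + |σ j|)) := by
        have p1 := mul_nonneg (abs_nonneg κ) (abs_nonneg (σ j))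
        have p2 := mul_nonneg (abs_nonneg (σ i₀)) (abs_nonneg (σ j))
        have p3 := mul_nonneg (abs_nonneg κ) p2
        have p4 := abs_nonneg κ
        have p5 := abs_nonneg (σ i₀)
        nlinarith
      nlinarith
    have h4 : ∏ j, ((1 + |τ j + σ j|) ^ P * (c j * ((1 + |σ j|) ^ (2 * P * r + 2))⁻¹)) ≤
        ∏ j, (((1 + 2 * |κ|) * p ^ 2) ^ P * (c j * ((1 + |σ j|) ^ (2 * P * r + 2))⁻¹)) :=
      Finset.prod_le_prod (fun j _ => mul_nonneg (by positivity)
        (mul_nonneg (hc0 j) (by positivity))) fun j _ => mul_le_mul_of_nonneg_right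
          (pow_le_pow_left₀ (by positivity) (h3 j) P) (mul_nonneg (hc0 j) (by positivity))
    refine (mul_le_mul_of_nonneg_left h4 hB).trans_eq ?_
    simp only [Finset.prod_mul_distrib, Finset.prod_inv_distrib, Finset.prod_pow,
      Finset.prod_const, Finset.card_univ, Fintype.card_fin, ← hp, B₂]
    have e : ((p ^ r) ^ 2) ^ P = p ^ (2 * P * r) := by
      rw [← pow_mul, ← pow_mul]
      congr 1
      ring
    rw [mul_pow, e, ← pow_mul, mul_comm r P, pow_add]
    field_simp

theorem tendsto_add_asymptoticTimes (κ : ℝ) (σ : Fin r → ℝ) :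
    Tendsto (fun (τ : Fin r → ℝ) i => τ i + σ i) (asymptoticTimes r a κ)
      (asymptoticTimes r a (3 * κ)) := by
  refine tendsto_inf.2 ⟨tendsto_pi.2 fun i => ?_, tendsto_principal.2 ?_⟩
  · have h : Tendsto (fun τ : Fin r → ℝ => τ i) (asymptoticTimes r a κ)
        (if i.val < a then atBot else atTop) :=
      (tendsto_eval_pi (fun i : Fin r => if i.val < a then (atBot : Filter ℝ) else atTop)
        i).mono_left inf_le_left
    split_ifs at h ⊢
    · exact tendsto_atBot_add_const_right _ _ h
    · exact tendsto_atTop_add_const_right _ _ h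
  · filter_upwards [eventually_sign_asymptoticTimes, eventually_ratio_asymptoticTimes,
      eventually_all.2 fun i => (tendsto_abs_asymptoticTimes i).eventually_ge_atTop 2,
      eventually_all.2 fun i => (tendsto_abs_asymptoticTimes i).eventually_ge_atTop (2 * |σ i|)]
      with τ hs hκ h2 hσ
    exact (add_mem_timeRegion hs h2 hκ fun i => by linarith [hσ i]).2

instance (r a : ℕ) (κ : ℝ) : (asymptoticTimes r a κ).IsCountablyGenerated := by
  have : ∀ i : Fin r, (if i.val < a then (atBot : Filter ℝ) else atTop).IsCountablyGenerated := by
    intro i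
    split_ifs <;> infer_instance
  unfold asymptoticTimes
  infer_instance

/-- Asymptotic vanishing is preserved by superpositions over time shifts, with rapidly decreasing
weights. -/
theorem AsymptoticallyVanishing.tendsto_integral {Λ : Type*} [Fintype Λ]
    {G : Λ → (Fin r → ℝ) → (Fin r → Space d → Fin m → ℂ) → ℂ}
    (hG : ∀ l, AsymptoticallyVanishing D a (G l))
    {f : Fin r → Space d → Fin m → ℂ} (hf : ∀ i, IsTest (f i)) (hno : NonOverlapping D a f)
    {Q : Λ → Fin r → ℝ → Space d → Matrix (Fin m) (Fin m) ℂ}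
    (hQ : ∀ l i j y, Rapid fun p : ℝ × Space d => Q l i p.1 p.2 j y)
    (hm : ∀ τ : Fin r → ℝ, AEStronglyMeasurable fun σ : Fin r → ℝ => ∑ l, G l (fun i => τ i + σ i)
      fun i k => Matrix.vecMul (f i k) (legMat a i (Q l i (σ i) k))) (κ : ℝ) :
    Tendsto (fun τ : Fin r → ℝ => ∫ σ : Fin r → ℝ, ∑ l, G l (fun i => τ i + σ i)
      fun i k => Matrix.vecMul (f i k) (legMat a i (Q l i (σ i) k)))
      (asymptoticTimes r a κ) (𝓝 0) := by
  choose B hB using fun l => (hG l).exists_eventually_norm_le hf hno (hQ l) κ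
  have h := tendsto_integral_filter_of_dominated_convergence (l := asymptoticTimes r a κ)
    (μ := volume)
    (F := fun (τ σ : Fin r → ℝ) => ∑ l, G l (fun i => τ i + σ i)
      fun i k => Matrix.vecMul (f i k) (legMat a i (Q l i (σ i) k))) (f := fun _ => 0)
    (fun σ => ∑ l, B l * ∏ i, ((1 + |σ i|) ^ 2)⁻¹) (.of_forall hm) ?_ ?_ ?_
  · simpa only [integral_zero] using h
  · filter_upwards [eventually_all.2 hB] with τ hτ
    exact .of_forall fun σ => (norm_sum_le _ _).trans (Finset.sum_le_sum fun l _ => hτ l σ)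
  · exact integrable_finsetSum _ fun l _ => (Integrable.fintype_prod
      (f := fun _ (s : ℝ) => ((1 + |s|) ^ 2)⁻¹) fun _ => integrable_inv_one_add_abs_sq).const_mul _
  · refine .of_forall fun σ => ?_
    have h0 := tendsto_finsetSum (Finset.univ : Finset Λ) fun l (_ : l ∈ Finset.univ) =>
      ((hG l).tendsto (fun i k => Matrix.vecMul (f i k) (legMat a i (Q l i (σ i) k)))
        (fun i => isTest_vecMul_rapid (hf i) a i (hQ l i) (σ i))
        (hno.vecMul hf fun i j y => contDiff_legConj (contDiff_slice (hQ l i j y).1 (σ i)))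
          (3 * κ)).comp (tendsto_add_asymptoticTimes κ σ)
    simpa only [Finset.sum_const_zero, Function.comp_def] using h0

end Vanishing

end AQFT

namespace AQFT

/-! ### The remainder of a Green function after subtraction of its polar part -/

section Remainder

variable {d m r a : ℕ}

theorem exists_norm_iteratedFDeriv_vecMul_moderate_le (a : ℕ) (i : Fin r)
    {M : ℝ → Space d → Matrix (Fin m) (Fin m) ℂ}
    (hM : ∀ j l, Moderate fun p : ℝ × Space d => M p.1 p.2 j l) {K : Set (Space d)}
    (hK : IsCompact K) (N : ℕ) : ∃ (c : ℝ) (Q : ℕ), 0 ≤ c ∧ ∀ (f : Space d → Fin m → ℂ) (b : ℝ),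
      IsTest f → tsupport f ⊆ K → (∀ n ≤ N, ∀ k, ‖iteratedFDeriv ℝ n f k‖ ≤ b) →
      ∀ τ, ∀ n ≤ N, ∀ k, ‖iteratedFDeriv ℝ n
        (fun k => Matrix.vecMul (f k) (legMat a i (M τ k))) k‖ ≤ c * (1 + |τ|) ^ Q * b := by
  choose c Q hc0 hc using fun p : Fin m × Fin m =>
    ((hM p.1 p.2).legConj (a := a) (i := i)).bound_le hK N
  have hc1 : 0 ≤ ∑ p, c p := Finset.sum_nonneg fun p _ => hc0 p
  refine ⟨m ^ 2 * 2 ^ N * ∑ p, c p, ∑ p, Q p, by positivity, fun f b hf hs hb τ n hn k => ?_⟩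
  have h := norm_iteratedFDeriv_vecMul_le hf (M := fun k => legMat a i (M τ k))
    (fun j l => contDiff_legConj (contDiff_slice (hM j l).1 τ)) (N := N)
    (K := (∑ p, c p) * (1 + |τ|) ^ (∑ p, Q p)) (by positivity) hb (fun j l n hn k hk => by
      refine (norm_iteratedFDeriv_slice_le (hM j l).legConj.1 τ k n).trans
        ((hc (j, l) n hn τ k (hs hk)).trans ?_)
      have h1 : c (j, l) ≤ ∑ p, c p :=
        Finset.single_le_sum (fun p _ => hc0 p) (Finset.mem_univ (j, l))
      have h2 : Q (j, l) ≤ ∑ p, Q p :=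
        Finset.single_le_sum (fun p _ => Nat.zero_le _) (Finset.mem_univ (j, l))
      exact mul_le_mul h1 (pow_le_pow_right₀ (by linarith [abs_nonneg τ]) h2) (by positivity) hc1)
    hn k
  refine h.trans_eq ?_
  ring

theorem vecMul_update (h : Fin r → Space d → Fin m → ℂ)
    (M : Fin r → Space d → Matrix (Fin m) (Fin m) ℂ) (i : Fin r) (u : Space d → Fin m → ℂ) :
    (fun j k => Matrix.vecMul (Function.update h i u j k) (M j k)) =
      Function.update (fun j k => Matrix.vecMul (h j k) (M j k)) i
        fun k => Matrix.vecMul (u k) (M i k) :=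
  funext fun j => Function.apply_update
    (fun j (f : Space d → Fin m → ℂ) k => Matrix.vecMul (f k) (M j k)) h i u j

theorem IsGeneralizedFunction.vecMul {C : (Fin r → Space d → Fin m → ℂ) → ℂ}
    (hC : IsGeneralizedFunction C) (a : ℕ) {M : Fin r → Space d → Matrix (Fin m) (Fin m) ℂ}
    (hM : ∀ i j l, ContDiff ℝ ((⊤ : ℕ∞) : WithTop ℕ∞) fun k => M i k j l) :
    IsGeneralizedFunction fun h => C fun i k => Matrix.vecMul (h i k) (legMat a i (M i k)) := by
  have ht : ∀ i {f : Space d → Fin m → ℂ}, IsTest f →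
      IsTest fun k => Matrix.vecMul (f k) (legMat a i (M i k)) := fun i f hf =>
    isTest_vecMul hf fun j l => contDiff_legConj (hM i j l)
  refine ⟨fun h i u v hh hu hv => ?_, fun h i c u hh hu => ?_, fun K hK => ?_⟩
  · simp only [vecMul_update h fun i k => legMat a i (M i k)]
    rw [← hC.map_add _ i _ _ (fun j => ht j (hh j)) (ht i hu) (ht i hv)]
    congr 2
    exact funext fun k => Matrix.add_vecMul _ _ _
  · simp only [vecMul_update h fun i k => legMat a i (M i k)]
    rw [← hC.map_smul _ i c _ (fun j => ht j (hh j)) (ht i hu)]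
    congr 2
    exact funext fun k => by rw [Pi.smul_apply, Pi.smul_apply, Matrix.smul_vecMul]
  · obtain ⟨N, B, hB⟩ := hC.continuous K hK
    choose c Q hc0 hc using fun i => exists_norm_iteratedFDeriv_vecMul_moderate_le a i
      (M := fun _ => M i) (fun j l => Moderate.of_momentum (hM i j l)) hK N
    refine ⟨N, B * ∏ i, c i, fun h b hb => ?_⟩
    refine (hB _ (fun i => c i * b i) fun i => ⟨ht i (hb i).1,
      (tsupport_vecMul_subset _).trans (hb i).2.1, fun n hn k => ?_⟩).trans_eq ?_
    · simpa using hc i (h i) (b i) (hb i).1 (hb i).2.1 (hb i).2.2 0 n hn k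
    · rw [Finset.prod_mul_distrib, mul_assoc]

theorem IsGeneralizedFunction.sub {C C' : (Fin r → Space d → Fin m → ℂ) → ℂ}
    (hC : IsGeneralizedFunction C) (hC' : IsGeneralizedFunction C') :
    IsGeneralizedFunction fun h => C h - C' h := by
  refine ⟨fun h i u v hh hu hv => ?_, fun h i c u hh hu => ?_, fun K hK => ?_⟩
  · rw [hC.map_add h i u v hh hu hv, hC'.map_add h i u v hh hu hv]
    ring
  · rw [hC.map_smul h i c u hh hu, hC'.map_smul h i c u hh hu]
    ring
  · obtain ⟨N, B, hB⟩ := hC.continuous K hK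
    obtain ⟨N', B', hB'⟩ := hC'.continuous K hK
    refine ⟨max N N', B + B', fun h M hM => (norm_sub_le _ _).trans ?_⟩
    rw [add_mul]
    exact add_le_add
      (hB h M fun i => ⟨(hM i).1, (hM i).2.1, fun n hn => (hM i).2.2 n (le_max_of_le_left hn)⟩)
      (hB' h M fun i => ⟨(hM i).1, (hM i).2.1, fun n hn => (hM i).2.2 n (le_max_of_le_right hn)⟩)

variable {𝒜 : Type*} [Ring 𝒜] [StarRing 𝒜] [Algebra ℂ 𝒜] [StarModule ℂ 𝒜]
  {S : TranslationInvariantState d 𝒜} {D : Dispersion d m} {A : Fin m → 𝒜} {B : ℝ}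

theorem integrable_prod_packet_mul_green (hB : 0 ≤ B) (hA : ∀ i, OpNormLE S (A i) B)
    {f : Fin r → Space d → Fin m → ℂ} (hf : ∀ i, IsTest (f i)) (D : Dispersion d m)
    (μ ν : Fin r → Fin m) (τ : Fin r → ℝ) (j : Fin r → Fin m) :
    Integrable fun x : Fin r → Space d =>
      (∏ i, packet D a i (f i) (μ i) (ν i) (τ i) (x i) (j i)) * green S A a τ x j :=
  (integrable_prod_packet hf D a μ ν j τ).mul_bdd (c := B ^ r)
    (continuous_ω_chronological hA (q := fun (x : Fin r → Space d) i => (τ i, x i))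
      (fun i => by fun_prop) τ j).aestronglyMeasurable
    (.of_forall fun x => norm_green_le hB hA _ _ _)

theorem prod_packet_update (D : Dispersion d m) (a : ℕ) (h : Fin r → Space d → Fin m → ℂ)
    (i : Fin r) (u : Space d → Fin m → ℂ) (μ ν j : Fin r → Fin m) (τ : Fin r → ℝ)
    (x : Fin r → Space d) :
    ∏ l, packet D a l (Function.update h i u l) (μ l) (ν l) (τ l) (x l) (j l) =
      packet D a i u (μ i) (ν i) (τ i) (x i) (j i) *
        ∏ l ∈ Finset.univ.erase i, packet D a l (h l) (μ l) (ν l) (τ l) (x l) (j l) := by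
  rw [← Finset.mul_prod_erase _ _ (Finset.mem_univ i), Function.update_self]
  congr 1
  exact Finset.prod_congr rfl fun l hl => by rw [Function.update_of_ne (Finset.ne_of_mem_erase hl)]

theorem packet_add {u v : Space d → Fin m → ℂ} (hu : IsTest u) (hv : IsTest v)
    (D : Dispersion d m) (a : ℕ) (i : Fin r) (μ ν j : Fin m) (τ : ℝ) (x : Space d) :
    packet D a i (u + v) μ ν τ x j = packet D a i u μ ν τ x j + packet D a i v μ ν τ x j :=
  wave_add D a i (hu.contDiff_apply j).continuous (hu.hasCompactSupport_apply j)
    (hv.contDiff_apply j).continuous (hv.hasCompactSupport_apply j) μ ν τ x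

theorem exists_norm_smearedGreen_le (hB : 0 ≤ B) (hA : ∀ i, OpNormLE S (A i) B)
    (D : Dispersion d m) (a : ℕ) (μ ν : Fin r → Fin m) {K : Set (Space d)} (hK : IsCompact K) :
    ∃ b : ℝ, 0 ≤ b ∧ ∀ (τ : Fin r → ℝ) (h : Fin r → Space d → Fin m → ℂ) (M : Fin r → ℝ),
      (∀ i, IsTest (h i) ∧ tsupport (h i) ⊆ K ∧
        ∀ n ≤ d + 1, ∀ k, ‖iteratedFDeriv ℝ n (h i) k‖ ≤ M i) →
      ‖smearedGreen S D A a h μ ν τ‖ ≤ b * ∏ i, ((1 + |τ i|) ^ (d + 1) * M i) := by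
  choose c hc0 hc using fun i : Fin r => exists_norm_packet_le D a i hK (d + 1)
  let I : ℝ := ∫ x : Space d, ((1 + ‖x‖) ^ (d + 1))⁻¹
  have hI : 0 ≤ I := integral_nonneg fun x => by positivity
  have hcI : 0 ≤ ∏ i, (c i * I) := Finset.prod_nonneg fun i _ => mul_nonneg (hc0 i) hI
  refine ⟨∑ _j : Fin r → Fin m, B ^ r * ∏ i, (c i * I),
    Finset.sum_nonneg fun _ _ => by positivity, fun τ h M hM => ?_⟩
  rw [Finset.sum_mul]
  refine (norm_sum_le _ _).trans (Finset.sum_le_sum fun j _ => ?_)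
  have hg : Integrable fun x : Fin r → Space d =>
      (∏ i, (c i * M i * (1 + |τ i|) ^ (d + 1) * ((1 + ‖x i‖) ^ (d + 1))⁻¹)) * B ^ r :=
    (Integrable.fintype_prod (f := fun i (x : Space d) =>
      c i * M i * (1 + |τ i|) ^ (d + 1) * ((1 + ‖x‖) ^ (d + 1))⁻¹) fun i =>
        integrable_inv_one_add_norm_pow.const_mul _).mul_const _
  refine (norm_integral_le_of_norm_le hg (.of_forall fun x => ?_)).trans_eq ?_
  · rw [norm_mul, norm_prod]
    refine mul_le_mul (Finset.prod_le_prod (fun _ _ => norm_nonneg _) fun i _ => ?_)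
      (norm_green_le hB hA _ _ _) (norm_nonneg _) (Finset.prod_nonneg fun i _ => ?_)
    · exact hc i (h i) (M i) (hM i).1 (hM i).2.1 (hM i).2.2 _ _ _ _ _
    · have := (norm_nonneg _).trans ((hM i).2.2 0 (Nat.zero_le _) 0)
      have := hc0 i
      positivity
  · rw [integral_mul_const, volume_pi, integral_fintype_prod_eq_prod (f := fun i (x : Space d) =>
      c i * M i * (1 + |τ i|) ^ (d + 1) * ((1 + ‖x‖) ^ (d + 1))⁻¹)]
    simp only [integral_const_mul, Finset.prod_mul_distrib, I]
    ring

theorem isGeneralizedFunction_smearedGreen (hB : 0 ≤ B) (hA : ∀ i, OpNormLE S (A i) B)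
    (D : Dispersion d m) (a : ℕ) (μ ν : Fin r → Fin m) (τ : Fin r → ℝ) :
    IsGeneralizedFunction fun h => smearedGreen S D A a h μ ν τ := by
  have ht : ∀ {h : Fin r → Space d → Fin m → ℂ} {i : Fin r} {u : Space d → Fin m → ℂ},
      (∀ j, IsTest (h j)) → IsTest u → ∀ j, IsTest (Function.update h i u j) := by
    intro h i u hh hu j
    by_cases hj : j = i
    · subst hj
      rwa [Function.update_self]
    · rw [Function.update_of_ne hj]
      exact hh j
  refine ⟨fun h i u v hh hu hv => ?_, fun h i c u hh hu => ?_, fun K hK => ?_⟩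
  · simp only [smearedGreen, ← Finset.sum_add_distrib]
    refine Finset.sum_congr rfl fun j _ => ?_
    rw [← integral_add (integrable_prod_packet_mul_green hB hA (ht hh hu) D μ ν τ j)
      (integrable_prod_packet_mul_green hB hA (ht hh hv) D μ ν τ j)]
    refine congrArg _ (funext fun x => ?_)
    rw [prod_packet_update, prod_packet_update, prod_packet_update, packet_add hu hv]
    ring
  · simp only [smearedGreen, Finset.mul_sum]
    refine Finset.sum_congr rfl fun j _ => ?_
    rw [← integral_const_mul]
    refine congrArg _ (funext fun x => ?_)
    rw [prod_packet_update, prod_packet_update]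
    have e : packet D a i (c • u) (μ i) (ν i) (τ i) (x i) (j i) =
        c * packet D a i u (μ i) (ν i) (τ i) (x i) (j i) := wave_const_mul D a i c _ _ _ _ _
    rw [e]
    ring
  · obtain ⟨b, -, hb⟩ := exists_norm_smearedGreen_le hB hA D a μ ν hK
    refine ⟨d + 1, b * ∏ i, (1 + |τ i|) ^ (d + 1), fun h M hM => (hb τ h M hM).trans_eq ?_⟩
    rw [Finset.prod_mul_distrib, mul_assoc]

/-- The Green function smeared with wave packets, minus the contribution of the polar part. -/
noncomputable def polarRemainder (S : TranslationInvariantState d 𝒜) (D : Dispersion d m)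
    (A : Fin m → 𝒜) (t : Fin m → ElemSpace d m) (a : ℕ)
    (C : (Fin r → Space d → Fin m → ℂ) → ℂ) (μ ν : Fin r → Fin m) (τ : Fin r → ℝ)
    (h : Fin r → Space d → Fin m → ℂ) : ℂ :=
  smearedGreen S D A a h μ ν τ -
    C fun i k => Matrix.vecMul (h i k) (legMat a i (polarMat D t (μ i) (ν i) (τ i) k))

/-- The definition of a polar coefficient, together with the polynomial growth of the Green function
and of the polar term. -/
theorem IsPolarCoefficient.asymptoticallyVanishing {t : Fin m → ElemSpace d m}
    {C : (Fin r → Space d → Fin m → ℂ) → ℂ} (hC : IsPolarCoefficient S D A t a C) (hB : 0 ≤ B)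
    (hA : ∀ i, OpNormLE S (A i) B) (ht : ∀ k, (ampMatrix t k).det ≠ 0) (μ ν : Fin r → Fin m) :
    AsymptoticallyVanishing D a (polarRemainder S D A t a C μ ν) := by
  refine ⟨fun τ => (isGeneralizedFunction_smearedGreen hB hA D a μ ν τ).sub
    (hC.generalized.vecMul a fun i j l => contDiff_slice
      (moderate_polarMat D ht (μ i) (ν i) j l).1 (τ i)), fun K hK => ?_, fun h hh hno κ => ?_⟩
  · obtain ⟨b, hb0, hb⟩ := exists_norm_smearedGreen_le hB hA D a μ ν hK
    obtain ⟨N, B', hB'⟩ := hC.generalized.continuous K hK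
    choose c Q hc0 hc using fun i => exists_norm_iteratedFDeriv_vecMul_moderate_le a i
      (M := polarMat D t (μ i) (ν i)) (moderate_polarMat D ht (μ i) (ν i)) hK N
    have hc1 : 0 ≤ ∏ i, c i := Finset.prod_nonneg fun i _ => hc0 i
    refine ⟨max (d + 1) N, max (d + 1) (∑ i, Q i), b + |B'| * ∏ i, c i, by positivity,
      fun τ h M hM => (norm_sub_le _ _).trans ?_⟩
    have hM0 : ∀ i, 0 ≤ M i := fun i =>
      (norm_nonneg _).trans ((hM i).2.2 0 (Nat.zero_le _) 0)
    have h1 : ∀ i, 1 ≤ 1 + |τ i| := fun i => by linarith [abs_nonneg (τ i)]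
    have hpow : ∀ i {q : ℕ}, q ≤ max (d + 1) (∑ i, Q i) →
        (1 + |τ i|) ^ q * M i ≤ (1 + |τ i|) ^ max (d + 1) (∑ i, Q i) * M i := fun i q hq =>
      mul_le_mul_of_nonneg_right (pow_le_pow_right₀ (h1 i) hq) (hM0 i)
    have hpos : ∀ i (q : ℕ), 0 ≤ (1 + |τ i|) ^ q * M i := fun i q =>
      mul_nonneg (by positivity) (hM0 i)
    rw [add_mul]
    refine add_le_add ?_ ?_
    · refine (hb τ h M fun i => ⟨(hM i).1, (hM i).2.1, fun n hn =>
        (hM i).2.2 n (le_max_of_le_left hn)⟩).trans (mul_le_mul_of_nonneg_left ?_ hb0)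
      exact Finset.prod_le_prod (fun i _ => hpos i _) fun i _ => hpow i (le_max_left _ _)
    · refine (hB' _ (fun i => c i * (1 + |τ i|) ^ Q i * M i) fun i => ⟨?_, ?_, ?_⟩).trans ?_
      · exact isTest_vecMul (hM i).1 fun j l => contDiff_legConj (contDiff_slice
          (moderate_polarMat D ht (μ i) (ν i) j l).1 (τ i))
      · exact (tsupport_vecMul_subset _).trans (hM i).2.1
      · exact hc i (h i) (M i) (hM i).1 (hM i).2.1
          (fun n hn => (hM i).2.2 n (le_max_of_le_right hn)) (τ i)
      · have e : ∏ i, (c i * (1 + |τ i|) ^ Q i * M i) =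
            (∏ i, c i) * ∏ i, ((1 + |τ i|) ^ Q i * M i) := by
          simp only [mul_assoc, Finset.prod_mul_distrib]
        rw [e, ← mul_assoc]
        refine mul_le_mul (mul_le_mul_of_nonneg_right (le_abs_self _) hc1)
          (Finset.prod_le_prod (fun i _ => hpos i _) fun i _ => hpow i ?_)
          (Finset.prod_nonneg fun i _ => hpos i _) (by positivity)
        exact (Finset.single_le_sum (f := Q) (fun _ _ => Nat.zero_le _)
          (Finset.mem_univ i)).trans (le_max_right _ _)
  · have h1 := hC.asymptotics h hh hno μ ν κ
    simpa only [smul_vecMul_eq_polarMat, polarRemainder] using h1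

end Remainder

/-! ### The polar coefficient for the smeared operators -/

section Existence

variable {d m r a : ℕ} {𝒜 : Type*} [Ring 𝒜] [StarRing 𝒜] [Algebra ℂ 𝒜] [StarModule ℂ 𝒜]
  {S : TranslationInvariantState d 𝒜} {D : Dispersion d m} {A A' : Fin m → 𝒜}
  {α : Fin m → Fin m → 𝓢(ℝ × Space d, ℂ)} {T T' : Fin m → ElemSpace d m}

/-- Matrices intertwining the amplitudes intertwine the energies. -/
theorem expI_opEnergy_mul {k : Space d} {M : Matrix (Fin m) (Fin m) ℂ}
    (hM : ampMatrix T' k = M * ampMatrix T k) (hT : (ampMatrix T k).det ≠ 0)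
    (hT' : (ampMatrix T' k).det ≠ 0) (s : ℝ) :
    expI s (opEnergy D T' k) * M = M * expI s (opEnergy D T k) := by
  have h1 : M = ampMatrix T' k * (ampMatrix T k)⁻¹ := by
    rw [hM, Matrix.mul_assoc, Matrix.mul_nonsing_inv _ (isUnit_iff_ne_zero.2 hT), Matrix.mul_one]
  rw [expI_opEnergy D T hT, expI_opEnergy D T' hT', h1]
  simp only [Matrix.mul_assoc]
  rw [Matrix.nonsing_inv_mul_cancel_left _ _ (isUnit_iff_ne_zero.2 hT'),
    Matrix.nonsing_inv_mul_cancel_left _ _ (isUnit_iff_ne_zero.2 hT)]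

/-- The Green function of the smeared operators has the polar coefficient `⊗ α(H, k) C`: up to
reordering, its remainder is a superposition of the remainders for the original operators. -/
theorem IsPolarCoefficient.smearing {C : (Fin r → Space d → Fin m → ℂ) → ℂ} {B : ℝ}
    (hC : IsPolarCoefficient S D A T a C) (hB : 1 ≤ B) (hA : ∀ i, OpNormLE S (A i) B)
    (hcomm : AsymptoticallyCommute S A) (hA' : IsSmearing S α A A')
    (hM : ∀ k, ampMatrix T' k = symbolAt α (opEnergy D T k) k * ampMatrix T k)
    (hT : ∀ k, (ampMatrix T k).det ≠ 0) (hT' : ∀ k, (ampMatrix T' k).det ≠ 0) :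
    IsPolarCoefficient S D A' T' a (tensorMul a (fun k => symbolAt α (opEnergy D T k) k) C) := by
  have hB0 : 0 ≤ B := zero_le_one.trans hB
  have hMc : ∀ j l, ContDiff ℝ ((⊤ : ℕ∞) : WithTop ℕ∞)
      fun k => symbolAt α (opEnergy D T k) k j l := by
    have e : ∀ k, symbolAt α (opEnergy D T k) k = ampMatrix T' k * (ampMatrix T k)⁻¹ := fun k => by
      rw [hM, Matrix.mul_assoc, Matrix.mul_nonsing_inv _ (isUnit_iff_ne_zero.2 (hT k)),
        Matrix.mul_one]
    simp only [e]
    exact contDiff_matrix_mul (contDiff_ampMatrix T') (contDiff_matrix_inv (contDiff_ampMatrix T) hT)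
  refine ⟨hC.generalized.vecMul a (M := fun _ k => symbolAt α (opEnergy D T k) k) fun _ => hMc,
    fun f hf hno μ ν κ => ?_⟩
  have h1 := tendsto_smearedGreen_sub (S := S) (D := D) (a := a) hA' hcomm hB hA hf hno μ ν κ
  have hg := fun τ => integral_smearedIntegrand_eq (S := S) (D := D) (α := α) (a := a) hB0 hA hf μ ν τ
  have hp := fun τ => hC.generalized.integral_polar (D := D) (a := a) hT α hf μ ν τ
  have hs : ∀ (i : Fin r) (lam : Fin m) (σ : ℝ), smearedTest D α a i (ν i) lam (f i) σ =
      fun k => Matrix.vecMul (f i k) (legMat a i (symbolSlice D α (ν i) lam σ k)) :=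
    fun _ _ _ => rfl
  simp only [hs] at hg hp
  have h2 := AsymptoticallyVanishing.tendsto_integral
    (fun lam : Fin r → Fin m => hC.asymptoticallyVanishing hB0 hA hT μ lam) hf hno
    (Q := fun lam i => symbolSlice D α (ν i) (lam i))
    (fun lam i => rapid_symbolSlice D α (ν i) (lam i)) (fun τ => by
      simp only [polarRemainder, Finset.sum_sub_distrib]
      exact (hg τ).1.aestronglyMeasurable.sub (hp τ).1.aestronglyMeasurable) κ
  have e : ∀ τ : Fin r → ℝ, tensorMul a (fun k => symbolAt α (opEnergy D T k) k) C
      (fun i k => legConj a i (expI (τ i) (D.E k) (μ i) (ν i)) •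
        Matrix.vecMul (f i k) (legMat a i (expI (-τ i) (opEnergy D T' k)))) =
      C (fun i k => Matrix.vecMul (f i k) (legMat a i (expI (τ i) (D.E k) (μ i) (ν i) •
          (symbolAt α (opEnergy D T k) k * expI (-τ i) (opEnergy D T k))))) := by
    intro τ
    refine congrArg C (funext fun i => funext fun k => ?_)
    rw [Matrix.smul_vecMul, vecMul_legMat_mul, expI_opEnergy_mul (hM k) (hT k) (hT' k), legMat_smul,
      Matrix.vecMul_smul]
  simp only [e]
  -- The error of the reordering, plus the superposition of the remainders.
  have h3 := h1.add h2
  rw [add_zero] at h3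
  refine h3.congr fun τ => ?_
  simp only [polarRemainder, Finset.sum_sub_distrib]
  rw [integral_sub (hg τ).1 (hp τ).1, ← (hp τ).2, (hg τ).2]
  ring

end Existence

end AQFT

namespace AQFT

/-! ### Uniqueness of the polar coefficient -/

section Uniqueness

variable {d m r a : ℕ}

instance (r a : ℕ) : (asymptoticTimes r a 1).NeBot := by
  have h : Tendsto (fun (s : ℝ) (i : Fin r) => if i.val < a then -s else s) atTop
      (asymptoticTimes r a 1) := by
    refine tendsto_inf.2 ⟨tendsto_pi.2 fun i => ?_, tendsto_principal.2 (.of_forall fun s i j => ?_)⟩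
    · split_ifs
      · exact tendsto_neg_atTop_atBot
      · exact tendsto_id
    · have e : ∀ i : Fin r, |if i.val < a then -s else s| = |s| := fun i => by
        split_ifs
        exacts [abs_neg s, rfl]
      rw [e, e, one_mul]
  exact h.neBot

/-- Multilinear expansion of a generalized function along decompositions of unity by matrices, one for
each leg. -/
theorem IsGeneralizedFunction.eq_sum_vecMul {C : (Fin r → Space d → Fin m → ℂ) → ℂ}
    (hC : IsGeneralizedFunction C) {h : Fin r → Space d → Fin m → ℂ} (hh : ∀ i, IsTest (h i))
    {L : Type*} [Fintype L] {R : Fin r → L → Space d → Matrix (Fin m) (Fin m) ℂ}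
    (hR : ∀ i l j y, ContDiff ℝ ((⊤ : ℕ∞) : WithTop ℕ∞) fun k => R i l k j y)
    (hR1 : ∀ i k, ∑ l, R i l k = 1) :
    C h = ∑ l : Fin r → L, C fun i k => Matrix.vecMul (h i k) (legMat a i (R i (l i) k)) := by
  let K : TopologicalSpace.Compacts (Space d) :=
    ⟨⋃ i, tsupport (h i), isCompact_iUnion fun i => (hh i).2.isCompact⟩
  have hsub : ∀ i, tsupport (h i) ⊆ K := fun i => Set.subset_iUnion (fun i => tsupport (h i)) i
  obtain ⟨N, Ψ, hΨ⟩ := hC.exists_continuousMultilinearMap K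
  let F : Fin r → L → BoundedTest m K N := fun i l =>
    BoundedTest.mk' K N (fun k => Matrix.vecMul (h i k) (legMat a i (R i l k)))
      (isTest_vecMul (hh i) fun j y => contDiff_legConj (hR i l j y))
      ((tsupport_vecMul_subset _).trans (hsub i))
  have hF : (fun i => (∑ l, F i l).val) = h := by
    ext i k y
    rw [BoundedTest.val_sum, Finset.sum_apply, Finset.sum_apply]
    change ∑ l, ∑ j, h i k j * legConj a i (R i l k j y) = h i k y
    rw [Finset.sum_comm]
    have e : ∀ j, ∑ l, h i k j * legConj a i (R i l k j y) =
        h i k j * legMat a i (1 : Matrix (Fin m) (Fin m) ℂ) j y := fun j => by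
      rw [← hR1 i k, legMat, Matrix.map_apply, Matrix.sum_apply, legConj_sum, Finset.mul_sum]
    simp only [e, legMat_one]
    exact congrFun (Matrix.vecMul_one (h i k)) y
  calc C h = Ψ fun i => ∑ l, F i l := by rw [hΨ, hF]
    _ = ∑ l : Fin r → L, Ψ fun i => F i (l i) := Ψ.map_sum F
    _ = _ := Finset.sum_congr rfl fun l _ => hΨ _

variable {D : Dispersion d m} {t : Fin m → ElemSpace d m}

/-- The time dependence of `polarMat` is undone by summation over the components of the wave
packets, so every test function is a sum of wave packets at any given time. -/
theorem sum_single_mul_polarMat (D : Dispersion d m) (k : Space d)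
    (ht : (ampMatrix t k).det ≠ 0) (τ : ℝ) :
    ∑ p : Fin m × Fin m, ampMatrix t k * Matrix.single p.2 p.1 (1 : ℂ) * (ampMatrix t k)⁻¹ *
      polarMat D t p.1 p.2 τ k = 1 := by
  have hu := isUnit_iff_ne_zero.2 ht
  have e : ∀ p : Fin m × Fin m, ampMatrix t k * Matrix.single p.2 p.1 (1 : ℂ) *
      (ampMatrix t k)⁻¹ * polarMat D t p.1 p.2 τ k = ampMatrix t k *
        Matrix.single p.2 p.1 (expI τ (D.E k) p.1 p.2) *
          ((expI (-τ) (D.E k)).transpose * (ampMatrix t k)⁻¹) := by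
    intro p
    have e1 : Matrix.single p.2 p.1 (expI τ (D.E k) p.1 p.2) =
        expI τ (D.E k) p.1 p.2 • Matrix.single p.2 p.1 (1 : ℂ) := by
      rw [Matrix.smul_single, smul_eq_mul, mul_one]
    rw [polarMat, expI_opEnergy D t ht, e1]
    simp only [Matrix.mul_assoc, Matrix.mul_smul, Matrix.smul_mul]
    rw [Matrix.nonsing_inv_mul_cancel_left _ _ hu]
  have e2 : ∑ p : Fin m × Fin m, Matrix.single p.2 p.1 (expI τ (D.E k) p.1 p.2) =
      (expI τ (D.E k)).transpose := by
    rw [Fintype.sum_prod_type_right]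
    exact (Matrix.matrix_eq_sum_single (expI τ (D.E k)).transpose).symm
  simp only [e, ← Finset.sum_mul, ← Finset.mul_sum, e2]
  rw [Matrix.mul_assoc, ← Matrix.mul_assoc (expI τ (D.E k)).transpose, ← Matrix.transpose_mul,
    ← expI_add, neg_add_cancel, expI_zero, Matrix.transpose_one, Matrix.one_mul,
    Matrix.mul_nonsing_inv _ hu]

variable {𝒜 : Type*} [Ring 𝒜] [StarRing 𝒜] [Algebra ℂ 𝒜] [StarModule ℂ 𝒜]
  {S : TranslationInvariantState d 𝒜} {A : Fin m → 𝒜}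

/-- Both coefficients describe the asymptotics of the same Green function. The decomposition of test
functions into wave packets makes the difference of their values a sum of such asymptotically
vanishing differences, and it does not depend on time. -/
theorem IsPolarCoefficient.unique {C C' : (Fin r → Space d → Fin m → ℂ) → ℂ}
    (hC : IsPolarCoefficient S D A t a C) (hC' : IsPolarCoefficient S D A t a C')
    (ht : ∀ k, (ampMatrix t k).det ≠ 0) {h : Fin r → Space d → Fin m → ℂ}
    (hh : ∀ i, IsTest (h i)) (hno : NonOverlapping D a h) : C h = C' h := by
  let W : Fin m × Fin m → Space d → Matrix (Fin m) (Fin m) ℂ := fun p k =>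
    ampMatrix t k * Matrix.single p.2 p.1 (1 : ℂ) * (ampMatrix t k)⁻¹
  have hW : ∀ p j l, ContDiff ℝ ((⊤ : ℕ∞) : WithTop ℕ∞) fun k => W p k j l := fun p =>
    contDiff_matrix_mul (contDiff_matrix_mul (contDiff_ampMatrix t) fun _ _ => contDiff_const)
      (contDiff_matrix_inv (contDiff_ampMatrix t) ht)
  let f : (Fin r → Fin m × Fin m) → Fin r → Space d → Fin m → ℂ := fun p i k =>
    Matrix.vecMul (h i k) (legMat a i (W (p i) k))
  have hf : ∀ p i, IsTest (f p i) := fun p i =>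
    isTest_vecMul (hh i) fun j l => contDiff_legConj (hW (p i) j l)
  have hfno : ∀ p, NonOverlapping D a (f p) := fun p =>
    hno.vecMul hh fun i j l => contDiff_legConj (hW (p i) j l)
  have hgen := hC.generalized.sub hC'.generalized
  have h1 : ∀ τ : Fin r → ℝ, C h - C' h = ∑ p : Fin r → Fin m × Fin m,
      ((C fun i k => Matrix.vecMul (f p i k)
          (legMat a i (polarMat D t (p i).1 (p i).2 (τ i) k))) -
        C' fun i k => Matrix.vecMul (f p i k)
          (legMat a i (polarMat D t (p i).1 (p i).2 (τ i) k))) := by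
    intro τ
    have := hgen.eq_sum_vecMul (a := a) hh
      (R := fun i p k => W p k * polarMat D t p.1 p.2 (τ i) k)
      (fun i p => contDiff_matrix_mul (hW p) fun j l =>
        contDiff_slice (moderate_polarMat D ht p.1 p.2 j l).1 (τ i))
      fun i k => sum_single_mul_polarMat D k (ht k) (τ i)
    simpa only [f, vecMul_legMat_mul] using this
  have h2 : Tendsto (fun _ : Fin r → ℝ => C h - C' h) (asymptoticTimes r a 1) (𝓝 0) := by
    have h3 : ∀ p : Fin r → Fin m × Fin m, Tendsto (fun τ : Fin r → ℝ =>
        (C fun i k => Matrix.vecMul (f p i k)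
          (legMat a i (polarMat D t (p i).1 (p i).2 (τ i) k))) -
        C' fun i k => Matrix.vecMul (f p i k)
          (legMat a i (polarMat D t (p i).1 (p i).2 (τ i) k))) (asymptoticTimes r a 1) (𝓝 0) := by
      intro p
      have e1 := hC.asymptotics (f p) (hf p) (hfno p) (fun i => (p i).1) (fun i => (p i).2) 1
      have e2 := hC'.asymptotics (f p) (hf p) (hfno p) (fun i => (p i).1) (fun i => (p i).2) 1
      have e3 := e2.sub e1
      simp only [smul_vecMul_eq_polarMat, sub_self] at e3
      exact e3.congr fun τ => by ring
    have h4 := tendsto_finsetSum Finset.univ fun p (_ : p ∈ Finset.univ) => h3 p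
    rw [Finset.sum_const_zero] at h4
    exact h4.congr fun τ => (h1 τ).symm
  exact sub_eq_zero.1 (tendsto_nhds_unique tendsto_const_nhds h2)

end Uniqueness

/-! ### Polar parts -/

section PolarParts

variable {d m r a : ℕ} {D : Dispersion d m} {t : Fin m → ElemSpace d m}

/-- A Hermitian matrix has no eigenvalues off the real axis. -/
theorem det_sub_smul_one_ne_zero {M : Matrix (Fin m) (Fin m) ℂ} (hM : M.IsHermitian) {z : ℂ}
    (hz : z.im ≠ 0) : (M - z • (1 : Matrix (Fin m) (Fin m) ℂ)).det ≠ 0 := by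
  intro h0
  obtain ⟨v, hv, hv0⟩ := Matrix.exists_mulVec_eq_zero_iff.2 h0
  rw [Matrix.sub_mulVec, Matrix.smul_mulVec, Matrix.one_mulVec, sub_eq_zero] at hv0
  have h1 : star v ⬝ᵥ M.mulVec v = z * (star v ⬝ᵥ v) := by
    rw [hv0, dotProduct_smul, smul_eq_mul]
  have h2 : (star v ⬝ᵥ M.mulVec v).im = 0 := hM.im_star_dotProduct_mulVec_self v
  have h3 : (star v ⬝ᵥ v).im = 0 := by
    have := Matrix.isHermitian_one.im_star_dotProduct_mulVec_self (𝕜 := ℂ) v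
    rwa [Matrix.one_mulVec] at this
  rw [h1, Complex.mul_im, h3, mul_zero, zero_add] at h2
  open scoped ComplexOrder in
  exact hv (dotProduct_star_self_eq_zero.1
    (Complex.ext ((mul_eq_zero.1 h2).resolve_left hz) h3 : star v ⬝ᵥ v = 0))

theorem legMat_sub_smul_one (a : ℕ) (i : Fin r) (M : Matrix (Fin m) (Fin m) ℂ) (z : ℂ) :
    legMat a i M - z • (1 : Matrix (Fin m) (Fin m) ℂ) =
      legMat a i (M - legConj a i z • (1 : Matrix (Fin m) (Fin m) ℂ)) := by
  unfold legMat legConj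
  split_ifs
  · ext j l
    simp
  · ext j l
    by_cases h : j = l <;> simp [h]

theorem det_legMat (a : ℕ) (i : Fin r) (M : Matrix (Fin m) (Fin m) ℂ) :
    (legMat a i M).det = legConj a i M.det := by
  unfold legMat legConj
  split_ifs
  · congr 1
  · exact (RingHom.map_det (starRingEnd ℂ) M).symm

theorem det_legMat_opEnergy_sub_ne_zero (D : Dispersion d m) (a : ℕ) (i : Fin r) {k : Space d}
    (ht : (ampMatrix t k).det ≠ 0) {z : ℂ} (hz : z.im < 0) :
    (legMat a i (opEnergy D t k) - z • (1 : Matrix (Fin m) (Fin m) ℂ)).det ≠ 0 := by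
  have hu := isUnit_iff_ne_zero.2 ht
  rw [legMat_sub_smul_one, det_legMat, ← norm_ne_zero_iff, norm_legConj, norm_ne_zero_iff]
  have e : ∀ w : ℂ, opEnergy D t k - w • (1 : Matrix (Fin m) (Fin m) ℂ) =
      ampMatrix t k * (D.E k - w • (1 : Matrix (Fin m) (Fin m) ℂ)).transpose *
        (ampMatrix t k)⁻¹ := fun w => by
    rw [Matrix.transpose_sub, Matrix.transpose_smul, Matrix.transpose_one, Matrix.mul_sub,
      Matrix.sub_mul, Matrix.mul_smul, Matrix.smul_mul, Matrix.mul_one,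
      Matrix.mul_nonsing_inv _ hu, opEnergy]
  rw [e, Matrix.det_conj ((Matrix.isUnit_iff_isUnit_det _).2 hu), Matrix.det_transpose]
  refine det_sub_smul_one_ne_zero (D.hermitian k) ?_
  unfold legConj
  split_ifs
  · exact hz.ne
  · rw [Complex.conj_im]
    exact neg_ne_zero.2 hz.ne

theorem contDiff_opEnergy (D : Dispersion d m) (ht : ∀ k, (ampMatrix t k).det ≠ 0) (j l : Fin m) :
    ContDiff ℝ ((⊤ : ℕ∞) : WithTop ℕ∞) fun k => opEnergy D t k j l :=
  contDiff_matrix_mul (contDiff_matrix_mul (contDiff_ampMatrix t) fun j l => (D.growth l j).1)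
    (contDiff_matrix_inv (contDiff_ampMatrix t) ht) j l

/-- The matrix `(H - ε)⁻¹` of the polar part. -/
noncomputable def resolvent (D : Dispersion d m) (t : Fin m → ElemSpace d m) (a : ℕ) (i : Fin r)
    (z : ℂ) (k : Space d) : Matrix (Fin m) (Fin m) ℂ :=
  (legMat a i (opEnergy D t k) - z • (1 : Matrix (Fin m) (Fin m) ℂ))⁻¹

theorem contDiff_resolvent (D : Dispersion d m) (ht : ∀ k, (ampMatrix t k).det ≠ 0) (a : ℕ)
    (i : Fin r) {z : ℂ} (hz : z.im < 0) (j l : Fin m) :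
    ContDiff ℝ ((⊤ : ℕ∞) : WithTop ℕ∞) fun k => resolvent D t a i z k j l := by
  refine contDiff_matrix_inv (fun p q => ?_)
    (fun k => det_legMat_opEnergy_sub_ne_zero D a i (ht k) hz) j l
  exact (contDiff_legConj (contDiff_opEnergy D ht p q)).sub contDiff_const

/-- Matrices intertwining the amplitudes intertwine the resolvents of the energies. -/
theorem resolvent_mul {T T' : Fin m → ElemSpace d m} {k : Space d}
    {M : Matrix (Fin m) (Fin m) ℂ}
    (hM : ampMatrix T' k = M * ampMatrix T k) (hT : (ampMatrix T k).det ≠ 0)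
    (hT' : (ampMatrix T' k).det ≠ 0) (D : Dispersion d m) (a : ℕ) (i : Fin r) {z : ℂ}
    (hz : z.im < 0) :
    resolvent D T' a i z k * legMat a i M = legMat a i M * resolvent D T a i z k := by
  have h1 : M = ampMatrix T' k * (ampMatrix T k)⁻¹ := by
    rw [hM, Matrix.mul_assoc, Matrix.mul_nonsing_inv _ (isUnit_iff_ne_zero.2 hT), Matrix.mul_one]
  have h2 : opEnergy D T' k * M = M * opEnergy D T k := by
    rw [opEnergy, opEnergy, h1]
    simp only [Matrix.mul_assoc]
    rw [Matrix.nonsing_inv_mul_cancel_left _ _ (isUnit_iff_ne_zero.2 hT'),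
      Matrix.nonsing_inv_mul_cancel_left _ _ (isUnit_iff_ne_zero.2 hT)]
  have hu := isUnit_iff_ne_zero.2 (det_legMat_opEnergy_sub_ne_zero D a i hT hz)
  have hu' := isUnit_iff_ne_zero.2 (det_legMat_opEnergy_sub_ne_zero D a i hT' hz)
  have h3 : (legMat a i (opEnergy D T' k) - z • (1 : Matrix (Fin m) (Fin m) ℂ)) * legMat a i M =
      legMat a i M * (legMat a i (opEnergy D T k) - z • (1 : Matrix (Fin m) (Fin m) ℂ)) := by
    rw [Matrix.sub_mul, Matrix.mul_sub, ← legMat_mul, ← legMat_mul, h2, Matrix.smul_mul,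
      Matrix.mul_smul, Matrix.one_mul, Matrix.mul_one]
  calc _ = (legMat a i (opEnergy D T' k) - z • (1 : Matrix (Fin m) (Fin m) ℂ))⁻¹ * (legMat a i M *
        (legMat a i (opEnergy D T k) - z • (1 : Matrix (Fin m) (Fin m) ℂ))) *
          resolvent D T a i z k := by
        rw [Matrix.mul_assoc, Matrix.mul_assoc, resolvent, resolvent, Matrix.mul_nonsing_inv _ hu,
          Matrix.mul_one]
    _ = _ := by rw [← h3, Matrix.nonsing_inv_mul_cancel_left _ _ hu']

variable {𝒜 : Type*} [Ring 𝒜] [StarRing 𝒜] [Algebra ℂ 𝒜] [StarModule ℂ 𝒜]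
  {S : TranslationInvariantState d 𝒜} {A' : Fin m → 𝒜} {T T' : Fin m → ElemSpace d m}
  {M : Space d → Matrix (Fin m) (Fin m) ℂ} {C C' : (Fin r → Space d → Fin m → ℂ) → ℂ}
  {ε : Fin r → ℂ} {h : Fin r → Space d → Fin m → ℂ}

/-- By uniqueness `C'` may be replaced by `⊗ M C`, and `M` is moved through the resolvents. -/
theorem polarPart_eq_tensorMul (hM : ∀ k, ampMatrix T' k = M k * ampMatrix T k)
    (hT : ∀ k, (ampMatrix T k).det ≠ 0) (hT' : ∀ k, (ampMatrix T' k).det ≠ 0)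
    (hC : IsPolarCoefficient S D A' T' a (tensorMul a M C))
    (hC' : IsPolarCoefficient S D A' T' a C') (hε : ∀ i, (ε i).im < 0) (hh : ∀ i, IsTest (h i))
    (hno : NonOverlapping D a h) :
    polarPart D T' a C' ε h = tensorMul a M (polarPart D T a C ε) h := by
  have hR : ∀ i j l, ContDiff ℝ ((⊤ : ℕ∞) : WithTop ℕ∞)
      fun k => resolvent D T' a i (ε i) k j l := fun i =>
    contDiff_resolvent D hT' a i (hε i)
  have h1 := hC'.unique hC hT' (fun i => isTest_vecMul (hh i) (hR i)) (hno.vecMul hh hR)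
  -- The resolvents are smooth, so uniqueness applies to the test functions multiplied by them.
  refine congrArg (Complex.I ^ r * ·) (h1.trans (congrArg C (funext fun i => funext fun k => ?_)))
  rw [Matrix.vecMul_vecMul, resolvent_mul (hM k) (hT k) (hT' k) D a i (hε i),
    ← Matrix.vecMul_vecMul]
  rfl

/-- The normalization turns `T'⁻¹ M` into `T⁻¹`. -/
theorem normalizedPolarPart_eq (hM : ∀ k, ampMatrix T' k = M k * ampMatrix T k)
    (hT : ∀ k, (ampMatrix T k).det ≠ 0) (hT' : ∀ k, (ampMatrix T' k).det ≠ 0)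
    (hC : IsPolarCoefficient S D A' T' a (tensorMul a M C))
    (hC' : IsPolarCoefficient S D A' T' a C') (hε : ∀ i, (ε i).im < 0) (hh : ∀ i, IsTest (h i))
    (hno : NonOverlapping D a h) :
    normalizedPolarPart D T' a C' ε h = normalizedPolarPart D T a C ε h := by
  have hR : ∀ (i : Fin r) j l, ContDiff ℝ ((⊤ : ℕ∞) : WithTop ℕ∞)
      fun k => legMat a i (ampMatrix T' k)⁻¹ j l := fun i j l =>
    contDiff_legConj (contDiff_matrix_inv (contDiff_ampMatrix T') hT' j l)
  refine (polarPart_eq_tensorMul hM hT hT' hC hC' hε (fun i => isTest_vecMul (hh i) (hR i))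
    (hno.vecMul hh hR)).trans (congrArg (polarPart D T a C ε) (funext fun i => funext fun k => ?_))
  have e : (ampMatrix T' k)⁻¹ * M k = (ampMatrix T k)⁻¹ := by
    have h1 : M k = ampMatrix T' k * (ampMatrix T k)⁻¹ := by
      rw [hM, Matrix.mul_assoc, Matrix.mul_nonsing_inv _ (isUnit_iff_ne_zero.2 (hT k)),
        Matrix.mul_one]
    rw [h1, Matrix.nonsing_inv_mul_cancel_left _ _ (isUnit_iff_ne_zero.2 (hT' k))]
  rw [vecMul_legMat_mul, e]

end PolarParts

end AQFT

theorem mainTheorem4 {d m : ℕ} {𝒜 : Type*} [Ring 𝒜] [StarRing 𝒜] [Algebra ℂ 𝒜] [StarModule ℂ 𝒜]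
    (S : TranslationInvariantState d 𝒜) (D : Dispersion d m) (Φ : ElementaryExcitation S D)
    (A A' : Fin m → 𝒜) (α : Fin m → Fin m → 𝓢(ℝ × Space d, ℂ))
    (hbdd : ∀ i, ∃ B : ℝ, OpNormLE S (A i) B)
    (hcomm : AsymptoticallyCommute S A)
    (hA' : IsSmearing S α A A')
    (T T' : Fin m → ElemSpace d m)
    (hT : ∀ i, IsOneParticleProjection Φ (A i) (T i))
    (hT' : ∀ i, IsOneParticleProjection Φ (A' i) (T' i))
    (hdet : ∀ k, (ampMatrix T k).det ≠ 0) :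
    (∀ i k β, T' i k β = ∑ j, ∫ p : ℝ × Space d,
        α i j p * planeWave k p.2 * (expI (-p.1) (D.E k)).mulVec (T j k).ofLp β) ∧
    (∀ k, ampMatrix T' k = symbolAt α (opEnergy D T k) k * ampMatrix T k) ∧
    ((∀ k, (ampMatrix T' k).det ≠ 0) →
      ∀ (r a : ℕ) (C : (Fin r → Space d → Fin m → ℂ) → ℂ),
        IsPolarCoefficient S D A T a C →
        IsPolarCoefficient S D A' T' a
          (tensorMul a (fun k => symbolAt α (opEnergy D T k) k) C) ∧
        ∀ C' : (Fin r → Space d → Fin m → ℂ) → ℂ, IsPolarCoefficient S D A' T' a C' →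
          ∀ ε : Fin r → ℂ, (∀ i, (ε i).im < 0) →
            ∀ h : Fin r → Space d → Fin m → ℂ, (∀ i, IsTest (h i)) → NonOverlapping D a h →
              polarPart D T' a C' ε h =
                tensorMul a (fun k => symbolAt α (opEnergy D T k) k) (polarPart D T a C ε) h ∧
              normalizedPolarPart D T' a C' ε h = normalizedPolarPart D T a C ε h) := by
  have hM : ∀ k, ampMatrix T' k = symbolAt α (opEnergy D T k) k * ampMatrix T k := fun k =>
    ampMatrix_eq_symbolAt_mul Φ hA' hT hT' (hdet k)
  refine ⟨fun i k β => ?_, hM, fun hdet' r a C hC => ?_⟩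
  · rw [amplitude_smearing Φ hA' hT hT' i k β]
    exact Finset.sum_congr rfl fun j _ => (integral_smearing_mulVec D (α i j) (T j) β k).symm
  · choose B hB using hbdd
    have hB' : ∀ i, OpNormLE S (A i) (1 + ∑ j, |B j|) := fun i => (hB i).mono
      ((le_abs_self _).trans ((Finset.single_le_sum (f := fun j => |B j|)
        (fun _ _ => abs_nonneg _) (Finset.mem_univ i)).trans (le_add_of_nonneg_left zero_le_one)))
    have hC' := hC.smearing (le_add_of_nonneg_right (Finset.sum_nonneg fun _ _ => abs_nonneg _))
      hB' hcomm hA' hM hdet hdet'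
    exact ⟨hC', fun C' h1 ε hε h hh hno =>
      ⟨polarPart_eq_tensorMul hM hdet hdet' hC' h1 hε hh hno,
        normalizedPolarPart_eq hM hdet hdet' hC' h1 hε hh hno⟩⟩
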